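/- Let $d\ge 1$, let $D\subset\mathbb R^d$ be open, and let $\kappa\ge 1$ be an integer. Equip $\mathbb R^d$ with the Euclidean norm and $\mathbb R^{d\times d}$ with the induced operator norm $\|\cdot\|_2$. For a Banach space $X$, use on $W^{\eta,p}(D;X)$ the norm $$\|v\|_{\eta,p,D}=\sum_{|\alpha|\le\eta}\frac1{\alpha!}\,\|\partial_x^\alpha v\|_{L^p(D;X)},$$ and write $H^{\eta}(D)=W^{\eta,2}(D;\mathbb R)$ and $H^1_0(D)$ for the closure of $C_c^\infty(D)$ in $H^1(D)$. Let $0<\underline a\le 1\le\overline a$ and $\underline a\le a\le\overline a$. *The coefficient.* Let $\sigma_0=1$, $\sigma_k\in\mathbb R$ for $k\ge1$, and $\psi_k\in W^{\kappa,\infty}(D;\mathbb R^d)$ for $k\ge 0$, be such that $\gamma_{\kappa,k}=\|\sigma_k\psi_k\|_{\kappa,\infty,D}$ satisfies $\sum_{k\ge0}\gamma_{\kappa,k}<\infty$, and put $c_{\gamma_\kappa}=\max\{\sum_{k\ge 0}\gamma_{\kappa,k},\,2\}$. Let $M\in\mathbb N$, $\square=[-1,1]^M$, and let $\mathbb P_y$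 be the uniform probability measure on $\square$. For $y\in\square$ let $$V[y]=\psi_0+\sum_{k=1}^M\sigma_k y_k\psi_k,\qquad A[y]=a I+\bigl(\|V[y]\|_2-a\bigr)\frac{V[y]V[y]^{\mathsf T}}{V[y]^{\mathsf T}V[y]},$$ and assume that for $\mathbb P_y$-almost every $y$ one has $\underline a\le\|V[y](x)\|_2\le\overline a$ for almost every $x\in D$. *Elliptic regularity.* Let $\mathcal R_\kappa$ be a Banach space of (classes of) measurable matrix fields $D\to\mathbb R^{d\times d}$ and let $s\mapsto C_{\kappa,er}(D,s)$ be a continuous function on $[0,\infty)$ such that, for every $B\in W^{\kappa,\infty}(D;\mathbb R^{d\times d})\cap\mathcal R_\kappa$ that is almost everywhere symmetric with all eigenvalues in $[\underline a,\overline a]$, and for every $h\in H^{\kappa-1}(D)$, there is a unique $w\in H^1_0(D)$ with $(B\nabla w,\nabla v)_{L^2(D;\mathbb R^d)}=(h,v)_{L^2(D)}$ for all $v\in H^1_0(D)$, and this $w$ lies in $H^{\kappa+1}(D)$ with $\|w\|_{\kappa+1,2,D}\le C_{\kappa,er}(D,\|B\|_{\mathcal R_\kappa})\,\|h\|_{\kappa-1,2,D}$.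 Assume that $A\in L^\infty_{\mathbb P_y}(\square;\mathcal R_\kappa)$ and put $$C_{\kappa,er}=\max_{0\le s\le\|A\|_{L^\infty_{\mathbb P_y}(\square;\mathcal R_\kappa)}}C_{\kappa,er}(D,s).$$ *Claim.* Let $f\in H^{\kappa-1}(D)$ and let $u\in L^\infty_{\mathbb P_y}(\square;H^1_0(D))$ be the solution of $$(A[y]\nabla u[y],\nabla v)_{L^2(D;\mathbb R^d)}=(f,v)_{L^2(D)}\qquad\text{for all }v\in H_0^1(D)\text{ and }\mathbb P_y\text{-almost every }y\in\square .$$ Then $u$ agrees $\mathbb P_y$-almost everywhere with an infinitely differentiable map $\square\to H^{\kappa+1}(D)$, again denoted by $u$ (derivatives at boundary points of $\square$ are taken within $\square$), and for every $\alpha\in\mathbb N^M$ one has $\partial_y^\alpha u\in L^\infty_{\mathbb P_y}(\square;H^{\kappa+1}(D))$ with $$\|\partial_y^\alpha u\|_{L^\infty_{\mathbb P_y}(\square;H^{\kappa+1}(D))}\le|\alpha|!\;\mu_\kappa^\alpha\;\Bigl(\max\bigl\{2,\;2\,C_{\kappa,er}\,\kappa^2d^2\,k_{\kappa,A},\;C_{\kappa,er}\|f\|_{\kappa-1,2,D}\bigr\}\Bigr)^{|\alpha|+1},$$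 where $\mu_\kappa^\alpha=\prod_{k=1}^M\mu_{\kappa,k}^{\alpha_k}$, $$\mu_{\kappa,k}=\frac{4c_{\gamma_\kappa}^2}{\underline a^2\log 2}\,\gamma_{\kappa,k},\qquad k_{\kappa,A}=\Bigl[(\kappa+1)\frac1{\underline a^2}\Bigl(\frac{2c_{\gamma_\kappa}^2}{\underline a^2}\Bigr)^{\kappa}+\overline a\Bigr]\,3(\kappa+1)\,\overline a\Bigl(\frac{2c_{\gamma_\kappa}^2}{\underline a^2}\Bigr)^{\kappa}c_{\gamma_\kappa}^2+\overline a .$$ -/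

import Mathlib

open MeasureTheory Set TopologicalSpace
open scoped ENNReal Distributions LineDeriv

noncomputable section

namespace AnisoDiff

/-- `ℝ^d` with the Euclidean norm. -/
abbrev Vec (d : ℕ) : Type := EuclideanSpace ℝ (Fin d)

/-- `ℝ^{d × d}` with the norm induced by the Euclidean norm, i.e. the endomorphisms of `ℝ^d` with
the operator norm. -/
abbrev Mat (d : ℕ) : Type := Vec d →L[ℝ] Vec d

/-- Lebesgue measure on the open set `D`. -/
abbrev vol {d : ℕ} (D : Opens (Vec d)) : Measure (Vec d) := volume.restrict (D : Set (Vec d))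

/-! ### Sobolev spaces -/

/-- The multi-indices `α ∈ ℕ^d` with `|α| ≤ k`. -/
def multiIdx (d k : ℕ) : Finset (Fin d → ℕ) :=
  (Fintype.piFinset fun _ => Finset.range (k + 1)).filter fun α => ∑ i, α i ≤ k

theorem mem_multiIdx {d k : ℕ} {α : Fin d → ℕ} : α ∈ multiIdx d k ↔ ∑ i, α i ≤ k := by
  simp only [multiIdx, Finset.mem_filter, Fintype.mem_piFinset, Finset.mem_range,
    and_iff_right_iff_imp]
  intro h i
  have := Finset.single_le_sum (f := α) (fun j _ => Nat.zero_le _) (Finset.mem_univ i)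
  omega

theorem zero_mem_multiIdx (d k : ℕ) : (0 : Fin d → ℕ) ∈ multiIdx d k := by
  simp [mem_multiIdx]

theorem single_mem_multiIdx {d k : ℕ} (hk : 1 ≤ k) (i : Fin d) :
    (Pi.single i 1 : Fin d → ℕ) ∈ multiIdx d k := by
  simpa [mem_multiIdx] using hk

/-- `α! = α₁! ⋯ α_d!`. -/
def multiFact {d : ℕ} (α : Fin d → ℕ) : ℕ := ∏ i, (α i).factorial

/-- The classical derivative `∂₁^{α₁} ⋯ ∂_d^{α_d} φ` of a test function `φ ∈ C_c^∞(D)`. -/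
def testDeriv {d : ℕ} {D : Opens (Vec d)} (α : Fin d → ℕ) (φ : 𝓓(D, ℝ)) : 𝓓(D, ℝ) :=
  (List.finRange d).foldr
    (fun i χ => (fun ρ : 𝓓(D, ℝ) => ∂_{(EuclideanSpace.single i 1 : Vec d)} ρ)^[α i] χ) φ

section Sobolev

variable {d : ℕ} {X : Type*} [NormedAddCommGroup X] [NormedSpace ℝ X]

/-- `w` is the weak derivative `∂^α v` in `D`. -/
def IsWeakDeriv (D : Opens (Vec d)) (α : Fin d → ℕ) (v w : Vec d → X) : Prop :=
  ∀ φ : 𝓓(D, ℝ), ∫ x, testDeriv α φ x • v x ∂vol D =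
    (-1 : ℝ) ^ (∑ i, α i) • ∫ x, φ x • w x ∂vol D

theorem integrable_test_smul {D : Opens (Vec d)} {p : ℝ≥0∞} [hp : Fact (1 ≤ p)]
    (φ : 𝓓(D, ℝ)) (v : Lp X p (vol D)) : Integrable (fun x => φ x • v x) (vol D) :=
  φ.integrable_bilin (ContinuousLinearMap.lsmul ℝ ℝ)
    ((((Lp.memLp v).locallyIntegrable hp.out)).locallyIntegrableOn _)

/-- The families `(v_α)_{|α| ≤ k}` of `L^p(D; X)`-functions such that `v_α` is the weak derivative
`∂^α v_0`. -/
def sobolevSubmodule (D : Opens (Vec d)) (k : ℕ) (p : ℝ≥0∞) [Fact (1 ≤ p)] (X : Type*)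
    [NormedAddCommGroup X] [NormedSpace ℝ X] :
    Submodule ℝ (multiIdx d k → Lp X p (vol D)) where
  carrier := {v | ∀ α : multiIdx d k,
    IsWeakDeriv D α.1 (v ⟨0, zero_mem_multiIdx d k⟩) (v α)}
  zero_mem' := by
    intro α φ
    have h : ∀ χ : 𝓓(D, ℝ), ∫ x, χ x • (0 : Lp X p (vol D)) x ∂vol D = 0 := by
      intro χ
      rw [← integral_zero (Vec d) X (μ := vol D)]
      refine integral_congr_ae ?_
      filter_upwards [Lp.coeFn_zero X p (vol D)] with x hx
      rw [hx, Pi.zero_apply, smul_zero]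
    simp only [Pi.zero_apply, h, smul_zero]
  add_mem' := by
    intro v w hv hw α φ
    have h : ∀ (χ : 𝓓(D, ℝ)) (f g : Lp X p (vol D)), ∫ x, χ x • (f + g) x ∂vol D =
        (∫ x, χ x • f x ∂vol D) + ∫ x, χ x • g x ∂vol D := by
      intro χ f g
      rw [← integral_add (integrable_test_smul χ f) (integrable_test_smul χ g)]
      refine integral_congr_ae ?_
      filter_upwards [Lp.coeFn_add f g] with x hx
      rw [hx, Pi.add_apply, smul_add]
    simp only [Pi.add_apply, h, smul_add]
    rw [hv α φ, hw α φ]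
  smul_mem' := by
    intro c v hv α φ
    have h : ∀ (χ : 𝓓(D, ℝ)) (f : Lp X p (vol D)), ∫ x, χ x • (c • f) x ∂vol D =
        c • ∫ x, χ x • f x ∂vol D := by
      intro χ f
      rw [← integral_smul]
      refine integral_congr_ae ?_
      filter_upwards [Lp.coeFn_smul c f] with x hx
      rw [hx, Pi.smul_apply, smul_comm]
    simp only [Pi.smul_apply, h]
    rw [hv α φ, smul_comm]

/-- The Sobolev space `W^{k,p}(D; X)`, for a Banach space `X`: the elements of `L^p(D; X)` whose
weak derivatives up to order `k` lie in `L^p(D; X)`. An element is stored together with these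
(unique) weak derivatives. -/
def Sobolev (D : Opens (Vec d)) (k : ℕ) (p : ℝ≥0∞) [Fact (1 ≤ p)] (X : Type*)
    [NormedAddCommGroup X] [NormedSpace ℝ X] : Type _ :=
  sobolevSubmodule D k p X

variable {D : Opens (Vec d)} {k : ℕ} {p : ℝ≥0∞} [Fact (1 ≤ p)]

instance : AddCommGroup (Sobolev D k p X) :=
  inferInstanceAs (AddCommGroup (sobolevSubmodule D k p X))

instance : Module ℝ (Sobolev D k p X) :=
  inferInstanceAs (Module ℝ (sobolevSubmodule D k p X))

/-- The weak derivative `∂^α v ∈ L^p(D; X)`, for `|α| ≤ k`. -/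
def Sobolev.deriv (v : Sobolev D k p X) (α : multiIdx d k) : Lp X p (vol D) := v.1 α

/-- The element of `L^p(D; X)` underlying an element of `W^{k,p}(D; X)`. -/
def Sobolev.toLp (v : Sobolev D k p X) : Lp X p (vol D) := v.deriv ⟨0, zero_mem_multiIdx d k⟩

/-- `‖v‖_{k,p,D} = ∑_{|α| ≤ k} (1 / α!) ‖∂^α v‖_{L^p(D; X)}`. -/
def sobolevNorm (D : Opens (Vec d)) (k : ℕ) (p : ℝ≥0∞) [Fact (1 ≤ p)] (X : Type*)
    [NormedAddCommGroup X] [NormedSpace ℝ X] : AddGroupNorm (Sobolev D k p X) where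
  toFun v := ∑ α : multiIdx d k, (1 / (multiFact α.1 : ℝ)) * ‖v.deriv α‖
  map_zero' := Finset.sum_eq_zero fun α _ => by
    have h : (0 : Sobolev D k p X).deriv α = 0 := rfl
    rw [h, norm_zero, mul_zero]
  add_le' v w := by
    rw [← Finset.sum_add_distrib]
    refine Finset.sum_le_sum fun α _ => ?_
    have h : (v + w).deriv α = v.deriv α + w.deriv α := rfl
    rw [h, ← mul_add]
    exact mul_le_mul_of_nonneg_left (norm_add_le _ _) (by positivity)
  neg' v := by
    refine Finset.sum_congr rfl fun α _ => ?_
    have h : (-v).deriv α = -v.deriv α := rfl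
    rw [h, norm_neg]
  eq_zero_of_map_eq_zero' v hv := by
    refine Subtype.ext (funext fun α => ?_)
    rw [Finset.sum_eq_zero_iff_of_nonneg fun α _ => by positivity] at hv
    have h := hv α (Finset.mem_univ α)
    have hf : (multiFact α.1 : ℝ) ≠ 0 := by
      exact_mod_cast Finset.prod_ne_zero_iff.mpr fun i _ => Nat.factorial_ne_zero _
    exact norm_eq_zero.mp ((mul_eq_zero.mp h).resolve_left (one_div_ne_zero hf))

instance : NormedAddCommGroup (Sobolev D k p X) :=
  (sobolevNorm D k p X).toNormedAddCommGroup

theorem Sobolev.norm_def (v : Sobolev D k p X) :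
    ‖v‖ = ∑ α : multiIdx d k, (1 / (multiFact α.1 : ℝ)) * ‖v.deriv α‖ := rfl

instance : NormedSpace ℝ (Sobolev D k p X) where
  norm_smul_le c v := by
    rw [Sobolev.norm_def, Sobolev.norm_def, Finset.mul_sum]
    refine Finset.sum_le_sum fun α _ => le_of_eq ?_
    have h : (c • v).deriv α = c • v.deriv α := rfl
    rw [h, norm_smul, mul_left_comm]

end Sobolev

/-- `H_0^1(D)`: the closure in `H^1(D)` of the test functions. -/
def H10 {d : ℕ} (D : Opens (Vec d)) : Set (Sobolev D 1 2 ℝ) :=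
  closure {v | ∃ φ : 𝓓(D, ℝ), v.toLp =ᵐ[vol D] φ}

/-- The weak gradient of `v ∈ H^1(D)`. -/
def grad {d : ℕ} {D : Opens (Vec d)} (v : Sobolev D 1 2 ℝ) (x : Vec d) : Vec d :=
  WithLp.toLp 2 fun i => v.deriv ⟨Pi.single i 1, single_mem_multiIdx le_rfl i⟩ x

/-! ### The elliptic problem -/

/-- `u ∈ H_0^1(D)` and `(A ∇u, ∇v)_{L²(D; ℝ^d)} = (h, v)_{L²(D)}` for all `v ∈ H_0^1(D)`. -/
def IsWeakSolution {d : ℕ} (D : Opens (Vec d)) (A : Vec d → Mat d) (h : Vec d → ℝ)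
    (u : Sobolev D 1 2 ℝ) : Prop :=
  u ∈ H10 D ∧ ∀ v ∈ H10 D,
    ∫ x, inner ℝ (A x (grad u x)) (grad v x) ∂vol D = ∫ x, h x * v.toLp x ∂vol D

/-- `A` is symmetric with all eigenvalues in `[aLow, aUp]`, almost everywhere in `D`. -/
def UniformlyElliptic {d : ℕ} (D : Opens (Vec d)) (aLow aUp : ℝ) (A : Vec d → Mat d) : Prop :=
  ∀ᵐ x ∂vol D, IsSelfAdjoint (A x) ∧
    ∀ ξ : Vec d, aLow * ‖ξ‖ ^ 2 ≤ inner ℝ (A x ξ) ξ ∧ inner ℝ (A x ξ) ξ ≤ aUp * ‖ξ‖ ^ 2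

/-- The elliptic regularity assumption of order `κ`. The Banach space `R` of matrix fields on `D` is
given with its inclusion `ι` into the matrix fields modulo equality almost everywhere, so that
`A = ι r` says that `A` lies in `R` and has `R`-norm `‖r‖`. The constant `Cer s` depends
continuously on the `R`-norm `s ≥ 0` of the coefficient. -/
def EllipticRegularity {d : ℕ} (D : Opens (Vec d)) (κ : ℕ) (aLow aUp : ℝ) {R : Type*}
    [NormedAddCommGroup R] [NormedSpace ℝ R] (ι : R →ₗ[ℝ] (Vec d →ₘ[vol D] Mat d))
    (Cer : ℝ → ℝ) : Prop :=
  ContinuousOn Cer (Ici 0) ∧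
  ∀ (A : Sobolev D κ ∞ (Mat d)) (r : R), ι r =ᵐ[vol D] A.toLp →
    UniformlyElliptic D aLow aUp A.toLp →
    ∀ h : Sobolev D (κ - 1) 2 ℝ,
      ∃ u : Sobolev D 1 2 ℝ, IsWeakSolution D A.toLp h.toLp u ∧
        (∀ u' : Sobolev D 1 2 ℝ, IsWeakSolution D A.toLp h.toLp u' → u' = u) ∧
        ∃ w : Sobolev D (κ + 1) 2 ℝ, w.toLp = u.toLp ∧ ‖w‖ ≤ Cer ‖r‖ * ‖h‖

/-! ### The random coefficient -/

/-- The parameter domain `□ = [-1, 1]^M`. -/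
def cube (M : ℕ) : Set (Fin M → ℝ) := Icc (fun _ => -1) (fun _ => 1)

/-- The law on `□` of `M` independent random variables, uniformly distributed on `[-1, 1]`. -/
def paramLaw (M : ℕ) : Measure (Fin M → ℝ) :=
  Measure.pi fun _ => ProbabilityTheory.cond volume (Icc (-1 : ℝ) 1)

section Coefficient

variable {d κ : ℕ} {D : Opens (Vec d)}

/-- `V[y] = ψ_0 + ∑_{k=1}^M σ_k y_k ψ_k`; the coordinate `y_k`, `1 ≤ k ≤ M`, is `y ⟨k - 1, _⟩`. -/
def field (σ : ℕ → ℝ) (ψ : ℕ → Sobolev D κ ∞ (Vec d)) {M : ℕ} (y : Fin M → ℝ) :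
    Sobolev D κ ∞ (Vec d) :=
  ψ 0 + ∑ k : Fin M, (σ (k + 1) * y k) • ψ (k + 1)

/-- `a I + (‖v‖ - a) v vᵀ / (vᵀ v)`. -/
def diffusionMatrix (a : ℝ) (v : Vec d) : Mat d :=
  a • ContinuousLinearMap.id ℝ (Vec d) +
    ((‖v‖ - a) / inner ℝ v v) • InnerProductSpace.rankOne ℝ v v

/-- The diffusion coefficient `A[y]`. -/
def coeff (a : ℝ) (σ : ℕ → ℝ) (ψ : ℕ → Sobolev D κ ∞ (Vec d)) {M : ℕ} (y : Fin M → ℝ)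
    (x : Vec d) : Mat d :=
  diffusionMatrix a ((field σ ψ y).toLp x)

/-- `γ_{κ,k} = ‖σ_k ψ_k‖_{κ,∞,D}`. -/
def gammaSeq (σ : ℕ → ℝ) (ψ : ℕ → Sobolev D κ ∞ (Vec d)) (k : ℕ) : ℝ := ‖σ k • ψ k‖

/-- `c_{γ_κ} = max {‖γ_κ‖_{ℓ¹}, 2}`. -/
def cGamma (σ : ℕ → ℝ) (ψ : ℕ → Sobolev D κ ∞ (Vec d)) : ℝ := max (∑' k, gammaSeq σ ψ k) 2

/-- `μ_{κ,k} = 4 c_γ² / (aLow² log 2) γ_{κ,k}`. -/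
def muSeq (aLow : ℝ) (σ : ℕ → ℝ) (ψ : ℕ → Sobolev D κ ∞ (Vec d)) (k : ℕ) : ℝ :=
  4 * cGamma σ ψ ^ 2 / (aLow ^ 2 * Real.log 2) * gammaSeq σ ψ k

/-- The constant `k_{κ,A}`, as a function of `c = c_{γ_κ}`. -/
def kA (κ : ℕ) (aLow aUp c : ℝ) : ℝ :=
  ((κ + 1) * (1 / aLow ^ 2) * (2 * c ^ 2 / aLow ^ 2) ^ κ + aUp) *
    (3 * (κ + 1) * aUp * (2 * c ^ 2 / aLow ^ 2) ^ κ * c ^ 2) + aUp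

end Coefficient

/-- `C_{κ,er} = max_{0 ≤ s ≤ S} C_{κ,er}(D, s)`. -/
def maxCer (Cer : ℝ → ℝ) (S : ℝ) : ℝ := sSup (Cer '' Icc 0 S)

/-- The classical derivative `∂_{y_1}^{α_1} ⋯ ∂_{y_M}^{α_M} g` on the set `s`, one-sided at
boundary points of `s` where necessary. -/
def paramDeriv {M : ℕ} {F : Type*} [NormedAddCommGroup F] [NormedSpace ℝ F]
    (s : Set (Fin M → ℝ)) (α : Fin M → ℕ) (g : (Fin M → ℝ) → F) : (Fin M → ℝ) → F :=
  (List.finRange M).foldr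
    (fun i g' => (fun χ y => fderivWithin ℝ χ s y (Pi.single i 1))^[α i] g') g

end AnisoDiff

end

noncomputable section

set_option linter.unusedSectionVars false
set_option maxSynthPendingDepth 3

namespace AnisoDiff

/-! ### Classical derivatives of test functions -/

/-! The parameter enters only through the affine map y ↦ V[y]. It therefore suffices to show that
the solution is a smooth function of the vector field V on an open subset of W^{κ,∞}, whose n-th
Fréchet derivative at every V[y] is at most n! C ρ^n (`DerivBound`). Evaluating that derivative on
the directions σ_k ψ_k, whose norms are γ_{κ,k}, produces the product in the claim
(`norm_paramDeriv_le`).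

The coefficient requires 1/|V| and 1/|V|² inside the Sobolev scale. With the weights 1/α! in the
norm the Leibniz rule has unit coefficients, so scalar W^{κ,∞} is a Banach algebra, and it remains
one with additional weights ε^|α| (`Sobolev.wnorm_bilin_le`). For c = c_γ and ε = aLow²/(4c²) the
function x = 1 - |V|²/c² has weighted norm below one: its sup norm is at most 1 - aLow²/c², and all
its derivatives carry a factor ε (`norm_projData_arg_le`). Hence the binomial series of (1 -
x)^{-1/2} converges, and 1/c times its sum is 1/|V|. Returning to the original norm costs a factor
ε^{-κ}.

The factorial bounds come from algebraic identities, not from formulas for derivatives of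
compositions. An inverse G of S satisfies G(y) = G(v) - G(y) (S(y) - S(v)) G(v), and this recursion
preserves geometric growth of the derivatives (`DerivBound.of_perturbation`). It is applied to
|V|^{-2} and again to the inverse of the elliptic operator. The function r = 1/|V| solves the linear
equation Dr = -(1/2) r · (r² D|V|²), which is treated by `DerivBound.of_linear_ode`.

On the side of the differential equation, a weak solution of class H^{κ+1} is a solution in H^{κ+1}
∩ H^1_0 of L(A) u = f, where L is linear and bounded in A (`isWeakSolution_iff`). Elliptic
regularity makes L(A[y]) invertible, with a uniform bound for the inverse, at almost every y. A set
of full measure is dense in the cube, and invertibility with a uniform bound passes to limits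
(`isInvertible_of_dense`), so it holds on the whole cube. Uniqueness identifies the result with u
almost everywhere, and `solution_bound_le` compares the constants. -/

/-- The `i`-th standard unit vector. -/
abbrev unitVec {d : ℕ} (i : Fin d) : Vec d := EuclideanSpace.single i 1

section Weak

variable {d : ℕ} {D : Opens (Vec d)}

theorem lineDeriv_test_apply (v : Vec d) (φ : 𝓓(D, ℝ)) (x : Vec d) :
    (∂_{v} φ : 𝓓(D, ℝ)) x = fderiv ℝ φ x v := by
  rw [TestFunction.lineDerivOp_eq_lineDerivCLM ℝ, TestFunction.lineDerivCLM_eq_fderivCLM,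
    TestFunction.fderivCLM_apply]
  simp

theorem differentiable_test (φ : 𝓓(D, ℝ)) : Differentiable ℝ φ :=
  φ.contDiff.differentiable (by simp)

/-- Symmetry of the second derivative. It makes the order of differentiation fixed in `testDeriv`
irrelevant. -/
theorem lineDeriv_test_comm (v w : Vec d) (φ : 𝓓(D, ℝ)) :
    (∂_{v} (∂_{w} φ : 𝓓(D, ℝ)) : 𝓓(D, ℝ)) = ∂_{w} (∂_{v} φ : 𝓓(D, ℝ)) := by
  have key : ∀ (a b : Vec d) (x : Vec d),
      (∂_{a} (∂_{b} φ : 𝓓(D, ℝ)) : 𝓓(D, ℝ)) x = fderiv ℝ (fderiv ℝ φ) x a b := by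
    intro a b x
    rw [lineDeriv_test_apply]
    have h : (⇑(∂_{b} φ : 𝓓(D, ℝ)) : Vec d → ℝ) = fun y => fderiv ℝ φ y b :=
      funext fun y => lineDeriv_test_apply b φ y
    have hd : DifferentiableAt ℝ (fderiv ℝ φ) x :=
      ((φ.contDiff.fderiv_right (m := 1) (by norm_cast)).differentiable (by simp)) x
    rw [h, fderiv_clm_apply hd (differentiableAt_const b)]
    simp
  ext x
  rw [key, key]
  have hs : IsSymmSndFDerivAt ℝ φ x :=
    φ.contDiff.contDiffAt.isSymmSndFDerivAt (by simp; norm_cast)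
  exact hs v w

/-- The operators commute, so one more factor `T j` can be moved past all the others to the front.
An arbitrary duplicate-free list is allowed so that the induction can record whether `j` has already
been met. -/
theorem foldr_iterate_add_single {ι β : Type*} [DecidableEq ι] (T : ι → β → β)
    (hT : ∀ i j b, T i (T j b) = T j (T i b)) (α : ι → ℕ) (j : ι) (b : β) (l : List ι)
    (hl : l.Nodup) :
    l.foldr (fun i χ => (T i)^[(α + Pi.single j 1 : ι → ℕ) i] χ) b =
      if j ∈ l then T j (l.foldr (fun i χ => (T i)^[α i] χ) b)
      else l.foldr (fun i χ => (T i)^[α i] χ) b := by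
  induction l with
  | nil => simp
  | cons a l ih =>
    rw [List.nodup_cons] at hl
    rw [List.foldr_cons, List.foldr_cons, ih hl.2]
    by_cases haj : j = a
    · subst haj
      simp only [hl.1, if_false, List.mem_cons, true_or, if_true, Pi.add_apply, Pi.single_eq_same]
      rw [Function.iterate_succ_apply']
    · have h1 : (α + Pi.single j 1 : ι → ℕ) a = α a := by
        simp [Ne.symm haj]
      rw [h1]
      by_cases hjl : j ∈ l
      · have hcomm : Function.Commute (T a) (T j) := fun b => hT a j b
        simp only [hjl, if_true, List.mem_cons, or_true]
        exact (hcomm.iterate_left (α a)) _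
      · simp [hjl, haj]

theorem testDeriv_add_single (α : Fin d → ℕ) (i : Fin d) (φ : 𝓓(D, ℝ)) :
    testDeriv (α + Pi.single i 1) φ = ∂_{unitVec i} (testDeriv α φ) := by
  unfold testDeriv
  have := foldr_iterate_add_single (fun i => (fun ρ : 𝓓(D, ℝ) => (∂_{unitVec i} ρ : 𝓓(D, ℝ))))
    (fun i j b => lineDeriv_test_comm _ _ b) α i φ (List.finRange d) (List.nodup_finRange d)
  simpa using this

theorem testDeriv_zero (φ : 𝓓(D, ℝ)) : testDeriv (0 : Fin d → ℕ) φ = φ := by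
  unfold testDeriv
  induction List.finRange d with
  | nil => rfl
  | cons a l ih => simp

/-- Induction on multi-indices by raising one entry. -/
theorem multiIndex_induction {P : (Fin d → ℕ) → Prop} (h0 : P 0)
    (hs : ∀ α i, P α → P (α + Pi.single i 1)) (α : Fin d → ℕ) : P α := by
  induction h : ∑ i, α i generalizing α with
  | zero =>
    have : α = 0 := by
      funext i
      exact (Finset.sum_eq_zero_iff.mp h) i (Finset.mem_univ i)
    exact this ▸ h0
  | succ n ih =>
    obtain ⟨i, hi⟩ : ∃ i, α i ≠ 0 := by
      by_contra! hc
      simp [hc] at h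
    have hα : α = (α - Pi.single i 1) + Pi.single i 1 := by
      funext j
      by_cases hj : j = i
      · subst hj; simp; omega
      · simp [hj]
    rw [hα]
    apply hs
    apply ih
    have := congrArg (fun β : Fin d → ℕ => ∑ i, β i) hα
    simp only [Pi.add_apply, Finset.sum_add_distrib, Finset.sum_pi_single', Finset.mem_univ,
      if_true] at this
    omega

theorem sum_add_single (α : Fin d → ℕ) (i : Fin d) :
    ∑ j, (α + Pi.single i 1 : Fin d → ℕ) j = ∑ j, α j + 1 := by
  simp [Finset.sum_add_distrib]

theorem testDeriv_lineDeriv (α : Fin d → ℕ) (v : Vec d) (φ : 𝓓(D, ℝ)) :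
    testDeriv α (∂_{v} φ : 𝓓(D, ℝ)) = ∂_{v} (testDeriv α φ) := by
  induction α using multiIndex_induction with
  | h0 => rw [testDeriv_zero, testDeriv_zero]
  | hs α i ih => rw [testDeriv_add_single, ih, testDeriv_add_single, lineDeriv_test_comm]

/-! ### First-order weak derivatives -/

variable {X Y Z : Type*} [NormedAddCommGroup X] [NormedSpace ℝ X] [NormedAddCommGroup Y]
  [NormedSpace ℝ Y] [NormedAddCommGroup Z] [NormedSpace ℝ Z]

/-- `w` is the weak partial derivative `∂_i v` in `D`. -/
def IsWeakPartial (D : Opens (Vec d)) (i : Fin d) (v w : Vec d → X) : Prop :=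
  ∀ φ : 𝓓(D, ℝ), ∫ x, (∂_{unitVec i} φ : 𝓓(D, ℝ)) x • v x ∂vol D = -∫ x, φ x • w x ∂vol D

theorem isWeakDeriv_zero (v : Vec d → X) : IsWeakDeriv D 0 v v := by
  intro φ
  simp [testDeriv_zero]

/-- Together with `IsWeakDeriv.isWeakPartial` this replaces a weak derivative of higher order by a
chain of first-order ones, so that the rules of calculus need only be proved for `IsWeakPartial`. -/
theorem IsWeakDeriv.trans_partial {α : Fin d → ℕ} {i : Fin d} {v w z : Vec d → X}
    (h : IsWeakDeriv D α v w) (h' : IsWeakPartial D i w z) :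
    IsWeakDeriv D (α + Pi.single i 1) v z := by
  intro φ
  rw [testDeriv_add_single, ← testDeriv_lineDeriv, h, h', sum_add_single, pow_succ, smul_neg]
  simp

/-- Test the first identity with `∂_i φ` and compare with the second; the common sign `(-1)^|α|`
cancels. -/
theorem IsWeakDeriv.isWeakPartial {α : Fin d → ℕ} {i : Fin d} {v w z : Vec d → X}
    (h : IsWeakDeriv D α v w) (h' : IsWeakDeriv D (α + Pi.single i 1) v z) :
    IsWeakPartial D i w z := by
  intro φ
  have h1 := h (∂_{unitVec i} φ)
  have h2 := h' φ
  rw [testDeriv_lineDeriv, ← testDeriv_add_single, h2, sum_add_single, pow_succ, mul_smul] at h1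
  have h3 : ((-1 : ℝ) ^ (∑ i, α i)) ≠ 0 := by simp
  have h4 := (smul_right_injective X h3) h1
  rw [← h4]
  simp

theorem IsWeakPartial.congr {i : Fin d} {v w v' w' : Vec d → X} (h : IsWeakPartial D i v w)
    (hv : v =ᵐ[vol D] v') (hw : w =ᵐ[vol D] w') : IsWeakPartial D i v' w' := by
  intro φ
  have h1 : ∫ x, (∂_{unitVec i} φ : 𝓓(D, ℝ)) x • v' x ∂vol D =
      ∫ x, (∂_{unitVec i} φ : 𝓓(D, ℝ)) x • v x ∂vol D :=
    integral_congr_ae (by filter_upwards [hv] with x hx; rw [hx])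
  have h2 : ∫ x, φ x • w' x ∂vol D = ∫ x, φ x • w x ∂vol D :=
    integral_congr_ae (by filter_upwards [hw] with x hx; rw [hx])
  rw [h1, h2, h φ]

theorem locInt_of_memLp {v : Vec d → X} {p : ℝ≥0∞} (hp : 1 ≤ p) (hv : MemLp v p (vol D)) :
    LocallyIntegrableOn v D (vol D) :=
  (hv.locallyIntegrable hp).locallyIntegrableOn _

theorem integrable_smul_test (φ : 𝓓(D, ℝ)) {v : Vec d → X}
    (hv : LocallyIntegrableOn v D (vol D)) : Integrable (fun x => φ x • v x) (vol D) :=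
  φ.integrable_bilin (ContinuousLinearMap.lsmul ℝ ℝ) hv

theorem isWeakPartial_zero (i : Fin d) :
    IsWeakPartial D i (fun _ => (0 : X)) (fun _ => 0) := by
  intro φ; simp

theorem IsWeakPartial.sum {ι : Type*} (s : Finset ι) {i : Fin d} {v w : ι → Vec d → X}
    (h : ∀ j ∈ s, IsWeakPartial D i (v j) (w j))
    (hv : ∀ j ∈ s, LocallyIntegrableOn (v j) D (vol D))
    (hw : ∀ j ∈ s, LocallyIntegrableOn (w j) D (vol D)) :
    IsWeakPartial D i (fun x => ∑ j ∈ s, v j x) (fun x => ∑ j ∈ s, w j x) := by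
  intro φ
  simp only [Finset.smul_sum]
  rw [integral_finsetSum _ fun j hj => integrable_smul_test _ (hv j hj),
    integral_finsetSum _ fun j hj => integrable_smul_test _ (hw j hj),
    ← Finset.sum_neg_distrib]
  exact Finset.sum_congr rfl fun j hj => h j hj φ

theorem IsWeakPartial.clm [CompleteSpace X] [CompleteSpace Y] (ℓ : X →L[ℝ] Y) {i : Fin d}
    {v w : Vec d → X}
    (h : IsWeakPartial D i v w)
    (hv : LocallyIntegrableOn v D (vol D)) (hw : LocallyIntegrableOn w D (vol D)) :
    IsWeakPartial D i (fun x => ℓ (v x)) (fun x => ℓ (w x)) := by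
  intro φ
  simp only [← map_smul]
  rw [ℓ.integral_comp_comm (integrable_smul_test _ hv),
    ℓ.integral_comp_comm (integrable_smul_test _ hw), h φ, map_neg]

theorem IsWeakPartial.smul_const (c : ℝ) {i : Fin d} {v w : Vec d → X}
    (h : IsWeakPartial D i v w) :
    IsWeakPartial D i (fun x => c • v x) (fun x => c • w x) := by
  intro φ
  simp only [smul_comm _ c]
  rw [integral_smul, integral_smul, h φ, smul_neg]

/-- The fundamental lemma of the calculus of variations on `D`. -/
theorem ae_eq_zero_of_test [CompleteSpace X] {w : Vec d → X}
    (hw : LocallyIntegrableOn w D (vol D))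
    (h : ∀ φ : 𝓓(D, ℝ), ∫ x, φ x • w x ∂vol D = 0) : w =ᵐ[vol D] 0 := by
  have key := D.isOpen.ae_eq_zero_of_integral_contDiff_smul_eq_zero (μ := vol D) hw
    (fun g hg hc hs => h ⟨g, hg, hc, hs⟩)
  filter_upwards [key, ae_restrict_mem D.isOpen.measurableSet] with x hx hxD using hx hxD

theorem ae_eq_of_test [CompleteSpace X] {w z : Vec d → X}
    (hw : LocallyIntegrableOn w D (vol D)) (hz : LocallyIntegrableOn z D (vol D))
    (h : ∀ φ : 𝓓(D, ℝ), ∫ x, φ x • w x ∂vol D = ∫ x, φ x • z x ∂vol D) : w =ᵐ[vol D] z := by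
  have := ae_eq_zero_of_test (w := fun x => w x - z x) (hw.sub hz) (fun φ => by
    simp only [smul_sub]
    rw [integral_sub (integrable_smul_test _ hw) (integrable_smul_test _ hz), h φ, sub_self])
  filter_upwards [this] with x hx using sub_eq_zero.mp hx

theorem IsWeakDeriv.unique [CompleteSpace X] {α : Fin d → ℕ} {v w z : Vec d → X}
    (h : IsWeakDeriv D α v w) (h' : IsWeakDeriv D α v z)
    (hw : LocallyIntegrableOn w D (vol D)) (hz : LocallyIntegrableOn z D (vol D)) :
    w =ᵐ[vol D] z := by
  refine ae_eq_of_test hw hz fun φ => ?_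
  have h3 : ((-1 : ℝ) ^ (∑ i, α i)) ≠ 0 := by simp
  exact smul_right_injective X h3 ((h φ).symm.trans (h' φ))

/-- Smooth test functions have their classical derivatives as weak derivatives. -/
theorem isWeakPartial_test (φ : 𝓓(D, ℝ)) (i : Fin d) :
    IsWeakPartial D i φ (∂_{unitVec i} φ : 𝓓(D, ℝ)) := by
  intro χ
  -- Test functions vanish off `D`, so the integrals extend to all of `ℝ^d`, where integration by
  -- parts has no boundary term.
  have hsupp : ∀ (a b : 𝓓(D, ℝ)), ∫ x, a x • b x ∂vol D = ∫ x, a x * b x := by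
    intro a b
    rw [setIntegral_eq_integral_of_forall_compl_eq_zero]
    · rfl
    · intro x hx
      have : a x = 0 := by
        by_contra hne
        exact hx (a.tsupport_subset (subset_tsupport _ hne))
      simp [this]
  rw [hsupp, hsupp]
  simp only [lineDeriv_test_apply]
  have hint : ∀ (f g : Vec d → ℝ), Continuous f → Continuous g → HasCompactSupport f →
      Integrable (fun x => f x * g x) := fun f g hf hg hc =>
    (hf.mul hg).integrable_of_hasCompactSupport hc.mul_right
  have hcf : ∀ a : 𝓓(D, ℝ), Continuous fun x => fderiv ℝ a x (unitVec i) := fun a =>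
    (a.contDiff.continuous_fderiv (by simp)).clm_apply continuous_const
  have := integral_mul_fderiv_eq_neg_fderiv_mul_of_integrable (μ := (volume : Measure (Vec d)))
    (f := χ) (g := φ) (v := unitVec i) (𝕜 := ℝ)
    ((hint φ _ φ.continuous (hcf χ) φ.hasCompactSupport).congr
      (Filter.Eventually.of_forall fun x => mul_comm _ _))
    (hint χ _ χ.continuous (hcf φ) χ.hasCompactSupport)
    (hint χ φ χ.continuous φ.continuous χ.hasCompactSupport)
    (fun x _ => differentiable_test χ x) (fun x _ => differentiable_test φ x)
  rw [this, neg_neg]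

/-- Constants have vanishing weak derivatives. -/
theorem isWeakPartial_const [CompleteSpace X] (c : X) (i : Fin d) :
    IsWeakPartial D i (fun _ => c) (fun _ => (0 : X)) := by
  intro χ
  simp only [smul_zero, integral_zero, neg_zero]
  rw [integral_smul_const]
  have : ∫ x, (∂_{unitVec i} χ : 𝓓(D, ℝ)) x ∂vol D = 0 := by
    rw [setIntegral_eq_integral_of_forall_compl_eq_zero]
    · simp only [lineDeriv_test_apply]
      have hi : Integrable fun x => fderiv ℝ χ x (unitVec i) :=
        ((χ.contDiff.continuous_fderiv (by simp)).clm_apply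
          continuous_const).integrable_of_hasCompactSupport (χ.hasCompactSupport.fderiv_apply ℝ _)
      have := integral_mul_fderiv_eq_neg_fderiv_mul_of_integrable
        (μ := (volume : Measure (Vec d))) (f := fun _ => (1 : ℝ)) (g := χ) (v := unitVec i)
        (𝕜 := ℝ) (by simp) (by simpa using hi)
        (by simpa using χ.continuous.integrable_of_hasCompactSupport χ.hasCompactSupport)
        (fun x _ => differentiableAt_const _) (fun x _ => differentiable_test χ x)
      simpa using this
    · intro x hx
      by_contra hne
      exact hx ((∂_{unitVec i} χ : 𝓓(D, ℝ)).tsupport_subset (subset_tsupport _ hne))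
  rw [this, zero_smul]

end Weak

/-! ### Mollification and the product rule for weak derivatives -/

section Product

open Filter Topology Convolution

variable {d : ℕ} {D : Opens (Vec d)}

theorem ae_norm_le_toReal_eLpNorm {α E : Type*} [MeasurableSpace α] {μ : Measure α}
    [NormedAddCommGroup E] {f : α → E} (hf : MemLp f ∞ μ) :
    ∀ᵐ x ∂μ, ‖f x‖ ≤ (eLpNorm f ∞ μ).toReal := by
  rw [eLpNorm_exponent_top]
  filter_upwards [ae_le_eLpNormEssSup (f := f) (μ := μ)] with x hx
  have hne : eLpNormEssSup f μ ≠ ∞ := by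
    rw [← eLpNorm_exponent_top]; exact hf.eLpNorm_ne_top
  have := ENNReal.toReal_mono hne hx
  rwa [toReal_enorm] at this

/-- Mollification of a function `u` on `D`, extended by zero. -/
def mollify (D : Opens (Vec d)) (ρ : ContDiffBump (0 : Vec d)) (u : Vec d → ℝ) : Vec d → ℝ :=
  (ρ.normed volume) ⋆[ContinuousLinearMap.lsmul ℝ ℝ, volume] ((D : Set (Vec d)).indicator u)

theorem mollify_apply (ρ : ContDiffBump (0 : Vec d)) (u : Vec d → ℝ) (x : Vec d) :
    mollify D ρ u x = ∫ z, ρ.normed volume (x - z) * u z ∂vol D := by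
  rw [mollify, convolution_eq_swap, ← integral_indicator D.isOpen.measurableSet]
  refine integral_congr_ae (Eventually.of_forall fun z => ?_)
  by_cases hz : z ∈ (D : Set (Vec d)) <;> simp [hz]

theorem locInt_indicator {u : Vec d → ℝ} (hu : MemLp u ∞ (vol D)) :
    LocallyIntegrable ((D : Set (Vec d)).indicator u) volume := by
  have h : MemLp ((D : Set (Vec d)).indicator u) ∞ volume :=
    (memLp_indicator_iff_restrict D.isOpen.measurableSet).mpr hu
  exact h.locallyIntegrable (by simp)

theorem contDiff_mollify (ρ : ContDiffBump (0 : Vec d)) {u : Vec d → ℝ}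
    (hu : MemLp u ∞ (vol D)) : ContDiff ℝ (⊤ : ℕ∞) (mollify D ρ u) :=
  ρ.hasCompactSupport_normed.contDiff_convolution_left _ ρ.contDiff_normed (locInt_indicator hu)

/-- The mollifier is nonnegative with total mass one, but over `D` alone its mass may be smaller;
hence `max C 0` rather than `C`. -/
theorem abs_mollify_le (ρ : ContDiffBump (0 : Vec d)) {u : Vec d → ℝ} {C : ℝ}
    (hC : ∀ᵐ x ∂vol D, |u x| ≤ C) (x : Vec d) : |mollify D ρ u x| ≤ max C 0 := by
  rw [mollify_apply, ← Real.norm_eq_abs]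
  have hi : Integrable (fun z => ρ.normed volume (x - z) : Vec d → ℝ) volume :=
    (ρ.integrable_normed (μ := volume)).comp_sub_left x
  calc ‖∫ z, ρ.normed volume (x - z) * u z ∂vol D‖
      ≤ ∫ z, ρ.normed volume (x - z) * max C 0 ∂vol D := by
        refine norm_integral_le_of_norm_le (hi.restrict.mul_const _) ?_
        filter_upwards [hC] with z hz
        rw [norm_mul, Real.norm_of_nonneg (ρ.nonneg_normed _)]
        exact mul_le_mul_of_nonneg_left (hz.trans (le_max_left _ _)) (ρ.nonneg_normed _)
    _ ≤ ∫ z, ρ.normed volume (x - z) * max C 0 := by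
        refine setIntegral_le_integral (hi.mul_const _) (Eventually.of_forall fun z => ?_)
        exact mul_nonneg (ρ.nonneg_normed _) (le_max_right _ _)
    _ = max C 0 := by
        rw [integral_mul_const, integral_sub_left_eq_self (ρ.normed volume) volume x,
          ρ.integral_normed, one_mul]

/-- Mollification commutes with weak derivatives, away from the boundary. -/
theorem fderiv_mollify (ρ : ContDiffBump (0 : Vec d)) {u u' : Vec d → ℝ} {i : Fin d}
    (hu : MemLp u ∞ (vol D)) (h : IsWeakPartial D i u u') {x : Vec d}
    (hx : Metric.closedBall x ρ.rOut ⊆ D) :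
    fderiv ℝ (mollify D ρ u) x (unitVec i) = mollify D ρ u' x := by
  have hsm : ContDiff ℝ (⊤ : ℕ∞) (fun z => ρ.normed volume (x - z)) :=
    ρ.contDiff_normed.comp (contDiff_const.sub contDiff_id)
  have hts : tsupport (fun z => ρ.normed volume (x - z)) ⊆ Metric.closedBall x ρ.rOut := by
    refine closure_minimal ?_ Metric.isClosed_closedBall
    intro z hz
    have : x - z ∈ Function.support (ρ.normed volume) := hz
    rw [ρ.support_normed_eq] at this
    rw [Metric.mem_closedBall, dist_comm, dist_eq_norm]
    simpa using (mem_ball_zero_iff.mp this).le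
  -- The reflected and translated mollifier is an admissible test function because its support lies
  -- in the ball of `hx`. Differentiating it in `z` instead of `x` changes the sign, which cancels
  -- the sign in the weak derivative.
  let χ : 𝓓(D, ℝ) := ⟨fun z => ρ.normed volume (x - z), hsm,
    HasCompactSupport.of_support_subset_isCompact (isCompact_closedBall x ρ.rOut)
      ((subset_tsupport _).trans hts), hts.trans hx⟩
  have hχ : ∀ z, (∂_{unitVec i} χ : 𝓓(D, ℝ)) z =
      -fderiv ℝ (ρ.normed volume) (x - z) (unitVec i) := by
    intro z
    rw [lineDeriv_test_apply]
    change fderiv ℝ (fun z => ρ.normed volume (x - z)) z (unitVec i) = _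
    have h0 : HasFDerivAt (fun z => x - z) (-ContinuousLinearMap.id ℝ (Vec d)) z :=
      (hasFDerivAt_id z).const_sub x
    have h1 : DifferentiableAt ℝ (ρ.normed volume) (x - z) :=
      (ρ.contDiff_normed (n := 1)).differentiable (by simp) _
    have h2 : HasFDerivAt (fun z => ρ.normed volume (x - z)) _ z := h1.hasFDerivAt.comp z h0
    rw [h2.fderiv]
    simp
  have h1 := h χ
  have hd := ρ.hasCompactSupport_normed.hasFDerivAt_convolution_left
    (ContinuousLinearMap.lsmul ℝ ℝ) (ρ.contDiff_normed (n := 1) (μ := volume))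
    (locInt_indicator hu) x
  have h2 : fderiv ℝ (mollify D ρ u) x (unitVec i) =
      ∫ z, fderiv ℝ (ρ.normed volume) (x - z) (unitVec i) * u z ∂vol D := by
    unfold mollify
    rw [hd.fderiv, convolution_eq_swap, ContinuousLinearMap.integral_apply]
    · rw [← integral_indicator D.isOpen.measurableSet]
      refine integral_congr_ae (Eventually.of_forall fun z => ?_)
      by_cases hz : z ∈ (D : Set (Vec d)) <;> simp [hz, ContinuousLinearMap.precompL]
    · have hce := (ρ.hasCompactSupport_normed (μ := volume)).fderiv ℝ |>.convolutionExists_left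
        ((ContinuousLinearMap.lsmul ℝ ℝ).precompL (Vec d))
        ((ρ.contDiff_normed (n := 1)).continuous_fderiv (by simp)) (locInt_indicator hu) x
      exact hce.integrable_swap
  rw [h2, mollify_apply]
  simp only [hχ, smul_eq_mul, neg_mul, integral_neg, neg_inj] at h1
  exact h1

variable {X Y Z : Type*} [NormedAddCommGroup X] [NormedSpace ℝ X] [NormedAddCommGroup Y]
  [NormedSpace ℝ Y] [NormedAddCommGroup Z] [NormedSpace ℝ Z]

/-- The product of a test function with a smooth function. -/
def testMul (φ : 𝓓(D, ℝ)) (g : Vec d → ℝ) (hg : ContDiff ℝ (⊤ : ℕ∞) g) : 𝓓(D, ℝ) :=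
  ⟨fun x => φ x * g x, φ.contDiff.mul hg, φ.hasCompactSupport.mul_right,
    (tsupport_mul_subset_left).trans φ.tsupport_subset⟩

theorem lineDeriv_testMul (φ : 𝓓(D, ℝ)) (g : Vec d → ℝ) (hg : ContDiff ℝ (⊤ : ℕ∞) g)
    (v x : Vec d) : (∂_{v} (testMul φ g hg) : 𝓓(D, ℝ)) x =
      (∂_{v} φ : 𝓓(D, ℝ)) x * g x + φ x * fderiv ℝ g x v := by
  rw [lineDeriv_test_apply, lineDeriv_test_apply]
  change fderiv ℝ (fun x => φ x * g x) x v = _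
  rw [fderiv_fun_mul (differentiable_test φ x) ((hg.differentiable (by simp)) x)]
  simp
  ring

/-- A sequence of bump functions with supports shrinking to the origin. -/
def shrinkingBump (d n : ℕ) : ContDiffBump (0 : Vec d) where
  rIn := 1 / ((n : ℝ) + 1)
  rOut := 2 / ((n : ℝ) + 1)
  rIn_pos := by positivity
  rIn_lt_rOut := by gcongr; norm_num

theorem tendsto_rOut_shrinkingBump : Tendsto (fun n => (shrinkingBump d n).rOut) atTop (𝓝 0) := by
  have := (tendsto_one_div_add_atTop_nhds_zero_nat (𝕜 := ℝ)).const_mul 2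
  simpa [shrinkingBump, div_eq_mul_inv] using this

theorem ae_tendsto_mollify {u : Vec d → ℝ} (hu : MemLp u ∞ (vol D)) :
    ∀ᵐ x ∂vol D, Tendsto (fun n => mollify D (shrinkingBump d n) u x) atTop (𝓝 (u x)) := by
  -- Lebesgue differentiation, for kernels whose outer and inner radii keep a bounded ratio, here
  -- two.
  have := ContDiffBump.ae_convolution_tendsto_right_of_locallyIntegrable
    (φ := shrinkingBump d) (l := atTop) (K := 2) tendsto_rOut_shrinkingBump
    (Eventually.of_forall fun n => by simp [shrinkingBump, div_eq_mul_inv]) (locInt_indicator hu)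
  filter_upwards [ae_restrict_of_ae this, ae_restrict_mem D.isOpen.measurableSet] with x hx hxD
  simpa [mollify, hxD] using hx

/-- The product rule for a bounded scalar function with bounded weak derivative. -/
theorem IsWeakPartial.smul {u u' : Vec d → ℝ} {v v' : Vec d → X} {i : Fin d}
    (hu : MemLp u ∞ (vol D)) (hu' : MemLp u' ∞ (vol D))
    (hv : LocallyIntegrableOn v D (vol D)) (hv' : LocallyIntegrableOn v' D (vol D))
    (h : IsWeakPartial D i u u') (h' : IsWeakPartial D i v v') :
    IsWeakPartial D i (fun x => u x • v x) (fun x => u' x • v x + u x • v' x) := by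
  intro φ
  obtain ⟨C, hC⟩ : ∃ C, ∀ᵐ x ∂vol D, |u x| ≤ C :=
    ⟨_, by simpa using ae_norm_le_toReal_eLpNorm hu⟩
  obtain ⟨C', hC'⟩ : ∃ C, ∀ᵐ x ∂vol D, |u' x| ≤ C :=
    ⟨_, by simpa using ae_norm_le_toReal_eLpNorm hu'⟩
  -- A margin `δ` around the support of `φ` still lies in `D`. On that support, mollification at
  -- radius at most `δ` commutes with `∂_i`.
  obtain ⟨δ, hδ, hδD⟩ := φ.hasCompactSupport.isCompact.exists_cthickening_subset_open D.isOpen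
    φ.tsupport_subset
  have hev : ∀ᶠ n in atTop, (shrinkingBump d n).rOut ≤ δ := by
    filter_upwards [tendsto_rOut_shrinkingBump.eventually (gt_mem_nhds hδ)] with n hn using hn.le
  set U : ℕ → Vec d → ℝ := fun n => mollify D (shrinkingBump d n) u with hU
  set U' : ℕ → Vec d → ℝ := fun n => mollify D (shrinkingBump d n) u' with hU'
  have hUs : ∀ n, ContDiff ℝ (⊤ : ℕ∞) (U n) := fun n => contDiff_mollify _ hu
  have hUs' : ∀ n, ContDiff ℝ (⊤ : ℕ∞) (U' n) := fun n => contDiff_mollify _ hu'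
  have hstep : ∀ᶠ n in atTop,
      (∫ x, ((∂_{unitVec i} φ : 𝓓(D, ℝ)) x * U n x + φ x * U' n x) • v x ∂vol D) =
        -∫ x, (φ x * U n x) • v' x ∂vol D := by
    filter_upwards [hev] with n hn
    -- For a smooth factor the product rule is just the choice of `φ U_n` as a test function for
    -- `v`.
    have := h' (testMul φ (U n) (hUs n))
    rw [← show (∫ x, (∂_{unitVec i} (testMul φ (U n) (hUs n)) : 𝓓(D, ℝ)) x • v x ∂vol D) = _
      from integral_congr_ae (Eventually.of_forall fun x => ?_), this]
    · rfl
    · simp only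
      rw [lineDeriv_testMul]
      congr 2
      by_cases hx : x ∈ tsupport φ
      · rw [hU, fderiv_mollify _ hu h]
        exact ((Metric.closedBall_subset_closedBall hn).trans
          (Metric.closedBall_subset_cthickening hx δ)).trans hδD
      · rw [image_eq_zero_of_notMem_tsupport hx, zero_mul, zero_mul]
  have hm : ∀ (χ : 𝓓(D, ℝ)) (w : Vec d → X), LocallyIntegrableOn w D (vol D) →
      AEStronglyMeasurable (fun x => χ x • w x) (vol D) := fun χ w hw =>
    (integrable_smul_test χ hw).aestronglyMeasurable
  -- the left-hand sides converge
  have hlim1 : Tendsto (fun n => ∫ x, ((∂_{unitVec i} φ : 𝓓(D, ℝ)) x * U n x + φ x * U' n x) • v x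
      ∂vol D) atTop (𝓝 (∫ x, ((∂_{unitVec i} φ : 𝓓(D, ℝ)) x * u x + φ x * u' x) • v x ∂vol D)) := by
    refine tendsto_integral_of_dominated_convergence
      (fun x => max C 0 * ‖(∂_{unitVec i} φ : 𝓓(D, ℝ)) x • v x‖ + max C' 0 * ‖φ x • v x‖)
      (fun n => ?_) ?_ (fun n => Eventually.of_forall fun x => ?_) ?_
    · have : (fun x => ((∂_{unitVec i} φ : 𝓓(D, ℝ)) x * U n x + φ x * U' n x) • v x) =
          fun x => U n x • ((∂_{unitVec i} φ : 𝓓(D, ℝ)) x • v x) + U' n x • (φ x • v x) := by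
        funext x; simp only [add_smul, smul_smul]; ring_nf
      rw [this]
      exact ((hUs n).continuous.aestronglyMeasurable.smul (hm _ _ hv)).add
        ((hUs' n).continuous.aestronglyMeasurable.smul (hm _ _ hv))
    · exact ((integrable_smul_test _ hv).norm.const_mul _).add
        ((integrable_smul_test _ hv).norm.const_mul _)
    · rw [add_smul]
      refine (norm_add_le _ _).trans (add_le_add ?_ ?_)
      · rw [mul_comm, mul_smul, norm_smul]
        exact mul_le_mul_of_nonneg_right (abs_mollify_le _ hC x) (norm_nonneg _)
      · rw [mul_comm, mul_smul, norm_smul]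
        exact mul_le_mul_of_nonneg_right (abs_mollify_le _ hC' x) (norm_nonneg _)
    · filter_upwards [ae_tendsto_mollify hu, ae_tendsto_mollify hu'] with x hx hx'
      exact ((hx.const_mul _).add (hx'.const_mul _)).smul_const _
  have hlim2 : Tendsto (fun n => -∫ x, (φ x * U n x) • v' x ∂vol D) atTop
      (𝓝 (-∫ x, (φ x * u x) • v' x ∂vol D)) := by
    refine (tendsto_integral_of_dominated_convergence
      (fun x => max C 0 * ‖φ x • v' x‖) (fun n => ?_) ?_
      (fun n => Eventually.of_forall fun x => ?_) ?_).neg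
    · have : (fun x => (φ x * U n x) • v' x) = fun x => U n x • (φ x • v' x) := by
        funext x; rw [smul_smul, mul_comm]
      rw [this]
      exact (hUs n).continuous.aestronglyMeasurable.smul (hm _ _ hv')
    · exact (integrable_smul_test _ hv').norm.const_mul _
    · rw [mul_comm, mul_smul, norm_smul]
      exact mul_le_mul_of_nonneg_right (abs_mollify_le _ hC x) (norm_nonneg _)
    · filter_upwards [ae_tendsto_mollify hu] with x hx
      exact (hx.const_mul _).smul_const _
  -- This is the product rule up to rearrangement; what follows only justifies splitting the
  -- integrals.
  have heq := tendsto_nhds_unique (hlim1.congr' hstep) hlim2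
  have hint : ∀ (χ : 𝓓(D, ℝ)) (g : Vec d → ℝ) (w : Vec d → X), MemLp g ∞ (vol D) →
      LocallyIntegrableOn w D (vol D) → Integrable (fun x => χ x • (g x • w x)) (vol D) := by
    intro χ g w hg hw
    have := memLp_one_iff_integrable.mp
      ((memLp_one_iff_integrable.mpr (integrable_smul_test χ hw)).smul (r := 1) hg)
    refine this.congr (Eventually.of_forall fun x => ?_)
    simp only [Pi.smul_apply', smul_smul, mul_comm]
  simp only [smul_add]
  rw [integral_add (hint _ _ _ hu' hv) (hint _ _ _ hu hv')]
  simp only [add_smul, mul_smul] at heq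
  rw [integral_add (hint _ _ _ hu hv) (hint _ _ _ hu' hv)] at heq
  rw [eq_sub_of_add_eq heq]
  abel

end Product

/-! ### Weak partial derivatives of `L^p` functions -/

section LpPartial

open Filter Topology

variable {d : ℕ} {D : Opens (Vec d)} {p : ℝ≥0∞} [hp : Fact (1 ≤ p)]
variable {X Y Z : Type*} [NormedAddCommGroup X] [NormedSpace ℝ X] [NormedAddCommGroup Y]
  [NormedSpace ℝ Y] [NormedAddCommGroup Z] [NormedSpace ℝ Z]

theorem locInt_lp (f : Lp X p (vol D)) : LocallyIntegrableOn f D (vol D) :=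
  ((Lp.memLp f).locallyIntegrable hp.out).locallyIntegrableOn _

theorem IsWeakPartial.lp_sum {ι : Type*} (s : Finset ι) {i : Fin d} {v w : ι → Lp X p (vol D)}
    (h : ∀ j ∈ s, IsWeakPartial D i (v j) (w j)) :
    IsWeakPartial D i (∑ j ∈ s, v j : Lp X p (vol D)) (∑ j ∈ s, w j : Lp X p (vol D)) := by
  refine (IsWeakPartial.sum s h (fun j _ => locInt_lp _) (fun j _ => locInt_lp _)).congr ?_ ?_
  · filter_upwards [Lp.coeFn_finsetSum s v] with x hx
    rw [hx, Finset.sum_apply]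
  · filter_upwards [Lp.coeFn_finsetSum s w] with x hx
    rw [hx, Finset.sum_apply]

theorem IsWeakPartial.lp_smul (c : ℝ) {i : Fin d} {v w : Lp X p (vol D)}
    (h : IsWeakPartial D i v w) :
    IsWeakPartial D i (c • v : Lp X p (vol D)) (c • w : Lp X p (vol D)) :=
  (h.smul_const c).congr (Lp.coeFn_smul c v).symm (Lp.coeFn_smul c w).symm

/-- The product rule for weak derivatives, with respect to a continuous bilinear map. -/
theorem IsWeakPartial.lp_bilin [FiniteDimensional ℝ X] [CompleteSpace Y] [CompleteSpace Z]
    (B : X →L[ℝ] Y →L[ℝ] Z) {i : Fin d} {u u' : Lp X ∞ (vol D)} {v v' : Lp Y p (vol D)}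
    (h : IsWeakPartial D i u u') (h' : IsWeakPartial D i v v') :
    IsWeakPartial D i (B.holder p u v) (B.holder p u' v + B.holder p u v' : Lp Z p (vol D)) := by
  have : CompleteSpace X := FiniteDimensional.complete ℝ X
  -- Coordinates in the finite-dimensional factor reduce the bilinear product to finitely many
  -- products `ℓ_j(u) • B(b_j, v)` with a scalar function.
  let b := Module.finBasis ℝ X
  let ℓ : Fin (Module.finrank ℝ X) → X →L[ℝ] ℝ := fun j =>
    LinearMap.toContinuousLinearMap (b.coord j)
  have hB : ∀ (x : X) (y : Y), B x y = ∑ j, ℓ j x • B (b j) y := by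
    intro x y
    conv_lhs => rw [← b.sum_repr x]
    rw [map_sum, sum_apply]
    simp [ℓ]
  have hmem : ∀ j (f : Lp X ∞ (vol D)), MemLp (fun x => ℓ j (f x)) ∞ (vol D) := fun j f =>
    (ℓ j).comp_memLp f
  have hmem' : ∀ j (g : Lp Y p (vol D)), LocallyIntegrableOn (fun x => B (b j) (g x)) D (vol D) :=
    fun j g => locInt_of_memLp hp.out ((B (b j)).comp_memLp g)
  have hloc : ∀ j (f : Lp X ∞ (vol D)) (g : Lp Y p (vol D)),
      LocallyIntegrableOn (fun x => ℓ j (f x) • B (b j) (g x)) D (vol D) := by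
    intro j f g
    refine locInt_of_memLp hp.out (((B (b j)).comp_memLp g).smul (p := ∞) (hmem j f))
  have key : ∀ j, IsWeakPartial D i (fun x => ℓ j (u x) • B (b j) (v x))
      (fun x => ℓ j (u' x) • B (b j) (v x) + ℓ j (u x) • B (b j) (v' x)) := fun j =>
    IsWeakPartial.smul (hmem j u) (hmem j u') (hmem' j v) (hmem' j v')
      (h.clm (ℓ j) (locInt_lp u) (locInt_lp u')) (h'.clm (B (b j)) (locInt_lp v) (locInt_lp v'))
  refine (IsWeakPartial.sum Finset.univ (fun j _ => key j) (fun j _ => hloc j u v)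
    (fun j _ => (hloc j u' v).add (hloc j u v'))).congr ?_ ?_
  · filter_upwards [B.coeFn_holder (r := p) u v] with x hx
    rw [hx, hB]
  · filter_upwards [B.coeFn_holder (r := p) u' v, B.coeFn_holder (r := p) u v',
      Lp.coeFn_add (B.holder p u' v) (B.holder p u v')] with x h1 h2 h3
    rw [h3, Pi.add_apply, h1, h2, hB, hB, Finset.sum_add_distrib]

/-- Integration against a test function, as a continuous functional on `L^p`. -/
theorem continuous_integral_test [CompleteSpace X] (φ : 𝓓(D, ℝ)) :
    Continuous fun f : Lp X p (vol D) => ∫ x, φ x • f x ∂vol D := by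
  have := ENNReal.HolderConjugate.conjExponent hp.out
  have : ENNReal.HolderConjugate p.conjExponent p := ENNReal.HolderConjugate.symm
  have : Fact (1 ≤ p.conjExponent) := ⟨ENNReal.HolderConjugate.one_le p.conjExponent p⟩
  have hφ : MemLp φ p.conjExponent (vol D) :=
    φ.continuous.memLp_of_hasCompactSupport φ.hasCompactSupport
  have := ((ContinuousLinearMap.lsmul ℝ ℝ : ℝ →L[ℝ] X →L[ℝ] X).lpPairing (vol D)
    p.conjExponent p (hφ.toLp φ)).continuous
  refine this.congr fun f => ?_
  rw [ContinuousLinearMap.lpPairing_eq_integral]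
  refine integral_congr_ae ?_
  filter_upwards [hφ.coeFn_toLp] with x hx
  simp [hx]

end LpPartial

/-! ### Normalised derivatives -/

section Coef

open Filter Topology

variable {d k : ℕ} {D : Opens (Vec d)} {p : ℝ≥0∞} [hp : Fact (1 ≤ p)]
variable {X Y Z : Type*} [NormedAddCommGroup X] [NormedSpace ℝ X] [NormedAddCommGroup Y]
  [NormedSpace ℝ Y] [NormedAddCommGroup Z] [NormedSpace ℝ Z]

theorem multiFact_pos (α : Fin d → ℕ) : 0 < (multiFact α : ℝ) := by
  unfold multiFact
  exact_mod_cast Finset.prod_pos fun i _ => Nat.factorial_pos _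

theorem multiFact_add_single (α : Fin d → ℕ) (i : Fin d) :
    (multiFact (α + Pi.single i 1) : ℝ) = (α i + 1) * multiFact α := by
  unfold multiFact
  rw [← Finset.mul_prod_erase Finset.univ _ (Finset.mem_univ i),
    ← Finset.mul_prod_erase Finset.univ (fun j => (α j).factorial) (Finset.mem_univ i)]
  have : ∏ x ∈ Finset.univ.erase i, ((α + Pi.single i 1 : Fin d → ℕ) x).factorial =
      ∏ x ∈ Finset.univ.erase i, (α x).factorial := by
    refine Finset.prod_congr rfl fun j hj => ?_
    simp [Finset.ne_of_mem_erase hj]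
  rw [this]
  simp [Nat.factorial_succ]
  ring

/-- The normalised derivative `∂^α v / α!`, with the value `0` if `|α| > k`. -/
def Sobolev.coef (v : Sobolev D k p X) (α : Fin d → ℕ) : Lp X p (vol D) :=
  if h : α ∈ multiIdx d k then (1 / (multiFact α : ℝ)) • v.deriv ⟨α, h⟩ else 0

theorem Sobolev.coef_of_mem (v : Sobolev D k p X) {α : Fin d → ℕ} (h : α ∈ multiIdx d k) :
    v.coef α = (1 / (multiFact α : ℝ)) • v.deriv ⟨α, h⟩ := by
  rw [Sobolev.coef, dif_pos h]

theorem Sobolev.deriv_eq_coef (v : Sobolev D k p X) {α : Fin d → ℕ} (h : α ∈ multiIdx d k) :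
    v.deriv ⟨α, h⟩ = (multiFact α : ℝ) • v.coef α := by
  rw [v.coef_of_mem h, smul_smul, mul_one_div_cancel (multiFact_pos α).ne', one_smul]

theorem Sobolev.coef_add (v w : Sobolev D k p X) (α : Fin d → ℕ) :
    (v + w).coef α = v.coef α + w.coef α := by
  by_cases h : α ∈ multiIdx d k
  · rw [coef_of_mem _ h, coef_of_mem _ h, coef_of_mem _ h, ← smul_add]; rfl
  · simp [Sobolev.coef, h]

theorem Sobolev.coef_smul (c : ℝ) (v : Sobolev D k p X) (α : Fin d → ℕ) :
    (c • v).coef α = c • v.coef α := by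
  by_cases h : α ∈ multiIdx d k
  · rw [coef_of_mem _ h, coef_of_mem _ h, smul_comm]; rfl
  · simp [Sobolev.coef, h]

theorem Sobolev.coef_zero_eq (v : Sobolev D k p X) : v.coef 0 = v.toLp := by
  rw [v.coef_of_mem (zero_mem_multiIdx d k)]
  simp [multiFact, Sobolev.toLp]

theorem Sobolev.norm_eq_sum_coef (v : Sobolev D k p X) :
    ‖v‖ = ∑ α ∈ multiIdx d k, ‖v.coef α‖ := by
  rw [Sobolev.norm_def, ← Finset.sum_coe_sort (multiIdx d k) fun α => ‖v.coef α‖]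
  refine Finset.sum_congr rfl fun α _ => ?_
  rw [v.coef_of_mem α.2, norm_smul, Real.norm_of_nonneg (by positivity)]

/-- Normalised derivatives behave like Taylor coefficients: `∂_i` shifts the index by `e_i` and
multiplies by `α_i + 1`. This is what removes binomial coefficients from the Leibniz rule. -/
theorem Sobolev.isWeakPartial_coef (v : Sobolev D k p X) {α : Fin d → ℕ} (i : Fin d)
    (h : ∑ j, α j < k) : IsWeakPartial D i (v.coef α)
      (((α i : ℝ) + 1) • v.coef (α + Pi.single i 1) : Lp X p (vol D)) := by
  have h1 : α ∈ multiIdx d k := mem_multiIdx.mpr h.le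
  have h2 : α + Pi.single i 1 ∈ multiIdx d k := by rw [mem_multiIdx, sum_add_single]; omega
  have h3 := (IsWeakDeriv.isWeakPartial (v.2 ⟨α, h1⟩) (v.2 ⟨α + Pi.single i 1, h2⟩)).lp_smul
    (1 / (multiFact α : ℝ))
  rw [v.coef_of_mem h1, v.coef_of_mem h2, smul_smul, multiFact_add_single]
  have h4 : ((α i : ℝ) + 1) * (1 / (((α i : ℝ) + 1) * multiFact α)) = 1 / (multiFact α : ℝ) := by
    have := (multiFact_pos α).ne'
    field_simp
  rw [h4]
  exact h3

/-- The element of `W^{k,p}` with a given family of normalised derivatives. -/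
def Sobolev.ofCoef (k : ℕ) (w : (Fin d → ℕ) → Lp X p (vol D))
    (h : ∀ (α : Fin d → ℕ) (i : Fin d), ∑ j, α j < k → IsWeakPartial D i (w α)
      (((α i : ℝ) + 1) • w (α + Pi.single i 1) : Lp X p (vol D))) : Sobolev D k p X :=
  ⟨fun α => (multiFact α.1 : ℝ) • w α.1, by
    rintro ⟨α, hα⟩
    change IsWeakDeriv D α ((multiFact (0 : Fin d → ℕ) : ℝ) • w 0 : Lp X p (vol D))
      ((multiFact α : ℝ) • w α : Lp X p (vol D))
    rw [mem_multiIdx] at hα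
    induction α using multiIndex_induction with
    | h0 => exact isWeakDeriv_zero _
    | hs α i ih =>
      rw [sum_add_single] at hα
      have h1 := (h α i (by omega)).lp_smul (multiFact α : ℝ)
      have h2 := (ih (by omega)).trans_partial h1
      rwa [smul_smul, mul_comm, ← multiFact_add_single] at h2⟩

theorem Sobolev.coef_ofCoef {w : (Fin d → ℕ) → Lp X p (vol D)} (h) {α : Fin d → ℕ}
    (hα : ∑ j, α j ≤ k) : (Sobolev.ofCoef k w h).coef α = w α := by
  rw [Sobolev.coef_of_mem _ (mem_multiIdx.mpr hα)]
  change (1 / (multiFact α : ℝ)) • ((multiFact α : ℝ) • w α) = w α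
  rw [smul_smul, one_div_mul_cancel (multiFact_pos α).ne', one_smul]

theorem Sobolev.toLp_ofCoef {w : (Fin d → ℕ) → Lp X p (vol D)} (h) :
    (Sobolev.ofCoef k w h).toLp = w 0 := by
  rw [← Sobolev.coef_zero_eq, Sobolev.coef_ofCoef h (by simp)]

theorem Sobolev.norm_ofCoef {w : (Fin d → ℕ) → Lp X p (vol D)} (h) :
    ‖Sobolev.ofCoef k w h‖ = ∑ α ∈ multiIdx d k, ‖w α‖ := by
  rw [Sobolev.norm_eq_sum_coef]
  exact Finset.sum_congr rfl fun α hα => by rw [Sobolev.coef_ofCoef h (mem_multiIdx.mp hα)]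

/-- Weak derivatives are unique: an element of `W^{k,p}` is determined by its underlying
function. -/
theorem Sobolev.ext_toLp [CompleteSpace X] {v w : Sobolev D k p X} (h : v.toLp = w.toLp) :
    v = w := by
  refine Subtype.ext (funext fun α => ?_)
  have h1 := v.2 α
  have h2 := w.2 α
  refine Lp.ext (IsWeakDeriv.unique h1 ?_ (locInt_lp _) (locInt_lp _))
  have h3 : v.1 ⟨0, zero_mem_multiIdx d k⟩ = w.1 ⟨0, zero_mem_multiIdx d k⟩ := h
  rw [h3]
  exact h2

theorem Sobolev.norm_coef_le (v : Sobolev D k p X) (α : Fin d → ℕ) : ‖v.coef α‖ ≤ ‖v‖ := by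
  by_cases h : α ∈ multiIdx d k
  · rw [v.norm_eq_sum_coef]
    exact Finset.single_le_sum (f := fun α => ‖v.coef α‖) (fun _ _ => norm_nonneg _) h
  · rw [Sobolev.coef, dif_neg h, norm_zero]; exact norm_nonneg _

/-- The normalised derivative as a continuous linear map. -/
def Sobolev.coefL (α : Fin d → ℕ) : Sobolev D k p X →L[ℝ] Lp X p (vol D) :=
  LinearMap.mkContinuous
    { toFun := fun v => v.coef α
      map_add' := fun v w => Sobolev.coef_add v w α
      map_smul' := fun c v => Sobolev.coef_smul c v α } 1
    (fun v => by simpa using v.norm_coef_le α)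

@[simp]
theorem Sobolev.coefL_apply (α : Fin d → ℕ) (v : Sobolev D k p X) :
    Sobolev.coefL α v = v.coef α := rfl

/-- The underlying function as a continuous linear map. -/
def Sobolev.toLpL : Sobolev D k p X →L[ℝ] Lp X p (vol D) := Sobolev.coefL 0

@[simp]
theorem Sobolev.toLpL_apply (v : Sobolev D k p X) : Sobolev.toLpL v = v.toLp :=
  v.coef_zero_eq

/-- Each defining identity equates two continuous functions, because integration against a test
function is continuous on `L^p`. -/
theorem isClosed_sobolevSubmodule [CompleteSpace X] :
    IsClosed (sobolevSubmodule D k p X : Set (multiIdx d k → Lp X p (vol D))) := by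
  have : (sobolevSubmodule D k p X : Set (multiIdx d k → Lp X p (vol D))) =
      ⋂ (α : multiIdx d k) (φ : 𝓓(D, ℝ)), {v | ∫ x, testDeriv α.1 φ x •
        (v ⟨0, zero_mem_multiIdx d k⟩ : Lp X p (vol D)) x ∂vol D =
          (-1 : ℝ) ^ (∑ i, α.1 i) • ∫ x, φ x • (v α : Lp X p (vol D)) x ∂vol D} := by
    ext v
    simp only [mem_iInter, mem_ofPred_eq]
    rfl
  rw [this]
  refine isClosed_iInter fun α => isClosed_iInter fun φ => isClosed_eq ?_ ?_
  · exact (continuous_integral_test _).comp (continuous_apply _)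
  · exact ((continuous_integral_test _).comp (continuous_apply _)).const_smul _

/-- The Sobolev norm is equivalent to the sup norm on a closed subspace of a finite product of `L^p`
spaces. -/
instance [CompleteSpace X] : CompleteSpace (Sobolev D k p X) := by
  have : CompleteSpace (sobolevSubmodule D k p X) :=
    isClosed_sobolevSubmodule.isComplete.completeSpace_coe
  let e : sobolevSubmodule D k p X ≃ₗ[ℝ] Sobolev D k p X := LinearEquiv.refl ℝ _
  have h1 : ∀ v, ‖e v‖ ≤ (∑ α : multiIdx d k, (1 / (multiFact α.1 : ℝ))) * ‖v‖ := by
    intro v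
    rw [Sobolev.norm_def, Finset.sum_mul]
    refine Finset.sum_le_sum fun α _ => mul_le_mul_of_nonneg_left ?_ (by positivity)
    exact norm_le_pi_norm v.1 α
  have h2 : ∀ v, ‖e.symm v‖ ≤ (∑ α : multiIdx d k, (multiFact α.1 : ℝ)) * ‖v‖ := by
    intro v
    refine (pi_norm_le_iff_of_nonneg (by positivity)).mpr fun α => ?_
    change ‖v.deriv α‖ ≤ _
    rw [v.deriv_eq_coef α.2, norm_smul, Real.norm_of_nonneg (by positivity)]
    refine mul_le_mul ?_ (v.norm_coef_le _) (norm_nonneg _) (by positivity)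
    exact Finset.single_le_sum (f := fun α : multiIdx d k => (multiFact α.1 : ℝ))
      (fun _ _ => by positivity) (Finset.mem_univ α)
  let E := e.toContinuousLinearEquivOfBounds _ _ h1 h2
  exact (completeSpace_congr (e := E.toEquiv) E.isUniformEmbedding).mp inferInstance

end Coef

/-! ### Operations on Sobolev functions -/

section Operations

open Filter Topology

variable {d k : ℕ} {D : Opens (Vec d)} {p : ℝ≥0∞} [hp : Fact (1 ≤ p)]
variable {X Y Z : Type*} [NormedAddCommGroup X] [NormedSpace ℝ X] [NormedAddCommGroup Y]
  [NormedSpace ℝ Y] [NormedAddCommGroup Z] [NormedSpace ℝ Z]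

/-- The Cauchy product rule for normalised derivatives. -/
theorem sum_Iic_add_single {M : Type*} [AddCommGroup M] [Module ℝ M]
    (f : (Fin d → ℕ) → (Fin d → ℕ) → M) (α : Fin d → ℕ) (i : Fin d) :
    ∑ β ∈ Finset.Iic α, (((β i : ℝ) + 1) • f (β + Pi.single i 1) (α - β) +
        (((α - β) i : ℕ) + 1 : ℝ) • f β (α - β + Pi.single i 1)) =
      ((α i : ℝ) + 1) • ∑ β ∈ Finset.Iic (α + Pi.single i 1), f β (α + Pi.single i 1 - β) := by
  -- Shift `β` by `e_i`; the indices that are not reached have `β_i = 0` and carry weight zero. In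
  -- `h2` there is no shift, and the missed indices have vanishing weight for the same reason.
  have h1 : ∑ β ∈ Finset.Iic α, ((β i : ℝ) + 1) • f (β + Pi.single i 1) (α - β) =
      ∑ β ∈ Finset.Iic (α + Pi.single i 1), (β i : ℝ) • f β (α + Pi.single i 1 - β) := by
    refine Finset.sum_of_injOn (fun β => β + Pi.single i 1) (fun a _ b _ h => by simpa using h)
      (fun β hβ => ?_) (fun β hβ hn => ?_) (fun β hβ => ?_)
    · simp only [Finset.coe_Iic, mem_Iic] at hβ ⊢
      exact add_le_add_left hβ _
    · by_cases h0 : β i = 0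
      · simp [h0]
      · refine absurd ⟨β - Pi.single i 1, ?_, ?_⟩ hn
        · simp only [Finset.coe_Iic, mem_Iic, Finset.mem_Iic] at hβ ⊢
          exact tsub_le_iff_right.mpr hβ
        · refine tsub_add_cancel_of_le fun j => ?_
          by_cases hj : j = i
          · subst hj; simp; omega
          · simp [hj]
    · simp [add_tsub_add_eq_tsub_right]
  have h2 : ∑ β ∈ Finset.Iic α, (((α - β) i : ℕ) + 1 : ℝ) • f β (α - β + Pi.single i 1) =
      ∑ β ∈ Finset.Iic (α + Pi.single i 1), (((α + Pi.single i 1 - β : Fin d → ℕ) i : ℕ) : ℝ) •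
        f β (α + Pi.single i 1 - β) := by
    refine Finset.sum_of_injOn (fun β => β) (fun a _ b _ h => h)
      (fun β hβ => ?_) (fun β hβ hn => ?_) (fun β hβ => ?_)
    · simp only [Finset.coe_Iic, mem_Iic] at hβ ⊢
      exact hβ.trans (by simp)
    · have h0 : (α + Pi.single i 1 - β : Fin d → ℕ) i = 0 := by
        by_contra h0
        refine hn ⟨β, ?_, rfl⟩
        simp only [Finset.coe_Iic, mem_Iic, Finset.mem_Iic] at hβ ⊢
        intro j
        by_cases hj : j = i
        · subst hj
          simp only [Pi.sub_apply, Pi.add_apply, Pi.single_eq_same] at h0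
          change β j ≤ α j
          omega
        · simpa [hj] using hβ j
      simp [h0]
    · rw [Finset.mem_Iic] at hβ
      have : α - β + Pi.single i 1 = α + Pi.single i 1 - β := (tsub_add_eq_add_tsub hβ)
      rw [← this]
      simp
  rw [Finset.sum_add_distrib, h1, h2, ← Finset.sum_add_distrib, Finset.smul_sum]
  refine Finset.sum_congr rfl fun β hβ => ?_
  -- The two weights add up to `(α + e_i)_i = α_i + 1`, independently of `β`.
  rw [← add_smul]
  congr 1
  rw [Finset.mem_Iic] at hβ
  have := hβ i
  rw [← Nat.cast_add]
  have h3 : β i + (α + Pi.single i 1 - β : Fin d → ℕ) i = α i + 1 := by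
    simp at this ⊢; omega
  rw [h3]; push_cast; ring

theorem sum_tsub {α β : Fin d → ℕ} (h : β ≤ α) :
    ∑ j, β j + ∑ j, (α - β) j = ∑ j, α j := by
  rw [← Finset.sum_add_distrib]
  refine Finset.sum_congr rfl fun j _ => ?_
  exact Nat.add_sub_of_le (h j)

/-- The normalised derivatives of a product, by the Leibniz rule. -/
def leibniz (B : X →L[ℝ] Y →L[ℝ] Z) (u : Sobolev D k ∞ X) (v : Sobolev D k p Y)
    (α : Fin d → ℕ) : Lp Z p (vol D) :=
  ∑ β ∈ Finset.Iic α, B.holder p (u.coef β) (v.coef (α - β))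

/-- The product of a `W^{k,∞}`-function and a `W^{k,p}`-function, with respect to a continuous
bilinear map. -/
def Sobolev.bilin [FiniteDimensional ℝ X] [CompleteSpace Y] [CompleteSpace Z]
    (B : X →L[ℝ] Y →L[ℝ] Z) (u : Sobolev D k ∞ X) (v : Sobolev D k p Y) : Sobolev D k p Z :=
  Sobolev.ofCoef k (leibniz B u v) (by
    intro α i hα
    have key : ∀ β ∈ Finset.Iic α, IsWeakPartial D i (B.holder p (u.coef β) (v.coef (α - β)))
        (((β i : ℝ) + 1) • B.holder p (u.coef (β + Pi.single i 1)) (v.coef (α - β)) +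
          (((α - β) i : ℕ) + 1 : ℝ) • B.holder p (u.coef β) (v.coef (α - β + Pi.single i 1)) :
            Lp Z p (vol D)) := by
      intro β hβ
      rw [Finset.mem_Iic] at hβ
      have hs := sum_tsub hβ
      have := IsWeakPartial.lp_bilin B (u.isWeakPartial_coef (α := β) i (by omega))
        (v.isWeakPartial_coef (α := α - β) i (by omega))
      rwa [B.holder_smul_left, B.holder_smul_right] at this
    have h := IsWeakPartial.lp_sum _ key
    rwa [sum_Iic_add_single (fun β γ => B.holder p (u.coef β) (v.coef γ))] at h)

theorem Sobolev.coef_bilin [FiniteDimensional ℝ X] [CompleteSpace Y] [CompleteSpace Z]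
    (B : X →L[ℝ] Y →L[ℝ] Z) (u : Sobolev D k ∞ X) (v : Sobolev D k p Y) {α : Fin d → ℕ}
    (h : ∑ j, α j ≤ k) : (Sobolev.bilin B u v).coef α =
      ∑ β ∈ Finset.Iic α, B.holder p (u.coef β) (v.coef (α - β)) :=
  Sobolev.coef_ofCoef _ h

theorem Sobolev.toLp_bilin [FiniteDimensional ℝ X] [CompleteSpace Y] [CompleteSpace Z]
    (B : X →L[ℝ] Y →L[ℝ] Z) (u : Sobolev D k ∞ X) (v : Sobolev D k p Y) :
    (Sobolev.bilin B u v).toLp = B.holder p u.toLp v.toLp := by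
  rw [← coef_zero_eq, coef_bilin _ _ _ (by simp), ← coef_zero_eq, ← coef_zero_eq]
  have : Finset.Iic (0 : Fin d → ℕ) = {0} := by
    ext β; simp
  rw [this]
  simp

theorem Sobolev.toLp_bilin_ae [FiniteDimensional ℝ X] [CompleteSpace Y] [CompleteSpace Z]
    (B : X →L[ℝ] Y →L[ℝ] Z) (u : Sobolev D k ∞ X) (v : Sobolev D k p Y) :
    (Sobolev.bilin B u v).toLp =ᵐ[vol D] fun x => B (u.toLp x) (v.toLp x) := by
  rw [Sobolev.toLp_bilin]
  exact B.coeFn_holder _ _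

/-! ### Weighted norms and the product estimate -/

/-- The weighted norm `∑_{|α| ≤ k} (ε^|α| / α!) ‖∂^α v‖_{L^p}`. -/
def Sobolev.wnorm (ε : ℝ) (v : Sobolev D k p X) : ℝ :=
  ∑ α ∈ multiIdx d k, ε ^ (∑ j, α j) * ‖v.coef α‖

theorem Sobolev.wnorm_one (v : Sobolev D k p X) : v.wnorm 1 = ‖v‖ := by
  simp [Sobolev.wnorm, Sobolev.norm_eq_sum_coef]

theorem Sobolev.wnorm_le_norm {ε : ℝ} (h0 : 0 ≤ ε) (h1 : ε ≤ 1) (v : Sobolev D k p X) :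
    v.wnorm ε ≤ ‖v‖ := by
  rw [v.norm_eq_sum_coef]
  refine Finset.sum_le_sum fun α _ => ?_
  exact mul_le_of_le_one_left (norm_nonneg _) (pow_le_one₀ h0 h1)

/-- Orders run up to `k`, so the smallest weight is `ε^k`. -/
theorem Sobolev.norm_le_wnorm {ε : ℝ} (h0 : 0 < ε) (h1 : ε ≤ 1) (v : Sobolev D k p X) :
    ‖v‖ ≤ (ε⁻¹) ^ k * v.wnorm ε := by
  rw [v.norm_eq_sum_coef, Sobolev.wnorm, Finset.mul_sum]
  refine Finset.sum_le_sum fun α hα => ?_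
  rw [← mul_assoc]
  refine le_mul_of_one_le_left (norm_nonneg _) ?_
  rw [mem_multiIdx] at hα
  calc (1 : ℝ) = (ε⁻¹) ^ k * ε ^ k := by rw [← mul_pow, inv_mul_cancel₀ h0.ne', one_pow]
    _ ≤ _ := mul_le_mul_of_nonneg_left (pow_le_pow_of_le_one h0.le h1 hα) (by positivity)

/-- In normalised derivatives the Leibniz rule is a Cauchy product with unit coefficients, and
`ε^|α|` is multiplicative in `α`. The pairs `(β, α - β)` are distinct, so the resulting sum is part
of the full double sum that the product of the two norms expands to. -/
theorem Sobolev.wnorm_bilin_le [FiniteDimensional ℝ X] [CompleteSpace Y] [CompleteSpace Z]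
    {ε : ℝ} (h0 : 0 ≤ ε) (B : X →L[ℝ] Y →L[ℝ] Z) (u : Sobolev D k ∞ X) (v : Sobolev D k p Y) :
    (Sobolev.bilin B u v).wnorm ε ≤ ‖B‖ * u.wnorm ε * v.wnorm ε := by
  calc (Sobolev.bilin B u v).wnorm ε
      ≤ ∑ α ∈ multiIdx d k, ∑ β ∈ Finset.Iic α,
          ‖B‖ * ((ε ^ (∑ j, β j) * ‖u.coef β‖) * (ε ^ (∑ j, (α - β) j) * ‖v.coef (α - β)‖)) := by
        refine Finset.sum_le_sum fun α hα => ?_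
        rw [Sobolev.coef_bilin B u v (mem_multiIdx.mp hα)]
        refine (mul_le_mul_of_nonneg_left (norm_sum_le _ _) (pow_nonneg h0 _)).trans ?_
        rw [Finset.mul_sum]
        refine Finset.sum_le_sum fun β hβ => ?_
        rw [Finset.mem_Iic] at hβ
        rw [← sum_tsub hβ, pow_add]
        calc _ ≤ ε ^ (∑ j, β j) * ε ^ (∑ j, (α - β) j) *
              (‖B‖ * ‖u.coef β‖ * ‖v.coef (α - β)‖) :=
              mul_le_mul_of_nonneg_left (B.norm_holder_apply_apply_le _ _) (by positivity)
          _ = _ := by ring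
    _ = ∑ q ∈ (multiIdx d k).sigma fun α => Finset.Iic α,
          ‖B‖ * ((ε ^ (∑ j, q.2 j) * ‖u.coef q.2‖) *
            (ε ^ (∑ j, (q.1 - q.2) j) * ‖v.coef (q.1 - q.2)‖)) := by
        rw [Finset.sum_sigma]
    _ ≤ ∑ q ∈ multiIdx d k ×ˢ multiIdx d k, ‖B‖ * ((ε ^ (∑ j, q.1 j) * ‖u.coef q.1‖) *
          (ε ^ (∑ j, q.2 j) * ‖v.coef q.2‖)) := by
        rw [← Finset.sum_image (s := (multiIdx d k).sigma fun α => Finset.Iic α)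
          (g := fun q : (Σ _ : Fin d → ℕ, Fin d → ℕ) => (q.2, q.1 - q.2))
          (f := fun q : (Fin d → ℕ) × (Fin d → ℕ) =>
            ‖B‖ * ((ε ^ (∑ j, q.1 j) * ‖u.coef q.1‖) * (ε ^ (∑ j, q.2 j) * ‖v.coef q.2‖)))]
        · refine Finset.sum_le_sum_of_subset_of_nonneg ?_ fun _ _ _ => by positivity
          intro q hq
          obtain ⟨⟨α, β⟩, hαβ, rfl⟩ := Finset.mem_image.mp hq
          rw [Finset.mem_sigma, Finset.mem_Iic, mem_multiIdx] at hαβ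
          have := sum_tsub hαβ.2
          rw [Finset.mem_product, mem_multiIdx, mem_multiIdx]
          constructor <;> simp only at * <;> omega
        · rintro ⟨α, β⟩ hq ⟨α', β'⟩ hq' h
          simp only [Finset.coe_sigma, Set.mem_sigma_iff, Finset.mem_coe, Finset.mem_Iic]
            at hq hq'
          simp only [Prod.mk.injEq] at h
          obtain ⟨rfl, h2⟩ := h
          have : α = α' := by
            rw [← tsub_add_cancel_of_le hq.2, h2, tsub_add_cancel_of_le hq'.2]
          rw [this]
    _ = ‖B‖ * u.wnorm ε * v.wnorm ε := by
        rw [Finset.sum_product, Sobolev.wnorm, Sobolev.wnorm, mul_assoc, Finset.sum_mul_sum,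
          Finset.mul_sum]
        exact Finset.sum_congr rfl fun _ _ => (Finset.mul_sum _ _ _).symm

theorem Sobolev.norm_bilin_le [FiniteDimensional ℝ X] [CompleteSpace Y] [CompleteSpace Z]
    (B : X →L[ℝ] Y →L[ℝ] Z) (u : Sobolev D k ∞ X) (v : Sobolev D k p Y) :
    ‖Sobolev.bilin B u v‖ ≤ ‖B‖ * ‖u‖ * ‖v‖ := by
  simpa only [Sobolev.wnorm_one] using Sobolev.wnorm_bilin_le zero_le_one B u v

theorem Sobolev.toLp_add (v w : Sobolev D k p X) : (v + w).toLp = v.toLp + w.toLp := rfl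

theorem Sobolev.toLp_smul (c : ℝ) (v : Sobolev D k p X) : (c • v).toLp = c • v.toLp := rfl

theorem Sobolev.bilin_add_left [FiniteDimensional ℝ X] [CompleteSpace Y] [CompleteSpace Z]
    (B : X →L[ℝ] Y →L[ℝ] Z) (u u' : Sobolev D k ∞ X) (v : Sobolev D k p Y) :
    bilin B (u + u') v = bilin B u v + bilin B u' v :=
  ext_toLp (by rw [toLp_add, toLp_bilin, toLp_bilin, toLp_bilin, toLp_add, B.holder_add_left])

theorem Sobolev.bilin_add_right [FiniteDimensional ℝ X] [CompleteSpace Y] [CompleteSpace Z]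
    (B : X →L[ℝ] Y →L[ℝ] Z) (u : Sobolev D k ∞ X) (v v' : Sobolev D k p Y) :
    bilin B u (v + v') = bilin B u v + bilin B u v' :=
  ext_toLp (by rw [toLp_add, toLp_bilin, toLp_bilin, toLp_bilin, toLp_add, B.holder_add_right])

theorem Sobolev.bilin_smul_left [FiniteDimensional ℝ X] [CompleteSpace Y] [CompleteSpace Z]
    (B : X →L[ℝ] Y →L[ℝ] Z) (c : ℝ) (u : Sobolev D k ∞ X) (v : Sobolev D k p Y) :
    bilin B (c • u) v = c • bilin B u v :=
  ext_toLp (by rw [toLp_smul, toLp_bilin, toLp_bilin, toLp_smul, B.holder_smul_left])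

theorem Sobolev.bilin_smul_right [FiniteDimensional ℝ X] [CompleteSpace Y] [CompleteSpace Z]
    (B : X →L[ℝ] Y →L[ℝ] Z) (c : ℝ) (u : Sobolev D k ∞ X) (v : Sobolev D k p Y) :
    bilin B u (c • v) = c • bilin B u v :=
  ext_toLp (by rw [toLp_smul, toLp_bilin, toLp_bilin, toLp_smul, B.holder_smul_right])

/-- The product as a continuous bilinear map. -/
def Sobolev.bilinL [FiniteDimensional ℝ X] [CompleteSpace Y] [CompleteSpace Z]
    (B : X →L[ℝ] Y →L[ℝ] Z) : Sobolev D k ∞ X →L[ℝ] Sobolev D k p Y →L[ℝ] Sobolev D k p Z :=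
  LinearMap.mkContinuous₂
    (LinearMap.mk₂ ℝ (Sobolev.bilin B) (bilin_add_left B) (bilin_smul_left B)
      (bilin_add_right B) (bilin_smul_right B)) ‖B‖ (Sobolev.norm_bilin_le B)

@[simp]
theorem Sobolev.bilinL_apply [FiniteDimensional ℝ X] [CompleteSpace Y] [CompleteSpace Z]
    (B : X →L[ℝ] Y →L[ℝ] Z) (u : Sobolev D k ∞ X) (v : Sobolev D k p Y) :
    Sobolev.bilinL B u v = Sobolev.bilin B u v := rfl

/-- Constant functions, for `p = ∞`. -/
def Sobolev.const [CompleteSpace X] (c : X) : Sobolev D k ∞ X :=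
  Sobolev.ofCoef k (fun α => if α = 0 then (memLp_top_const c).toLp (fun _ => c) else 0) (by
    intro α i _
    have h1 : α + Pi.single i 1 ≠ 0 := by
      intro h
      have := congrFun h i
      simp at this
    rw [if_neg h1, smul_zero]
    have hz : (fun _ => (0 : X)) =ᵐ[vol D] (0 : Lp X ∞ (vol D)) := (Lp.coeFn_zero X ∞ _).symm
    split_ifs
    · exact (isWeakPartial_const c i).congr (MemLp.coeFn_toLp _).symm hz
    · exact (isWeakPartial_zero i).congr hz hz)

theorem Sobolev.toLp_const [CompleteSpace X] (c : X) :
    (Sobolev.const c : Sobolev D k ∞ X).toLp =ᵐ[vol D] fun _ => c := by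
  rw [Sobolev.const, Sobolev.toLp_ofCoef, if_pos rfl]
  exact MemLp.coeFn_toLp _

theorem Sobolev.wnorm_const_le [CompleteSpace X] (ε : ℝ) (c : X) :
    (Sobolev.const c : Sobolev D k ∞ X).wnorm ε ≤ ‖c‖ := by
  have : ∀ α ∈ multiIdx d k, ε ^ (∑ j, α j) * ‖(Sobolev.const c : Sobolev D k ∞ X).coef α‖ =
      if α = 0 then ‖(memLp_top_const c : MemLp (fun _ => c) ∞ (vol D)).toLp (fun _ => c)‖
        else 0 := by
    intro α hα
    rw [Sobolev.const, Sobolev.coef_ofCoef _ (mem_multiIdx.mp hα)]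
    split_ifs with h
    · subst h; simp
    · simp
  rw [Sobolev.wnorm, Finset.sum_congr rfl this, Finset.sum_ite_eq' ,
    if_pos (zero_mem_multiIdx d k), Lp.norm_toLp]
  refine ENNReal.toReal_le_of_le_ofReal (norm_nonneg _) ?_
  rw [eLpNorm_exponent_top]
  exact eLpNormEssSup_le_of_ae_bound (Eventually.of_forall fun _ => le_rfl)

end Operations

/-! ### Factorial bounds for iterated derivatives -/

section DerivBounds

open Filter Topology
open scoped Nat

variable {E F G H : Type*} [NormedAddCommGroup E] [NormedSpace ℝ E] [NormedAddCommGroup F]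
  [NormedSpace ℝ F] [NormedAddCommGroup G] [NormedSpace ℝ G] [NormedAddCommGroup H]
  [NormedSpace ℝ H]

/-- All derivatives of `f` at `x` satisfy `‖D^n f(x)‖ ≤ n! C ρ^n`. -/
def DerivBound (f : E → F) (x : E) (C ρ : ℝ) : Prop :=
  ∀ n : ℕ, ‖iteratedFDeriv ℝ n f x‖ ≤ n ! * C * ρ ^ n

theorem norm_iteratedFDeriv_bilin_le (B : F →L[ℝ] G →L[ℝ] H) {f : E → F} {g : E → G} {s : Set E}
    (hs : IsOpen s) {x : E} (hx : x ∈ s) (hf : ContDiffOn ℝ (⊤ : ℕ∞) f s)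
    (hg : ContDiffOn ℝ (⊤ : ℕ∞) g s) (n : ℕ) :
    ‖iteratedFDeriv ℝ n (fun y => B (f y) (g y)) x‖ ≤ ‖B‖ * ∑ i ∈ Finset.range (n + 1),
      (n.choose i : ℝ) * ‖iteratedFDeriv ℝ i f x‖ * ‖iteratedFDeriv ℝ (n - i) g x‖ := by
  have := B.norm_iteratedFDerivWithin_le_of_bilinear hf hg hs.uniqueDiffOn hx (n := n)
    (by exact_mod_cast le_top)
  simpa only [iteratedFDerivWithin_of_isOpen _ hs hx] using this

theorem choose_mul_factorials {n i : ℕ} (h : i ≤ n) :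
    (n.choose i : ℝ) * i ! * (n - i)! = n ! := by
  exact_mod_cast Nat.choose_mul_factorial_mul_factorial h

theorem sum_pow_half_le (n : ℕ) : ∑ i ∈ Finset.range (n + 1), (1 / 2 : ℝ) ^ (n - i) ≤ 2 := by
  have := Finset.sum_range_reflect (fun j => (1 / 2 : ℝ) ^ j) (n + 1)
  simp only [Nat.add_sub_cancel] at this
  rw [this]
  exact sum_geometric_two_le _

/-- The binomial coefficient cancels the factorials. Halving the rate of one factor turns the
remaining sum of `n + 1` terms into a geometric one, so that a product loses only a factor two,
uniformly in `n`. -/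
theorem sum_choose_bound {a b : ℕ → ℝ} {C C' τ : ℝ} (hC' : 0 ≤ C')
    (hτ : 0 ≤ τ) (n : ℕ) (ha : ∀ i ≤ n, a i ≤ i ! * C * τ ^ i)
    (hb : ∀ i ≤ n, b i ≤ i ! * C' * (τ / 2) ^ i) (ha0 : ∀ i, 0 ≤ a i) (hb0 : ∀ i, 0 ≤ b i) :
    ∑ i ∈ Finset.range (n + 1), (n.choose i : ℝ) * a i * b (n - i) ≤
      n ! * (2 * C * C') * τ ^ n := by
  have hC : 0 ≤ C := by simpa using (ha0 0).trans (ha 0 (Nat.zero_le _))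
  calc ∑ i ∈ Finset.range (n + 1), (n.choose i : ℝ) * a i * b (n - i)
      ≤ ∑ i ∈ Finset.range (n + 1), (n ! * (C * C') * τ ^ n) * (1 / 2) ^ (n - i) := by
        refine Finset.sum_le_sum fun i hi => ?_
        have hin : i ≤ n := Nat.lt_succ_iff.mp (Finset.mem_range.mp hi)
        calc (n.choose i : ℝ) * a i * b (n - i)
            ≤ (n.choose i : ℝ) * (i ! * C * τ ^ i) * ((n - i)! * C' * (τ / 2) ^ (n - i)) := by
              have := ha i hin
              have := hb (n - i) (Nat.sub_le _ _)
              have := ha0 i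
              have := hb0 (n - i)
              gcongr
          _ = ((n.choose i : ℝ) * i ! * (n - i)!) * (C * C') * (τ ^ i * τ ^ (n - i)) *
                (1 / 2) ^ (n - i) := by
              rw [div_eq_mul_one_div τ 2, mul_pow]; ring
          _ = _ := by
              rw [choose_mul_factorials hin, ← pow_add, Nat.add_sub_cancel' hin]
    _ = (n ! * (C * C') * τ ^ n) * ∑ i ∈ Finset.range (n + 1), (1 / 2 : ℝ) ^ (n - i) := by
        rw [Finset.mul_sum]
    _ ≤ (n ! * (C * C') * τ ^ n) * 2 :=
        mul_le_mul_of_nonneg_left (sum_pow_half_le n) (by positivity)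
    _ = _ := by ring

theorem DerivBound.nonneg {f : E → F} {x : E} {C ρ : ℝ} (h : DerivBound f x C ρ) : 0 ≤ C := by
  have := (norm_nonneg _).trans (h 0)
  simpa using this

theorem DerivBound.mono {f : E → F} {x : E} {C C' ρ ρ' : ℝ} (h : DerivBound f x C ρ)
    (hC : C ≤ C') (h0 : 0 ≤ ρ) (hρ : ρ ≤ ρ') : DerivBound f x C' ρ' := fun n => by
  have h1 := h.nonneg
  have h2 := h1.trans hC
  refine (h n).trans ?_
  gcongr

theorem DerivBound.bilin (B : F →L[ℝ] G →L[ℝ] H) {f : E → F} {g : E → G} {s : Set E}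
    (hs : IsOpen s) {x : E} (hx : x ∈ s) (hf : ContDiffOn ℝ (⊤ : ℕ∞) f s)
    (hg : ContDiffOn ℝ (⊤ : ℕ∞) g s) {C C' τ : ℝ} (hτ : 0 ≤ τ) (hB : ‖B‖ ≤ 1)
    (h : DerivBound f x C τ) (h' : DerivBound g x C' (τ / 2)) :
    DerivBound (fun y => B (f y) (g y)) x (2 * C * C') τ := fun n => by
  refine (norm_iteratedFDeriv_bilin_le B hs hx hf hg n).trans ?_
  refine (mul_le_of_le_one_left (by positivity) hB).trans ?_
  exact sum_choose_bound h'.nonneg hτ n (fun i _ => h i) (fun i _ => h' i)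
    (fun i => norm_nonneg _) (fun i => norm_nonneg _)

theorem DerivBound.clm (ℓ : F →L[ℝ] G) {f : E → F} {s : Set E} (hs : IsOpen s) {x : E}
    (hx : x ∈ s) (hf : ContDiffOn ℝ (⊤ : ℕ∞) f s) {C ρ N : ℝ} (h : DerivBound f x C ρ)
    (hN : ‖ℓ‖ ≤ N) : DerivBound (fun y => ℓ (f y)) x (N * C) ρ := fun n => by
  have hc : ContDiffAt ℝ n f x :=
    ((hf.contDiffAt (hs.mem_nhds hx)).of_le (by exact_mod_cast le_top))
  have := ℓ.norm_iteratedFDeriv_comp_left hc (le_refl (n : WithTop ℕ∞))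
  refine this.trans ?_
  have h1 := h n
  have h0 := (norm_nonneg _).trans hN
  calc ‖ℓ‖ * ‖iteratedFDeriv ℝ n f x‖ ≤ N * (n ! * C * ρ ^ n) := by gcongr
    _ = _ := by ring

theorem DerivBound.add {f g : E → F} {s : Set E} (hs : IsOpen s) {x : E}
    (hx : x ∈ s) (hf : ContDiffOn ℝ (⊤ : ℕ∞) f s) (hg : ContDiffOn ℝ (⊤ : ℕ∞) g s) {C C' ρ : ℝ}
    (h : DerivBound f x C ρ) (h' : DerivBound g x C' ρ) :
    DerivBound (fun y => f y + g y) x (C + C') ρ := fun n => by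
  have hc : ContDiffAt ℝ n f x :=
    ((hf.contDiffAt (hs.mem_nhds hx)).of_le (by exact_mod_cast le_top))
  have hc' : ContDiffAt ℝ n g x :=
    ((hg.contDiffAt (hs.mem_nhds hx)).of_le (by exact_mod_cast le_top))
  rw [fun_iteratedFDeriv_add_apply hc hc']
  refine (norm_add_le _ _).trans ((add_le_add (h n) (h' n)).trans (le_of_eq (by ring)))

/-- Derivative bounds for the solution `g` of `g = g₀ - g Δ g₀`. -/
theorem DerivBound.of_perturbation (P : F →L[ℝ] G →L[ℝ] F) {g : E → F} {Δ : E → G} {s : Set E}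
    (hs : IsOpen s) {x : E} (hx : x ∈ s) (hg : ContDiffOn ℝ (⊤ : ℕ∞) g s)
    (hΔ : ContDiffOn ℝ (⊤ : ℕ∞) Δ s) {g₀ β ρ : ℝ} (hβ : 0 ≤ β) (hρ : 0 ≤ ρ)
    (hP : ‖P‖ ≤ g₀) (hgx : ‖g x‖ ≤ g₀) (hΔx : Δ x = 0)
    (hΔn : ∀ n : ℕ, 1 ≤ n → ‖iteratedFDeriv ℝ n Δ x‖ ≤ n ! * β * ρ ^ n)
    (heq : ∀ y ∈ s, g y = g x - P (g y) (Δ y)) :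
    DerivBound g x g₀ ((1 + g₀ * β) * ρ) := by
  have hg0 : 0 ≤ g₀ := (norm_nonneg _).trans hgx
  intro n
  induction n using Nat.strong_induction_on with
  | _ n ih =>
  rcases Nat.eq_zero_or_pos n with rfl | hn
  · simpa using hgx
  have hPg : ContDiffOn ℝ (⊤ : ℕ∞) (fun y => P (g y) (Δ y)) s :=
    (P.contDiff.comp_contDiffOn hg).clm_apply hΔ
  have hPn : ContDiffAt ℝ n (fun y => P (g y) (Δ y)) x :=
    (hPg.contDiffAt (hs.mem_nhds hx)).of_le (by exact_mod_cast le_top)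
  have h1 : iteratedFDeriv ℝ n g x = -iteratedFDeriv ℝ n (fun y => P (g y) (Δ y)) x := by
    have he : g =ᶠ[𝓝 x] fun y => g x - P (g y) (Δ y) :=
      Filter.eventually_of_mem (hs.mem_nhds hx) heq
    rw [(he.iteratedFDeriv ℝ n).eq_of_nhds, fun_iteratedFDeriv_sub_apply contDiffAt_const hPn,
      iteratedFDeriv_const_of_ne (Nat.pos_iff_ne_zero.mp hn)]
    simp
  rw [h1, norm_neg]
  refine (norm_iteratedFDeriv_bilin_le P hs hx hg hΔ n).trans ?_
  -- The term with all derivatives on `g` carries the factor `Δ x = 0`; only derivatives of `g` of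
  -- order below `n` remain.
  rw [Finset.sum_range_succ, Nat.sub_self, norm_iteratedFDeriv_zero, hΔx, norm_zero, mul_zero,
    add_zero]
  set q := g₀ * β with hq
  have hq0 : 0 ≤ q := mul_nonneg hg0 hβ
  have h2 : ∑ i ∈ Finset.range n, (n.choose i : ℝ) * ‖iteratedFDeriv ℝ i g x‖ *
      ‖iteratedFDeriv ℝ (n - i) Δ x‖ ≤
      (n ! * g₀ * β * ρ ^ n) * ∑ i ∈ Finset.range n, (1 + q) ^ i := by
    rw [Finset.mul_sum]
    refine Finset.sum_le_sum fun i hi => ?_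
    have hin := Finset.mem_range.mp hi
    calc (n.choose i : ℝ) * ‖iteratedFDeriv ℝ i g x‖ * ‖iteratedFDeriv ℝ (n - i) Δ x‖
        ≤ (n.choose i : ℝ) * (i ! * g₀ * ((1 + q) * ρ) ^ i) * ((n - i)! * β * ρ ^ (n - i)) := by
          have := ih i hin
          have := hΔn (n - i) (by omega)
          gcongr
      _ = ((n.choose i : ℝ) * i ! * (n - i)!) * g₀ * β * (ρ ^ i * ρ ^ (n - i)) * (1 + q) ^ i := by
          rw [mul_pow]; ring
      _ = _ := by
          rw [choose_mul_factorials hin.le, ← pow_add, Nat.add_sub_cancel' hin.le]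
  -- The rate `(1 + q) ρ` is chosen so that this geometric sum reproduces the claimed bound at order
  -- `n`.
  have h3 : q * ∑ i ∈ Finset.range n, (1 + q) ^ i = (1 + q) ^ n - 1 := by
    have := mul_geom_sum (1 + q) n
    simpa using this
  calc ‖P‖ * ∑ i ∈ Finset.range n, (n.choose i : ℝ) * ‖iteratedFDeriv ℝ i g x‖ *
        ‖iteratedFDeriv ℝ (n - i) Δ x‖
      ≤ g₀ * ((n ! * g₀ * β * ρ ^ n) * ∑ i ∈ Finset.range n, (1 + q) ^ i) := by
        gcongr
    _ = n ! * g₀ * ρ ^ n * (q * ∑ i ∈ Finset.range n, (1 + q) ^ i) := by rw [hq]; ring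
    _ = n ! * g₀ * ρ ^ n * ((1 + q) ^ n - 1) := by rw [h3]
    _ ≤ n ! * g₀ * ρ ^ n * (1 + q) ^ n := by
        gcongr
        linarith
    _ = _ := by rw [mul_pow]; ring

/-- Derivative bounds for the solution `r` of the linear differential equation `Dr = P(r, w)`. -/
theorem DerivBound.of_linear_ode (P : F →L[ℝ] G →L[ℝ] (E →L[ℝ] F)) {r : E → F} {w : E → G}
    {s : Set E} (hs : IsOpen s) {x : E} (hx : x ∈ s) (hr : ContDiffOn ℝ (⊤ : ℕ∞) r s)
    (hw : ContDiffOn ℝ (⊤ : ℕ∞) w s) {r₀ W τ P₀ : ℝ} (hτ : 0 ≤ τ) (hP : ‖P‖ ≤ P₀)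
    (hrx : ‖r x‖ ≤ r₀) (hW : DerivBound w x W (τ / 2)) (hPW : 2 * P₀ * W ≤ τ)
    (heq : ∀ y ∈ s, fderiv ℝ r y = P (r y) (w y)) : DerivBound r x r₀ τ := by
  have hr0 : 0 ≤ r₀ := (norm_nonneg _).trans hrx
  intro n
  induction n using Nat.strong_induction_on with
  | _ n ih =>
  rcases n with _ | n
  · simpa using hrx
  have he : fderiv ℝ r =ᶠ[𝓝 x] fun y => P (r y) (w y) :=
    Filter.eventually_of_mem (hs.mem_nhds hx) heq
  -- The derivative of order `n + 1` is the `n`-th derivative of the right-hand side, which involves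
  -- only `D^i r` with `i ≤ n`. The extra factor in `(n + 1)!` is not needed and is given away at
  -- the end.
  rw [← norm_iteratedFDeriv_fderiv, (he.iteratedFDeriv ℝ n).eq_of_nhds]
  refine (norm_iteratedFDeriv_bilin_le P hs hx hr hw n).trans ?_
  have h1 := sum_choose_bound hW.nonneg hτ n (fun i hi => ih i (by omega)) (fun i _ => hW i)
    (fun i => norm_nonneg _) (fun i => norm_nonneg _)
  have hP0 : 0 ≤ P₀ := (norm_nonneg _).trans hP
  have hW0 := hW.nonneg
  calc _ ≤ P₀ * (n ! * (2 * r₀ * W) * τ ^ n) := by gcongr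
    _ = n ! * r₀ * τ ^ n * (2 * P₀ * W) := by ring
    _ ≤ n ! * r₀ * τ ^ n * τ := by gcongr
    _ = n ! * r₀ * τ ^ (n + 1) := by ring
    _ ≤ (n + 1)! * r₀ * τ ^ (n + 1) := by
        gcongr
        omega

end DerivBounds

/-! ### The inverse square root in a commutative Banach algebra -/

section InvSqrt

open Filter Topology

/-- The Taylor coefficients of `(1 - x)^{-1/2}`. -/
def invSqrtCoeff (n : ℕ) : ℝ := (n.centralBinom : ℝ) / 4 ^ n

theorem invSqrtCoeff_nonneg (n : ℕ) : 0 ≤ invSqrtCoeff n := by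
  unfold invSqrtCoeff; positivity

theorem invSqrtCoeff_succ (n : ℕ) :
    ((n : ℝ) + 1) * invSqrtCoeff (n + 1) = (n + 1 / 2) * invSqrtCoeff n := by
  have h := Nat.succ_mul_centralBinom_succ n
  have h' : ((n : ℝ) + 1) * ((n + 1).centralBinom : ℝ) = 2 * (2 * n + 1) * n.centralBinom := by
    exact_mod_cast h
  unfold invSqrtCoeff
  rw [pow_succ, mul_div_assoc', h']
  field_simp
  ring

theorem invSqrtCoeff_le_one (n : ℕ) : invSqrtCoeff n ≤ 1 := by
  induction n with
  | zero => simp [invSqrtCoeff]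
  | succ n ih =>
    have h := invSqrtCoeff_succ n
    have h0 := invSqrtCoeff_nonneg n
    have hn : (0 : ℝ) < n + 1 := by positivity
    have : ((n : ℝ) + 1) * invSqrtCoeff (n + 1) ≤ (n + 1) * 1 := by
      rw [h]; nlinarith
    exact le_of_mul_le_mul_left this hn

/-- The square of the generating function is the geometric series. The recursion for the
coefficients says `2 (1 - X) b' = b`, so `b² (1 - X)` has derivative zero, and its constant term is
one. -/
theorem sum_invSqrtCoeff_mul (n : ℕ) :
    ∑ q ∈ Finset.HasAntidiagonal.antidiagonal n, invSqrtCoeff q.1 * invSqrtCoeff q.2 = 1 := by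
  let b : PowerSeries ℝ := PowerSeries.mk invSqrtCoeff
  let δ := PowerSeries.derivative ℝ
  have hb : 2 * ((1 - PowerSeries.X) * δ b) = b := by
    ext m
    rw [two_mul, map_add, sub_mul, one_mul, map_sub]
    rcases m with _ | m
    · have := invSqrtCoeff_succ 0
      simp [δ, b, PowerSeries.coeff_derivative] at this ⊢
      linarith
    · have := invSqrtCoeff_succ (m + 1)
      rw [PowerSeries.coeff_succ_X_mul]
      simp [δ, b, PowerSeries.coeff_derivative] at this ⊢
      linarith
  have hb2 : b * b * (1 - PowerSeries.X) = 1 := by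
    apply PowerSeries.derivative.ext (R := ℝ)
    · have h1 : δ (b * b * (1 - PowerSeries.X)) = b * (2 * ((1 - PowerSeries.X) * δ b)) - b * b := by
        simp [δ, Derivation.leibniz]
        ring
      change δ _ = δ 1
      rw [h1, hb, sub_self]
      simp [δ]
    · simp [b, invSqrtCoeff]
  have hgeo : b * b = PowerSeries.mk fun _ => (1 : ℝ) := by
    have h1 : (PowerSeries.mk fun _ => (1 : ℝ)) * (1 - PowerSeries.X) = 1 :=
      PowerSeries.mk_one_mul_one_sub_eq_one ℝ
    calc b * b = b * b * ((PowerSeries.mk fun _ => (1 : ℝ)) * (1 - PowerSeries.X)) := by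
          rw [h1, mul_one]
      _ = b * b * (1 - PowerSeries.X) * (PowerSeries.mk fun _ => (1 : ℝ)) := by ring
      _ = _ := by rw [hb2, one_mul]
  have := congrArg (PowerSeries.coeff n) hgeo
  rw [PowerSeries.coeff_mul] at this
  simpa [b] using this

variable {A : Type*} [NormedCommRing A] [NormedAlgebra ℝ A] [CompleteSpace A]

/-- `∑ b_n x^n`, where `b_n` are the Taylor coefficients of `(1 - x)^{-1/2}`. -/
def invSqrtSeries (x : A) : A := ∑' n, invSqrtCoeff n • x ^ n

/-- Only `‖1‖ ≤ 1` is assumed: for empty `D` the function algebra is trivial and `‖1‖ = 0`. -/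
theorem norm_pow_le_of_one (h1 : ‖(1 : A)‖ ≤ 1) (x : A) (n : ℕ) : ‖x ^ n‖ ≤ ‖x‖ ^ n := by
  rcases n with _ | n
  · simpa using h1
  · exact norm_pow_le' x (Nat.succ_pos n)

theorem norm_invSqrt_term_le (h1 : ‖(1 : A)‖ ≤ 1) (x : A) (n : ℕ) :
    ‖invSqrtCoeff n • x ^ n‖ ≤ ‖x‖ ^ n := by
  rw [norm_smul, Real.norm_of_nonneg (invSqrtCoeff_nonneg n)]
  exact (mul_le_of_le_one_left (norm_nonneg _) (invSqrtCoeff_le_one n)).trans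
    (norm_pow_le_of_one h1 x n)

theorem summable_invSqrt (h1 : ‖(1 : A)‖ ≤ 1) {x : A} (hx : ‖x‖ < 1) :
    Summable fun n => ‖invSqrtCoeff n • x ^ n‖ :=
  Summable.of_nonneg_of_le (fun _ => norm_nonneg _) (norm_invSqrt_term_le h1 x)
    (summable_geometric_of_lt_one (norm_nonneg _) hx)

theorem hasSum_invSqrtSeries (h1 : ‖(1 : A)‖ ≤ 1) {x : A} (hx : ‖x‖ < 1) :
    HasSum (fun n => invSqrtCoeff n • x ^ n) (invSqrtSeries x) :=
  (summable_invSqrt h1 hx).of_norm.hasSum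

theorem norm_invSqrtSeries_le (h1 : ‖(1 : A)‖ ≤ 1) {x : A} (hx : ‖x‖ < 1) :
    ‖invSqrtSeries x‖ ≤ (1 - ‖x‖)⁻¹ :=
  tsum_of_norm_bounded (hasSum_geometric_of_lt_one (norm_nonneg _) hx) (norm_invSqrt_term_le h1 x)

theorem invSqrtSeries_mul_self (h1 : ‖(1 : A)‖ ≤ 1) {x : A} (hx : ‖x‖ < 1) :
    invSqrtSeries x * invSqrtSeries x = ∑' n, x ^ n := by
  unfold invSqrtSeries
  rw [tsum_mul_tsum_eq_tsum_sum_antidiagonal_of_summable_norm (summable_invSqrt h1 hx)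
    (summable_invSqrt h1 hx)]
  refine tsum_congr fun n => ?_
  have : ∀ q ∈ Finset.HasAntidiagonal.antidiagonal n, invSqrtCoeff q.1 • x ^ q.1 * invSqrtCoeff q.2 • x ^ q.2 =
      (invSqrtCoeff q.1 * invSqrtCoeff q.2) • x ^ n := by
    intro q hq
    rw [smul_mul_smul_comm, ← pow_add, Finset.HasAntidiagonal.mem_antidiagonal.mp hq]
  rw [Finset.sum_congr rfl this, ← Finset.sum_smul, sum_invSqrtCoeff_mul, one_smul]

/-- The square is a geometric series and so obeys the same bound as the series itself, where
submultiplicativity would only give the square of that bound. -/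
theorem norm_invSqrtSeries_mul_self_le (h1 : ‖(1 : A)‖ ≤ 1) {x : A} (hx : ‖x‖ < 1) :
    ‖invSqrtSeries x * invSqrtSeries x‖ ≤ (1 - ‖x‖)⁻¹ := by
  rw [invSqrtSeries_mul_self h1 hx]
  exact tsum_of_norm_bounded (hasSum_geometric_of_lt_one (norm_nonneg _) hx)
    (norm_pow_le_of_one h1 x)

theorem invSqrtSeries_mul_self_mul (h1 : ‖(1 : A)‖ ≤ 1) {x : A} (hx : ‖x‖ < 1) :
    invSqrtSeries x * invSqrtSeries x * (1 - x) = 1 := by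
  rw [invSqrtSeries_mul_self h1 hx]
  exact geom_series_mul_neg x hx

/-- Coefficients bounded by one give a radius of convergence of at least one, hence analyticity on
the open unit ball. -/
theorem contDiffOn_invSqrtSeries (h1 : ‖(1 : A)‖ ≤ 1) :
    ContDiffOn ℝ (⊤ : ℕ∞) (invSqrtSeries : A → A) (Metric.ball 0 1) := by
  have hrad : 1 ≤ (FormalMultilinearSeries.ofScalars A invSqrtCoeff).radius := by
    have := (FormalMultilinearSeries.ofScalars A invSqrtCoeff).le_radius_of_bound 1 (r := 1)
      (fun n => by
        rw [NNReal.coe_one, one_pow, mul_one]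
        rcases n with _ | n
        · rw [FormalMultilinearSeries.ofScalars_norm_eq_mul,
            ContinuousMultilinearMap.norm_mkPiAlgebraFin_zero]
          simpa [invSqrtCoeff] using h1
        · refine (FormalMultilinearSeries.ofScalars_norm_le A invSqrtCoeff _ n.succ_pos).trans ?_
          rw [Real.norm_of_nonneg (invSqrtCoeff_nonneg _)]
          exact invSqrtCoeff_le_one _)
    simpa using this
  have hps := (FormalMultilinearSeries.ofScalars A invSqrtCoeff).hasFPowerSeriesOnBall
    (lt_of_lt_of_le one_pos hrad)
  have heq : (FormalMultilinearSeries.ofScalars A invSqrtCoeff).sum = invSqrtSeries :=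
    FormalMultilinearSeries.ofScalarsSum_eq_tsum invSqrtCoeff
  rw [heq] at hps
  have han : AnalyticOnNhd ℝ (invSqrtSeries : A → A) (Metric.ball 0 1) := by
    refine hps.analyticOnNhd.mono fun x hx => ?_
    rw [mem_ball_zero_iff] at hx
    refine Metric.mem_eball.mpr (lt_of_lt_of_le ?_ hrad)
    rw [edist_zero_right]
    rw [← ofReal_norm, ← ENNReal.ofReal_one]
    exact (ENNReal.ofReal_lt_ofReal_iff one_pos).mpr hx
  exact han.contDiffOn Metric.isOpen_ball.uniqueDiffOn

end InvSqrt

/-! ### The space `W^{k,∞}` with a weighted norm -/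

section Weighted

open Filter Topology

variable {d k : ℕ} {D : Opens (Vec d)} {ε : Ioi (0 : ℝ)}
variable {X Y Z : Type*} [NormedAddCommGroup X] [NormedSpace ℝ X] [NormedAddCommGroup Y]
  [NormedSpace ℝ Y] [NormedAddCommGroup Z] [NormedSpace ℝ Z]

/-- The space `W^{k,∞}(D; X)` with the norm `∑_{|α| ≤ k} (ε^|α| / α!) ‖∂^α v‖_{L^∞}`. -/
def WSob (_ε : Ioi (0 : ℝ)) (D : Opens (Vec d)) (k : ℕ) (X : Type*) [NormedAddCommGroup X]
    [NormedSpace ℝ X] : Type _ := Sobolev D k ∞ X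

instance : AddCommGroup (WSob ε D k X) := inferInstanceAs (AddCommGroup (Sobolev D k ∞ X))

instance : Module ℝ (WSob ε D k X) := inferInstanceAs (Module ℝ (Sobolev D k ∞ X))

/-- The weighted norm as a group norm. -/
def wsobNorm (ε : Ioi (0 : ℝ)) (D : Opens (Vec d)) (k : ℕ) (X : Type*) [NormedAddCommGroup X]
    [NormedSpace ℝ X] : AddGroupNorm (WSob ε D k X) where
  toFun v := Sobolev.wnorm ε (v : Sobolev D k ∞ X)
  map_zero' := by
    refine Finset.sum_eq_zero fun α _ => ?_
    have : (0 : Sobolev D k ∞ X).coef α = 0 := map_zero (Sobolev.coefL α)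
    change _ * ‖(0 : Sobolev D k ∞ X).coef α‖ = 0
    rw [this, norm_zero, mul_zero]
  add_le' v w := by
    unfold Sobolev.wnorm
    rw [← Finset.sum_add_distrib]
    refine Finset.sum_le_sum fun α _ => ?_
    rw [← mul_add]
    refine mul_le_mul_of_nonneg_left ?_ (pow_nonneg ε.2.le _)
    have := Sobolev.coef_add (v : Sobolev D k ∞ X) w α
    exact (congrArg norm this).le.trans (norm_add_le _ _)
  neg' v := by
    refine Finset.sum_congr rfl fun α _ => ?_
    have : (-v : Sobolev D k ∞ X).coef α = -Sobolev.coef v α := map_neg (Sobolev.coefL α) v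
    exact congrArg (fun t => _ * t) ((congrArg norm this).trans (norm_neg _))
  eq_zero_of_map_eq_zero' v hv := by
    unfold Sobolev.wnorm at hv
    rw [Finset.sum_eq_zero_iff_of_nonneg
      fun α _ => mul_nonneg (pow_nonneg ε.2.le _) (norm_nonneg _)] at hv
    refine (@norm_eq_zero (Sobolev D k ∞ X) _ v).mp ?_
    refine (Sobolev.norm_eq_sum_coef (p := ∞) v).trans (Finset.sum_eq_zero fun α hα => ?_)
    exact (mul_eq_zero.mp (hv α hα)).resolve_left (pow_pos ε.2 _).ne'

instance : NormedAddCommGroup (WSob ε D k X) := (wsobNorm ε D k X).toNormedAddCommGroup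

/-- The identity `W^{k,∞}(D; X) → W^{k,∞}(D; X)` onto the space with the weighted norm. -/
def WSob.of (ε : Ioi (0 : ℝ)) : Sobolev D k ∞ X ≃ₗ[ℝ] WSob ε D k X := LinearEquiv.refl ℝ _

theorem WSob.norm_of (v : Sobolev D k ∞ X) : ‖WSob.of ε v‖ = v.wnorm ε := rfl

theorem WSob.norm_eq (v : WSob ε D k X) : ‖v‖ = ((WSob.of ε).symm v).wnorm ε := rfl

instance : NormedSpace ℝ (WSob ε D k X) where
  norm_smul_le c v := by
    rw [WSob.norm_eq, WSob.norm_eq, map_smul]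
    unfold Sobolev.wnorm
    rw [Finset.mul_sum]
    refine Finset.sum_le_sum fun α _ => le_of_eq ?_
    rw [Sobolev.coef_smul, norm_smul, mul_left_comm]

/-- The identity into the space with the weighted norm, for `ε ≤ 1`. -/
def WSob.ofL (hε : (ε : ℝ) ≤ 1) : Sobolev D k ∞ X ≃L[ℝ] WSob ε D k X :=
  (WSob.of ε).toContinuousLinearEquivOfBounds 1 ((ε : ℝ)⁻¹ ^ k)
    (fun v => by rw [one_mul, WSob.norm_of]; exact v.wnorm_le_norm ε.2.le hε)
    (fun v => by rw [WSob.norm_eq]; exact Sobolev.norm_le_wnorm ε.2 hε _)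

theorem WSob.norm_ofL_le (hε : (ε : ℝ) ≤ 1) :
    ‖(WSob.ofL (D := D) (k := k) (X := X) hε).toContinuousLinearMap‖ ≤ 1 :=
  ContinuousLinearMap.opNorm_le_bound _ zero_le_one fun v => by
    rw [one_mul]; exact v.wnorm_le_norm ε.2.le hε

theorem WSob.norm_ofL_symm_le (hε : (ε : ℝ) ≤ 1) :
    ‖(WSob.ofL (D := D) (k := k) (X := X) hε).symm.toContinuousLinearMap‖ ≤ (ε : ℝ)⁻¹ ^ k :=
  ContinuousLinearMap.opNorm_le_bound _ (pow_nonneg (inv_nonneg.mpr ε.2.le) _) fun _ =>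
    Sobolev.norm_le_wnorm ε.2 hε _

theorem WSob.completeSpace [CompleteSpace X] (hε : (ε : ℝ) ≤ 1) :
    CompleteSpace (WSob ε D k X) :=
  (completeSpace_congr (e := (WSob.ofL hε).toEquiv) (WSob.ofL hε).isUniformEmbedding).mp
    inferInstance

/-- The underlying function. -/
def WSob.toLp (v : WSob ε D k X) : Lp X ∞ (vol D) := ((WSob.of ε).symm v).toLp

theorem WSob.toLp_add (v w : WSob ε D k X) : (v + w).toLp = v.toLp + w.toLp := rfl

theorem WSob.toLp_smul (c : ℝ) (v : WSob ε D k X) : (c • v).toLp = c • v.toLp := rfl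

theorem WSob.toLp_of (v : Sobolev D k ∞ X) : (WSob.of ε v).toLp = v.toLp := rfl

theorem WSob.ext [CompleteSpace X] {v w : WSob ε D k X} (h : v.toLp =ᵐ[vol D] w.toLp) : v = w :=
  (WSob.of ε).symm.injective (Sobolev.ext_toLp (Lp.ext h))

/-- The product with respect to a continuous bilinear map. -/
def WSob.bilinL [FiniteDimensional ℝ X] [CompleteSpace Y] [CompleteSpace Z]
    (B : X →L[ℝ] Y →L[ℝ] Z) : WSob ε D k X →L[ℝ] WSob ε D k Y →L[ℝ] WSob ε D k Z :=
  LinearMap.mkContinuous₂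
    (LinearMap.mk₂ ℝ (fun u v => WSob.of ε (Sobolev.bilin B ((WSob.of ε).symm u)
        ((WSob.of ε).symm v)))
      (fun u u' v => by rw [map_add, Sobolev.bilin_add_left, map_add])
      (fun c u v => by rw [map_smul, Sobolev.bilin_smul_left, map_smul])
      (fun u v v' => by rw [map_add, Sobolev.bilin_add_right, map_add])
      (fun c u v => by rw [map_smul, Sobolev.bilin_smul_right, map_smul])) ‖B‖
    (fun u v => Sobolev.wnorm_bilin_le ε.2.le B _ _)

theorem WSob.norm_bilinL_le [FiniteDimensional ℝ X] [CompleteSpace Y] [CompleteSpace Z]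
    (B : X →L[ℝ] Y →L[ℝ] Z) :
    ‖(WSob.bilinL B : WSob ε D k X →L[ℝ] WSob ε D k Y →L[ℝ] WSob ε D k Z)‖ ≤ ‖B‖ :=
  LinearMap.mkContinuous₂_norm_le _ (norm_nonneg _) _

theorem WSob.toLp_bilinL [FiniteDimensional ℝ X] [CompleteSpace Y] [CompleteSpace Z]
    (B : X →L[ℝ] Y →L[ℝ] Z) (u : WSob ε D k X) (v : WSob ε D k Y) :
    (WSob.bilinL B u v).toLp =ᵐ[vol D] fun x => B (u.toLp x) (v.toLp x) :=
  Sobolev.toLp_bilin_ae B _ _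

/-! ### The weighted space of scalar functions as a commutative normed algebra -/

instance : Mul (WSob ε D k ℝ) := ⟨fun u v => WSob.bilinL (ContinuousLinearMap.mul ℝ ℝ) u v⟩

instance : One (WSob ε D k ℝ) := ⟨WSob.of ε (Sobolev.const 1)⟩

theorem WSob.toLp_mul (u v : WSob ε D k ℝ) :
    (u * v).toLp =ᵐ[vol D] fun x => u.toLp x * v.toLp x :=
  WSob.toLp_bilinL (ContinuousLinearMap.mul ℝ ℝ) u v

theorem WSob.toLp_one : (1 : WSob ε D k ℝ).toLp =ᵐ[vol D] fun _ => (1 : ℝ) :=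
  Sobolev.toLp_const 1

theorem WSob.norm_one_le : ‖(1 : WSob ε D k ℝ)‖ ≤ 1 := by
  have := Sobolev.wnorm_const_le (D := D) (k := k) (ε : ℝ) (1 : ℝ)
  rwa [norm_one] at this

/-- An element is determined by its underlying function, so associativity, commutativity and the
unit laws can be checked almost everywhere. Submultiplicativity is the weighted product estimate. -/
instance : NormedCommRing (WSob ε D k ℝ) :=
  { (inferInstance : NormedAddCommGroup (WSob ε D k ℝ)) with
    mul := (· * ·)
    one := 1
    left_distrib := fun u v w => map_add (WSob.bilinL (ContinuousLinearMap.mul ℝ ℝ) u) v w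
    right_distrib := fun u v w => by
      change WSob.bilinL (ContinuousLinearMap.mul ℝ ℝ) (u + v) w = _
      rw [map_add]; rfl
    zero_mul := fun u => by
      change WSob.bilinL (ContinuousLinearMap.mul ℝ ℝ) 0 u = _
      rw [map_zero]; rfl
    mul_zero := fun u => map_zero (WSob.bilinL (ContinuousLinearMap.mul ℝ ℝ) u)
    mul_assoc := fun u v w => WSob.ext (by
      filter_upwards [WSob.toLp_mul (u * v) w, WSob.toLp_mul u v, WSob.toLp_mul u (v * w),
        WSob.toLp_mul v w] with x h1 h2 h3 h4
      rw [h1, h2, h3, h4, mul_assoc])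
    one_mul := fun u => WSob.ext (by
      filter_upwards [WSob.toLp_mul 1 u, WSob.toLp_one (ε := ε) (D := D) (k := k)] with x h1 h2
      rw [h1, h2, one_mul])
    mul_one := fun u => WSob.ext (by
      filter_upwards [WSob.toLp_mul u 1, WSob.toLp_one (ε := ε) (D := D) (k := k)] with x h1 h2
      rw [h1, h2, mul_one])
    mul_comm := fun u v => WSob.ext (by
      filter_upwards [WSob.toLp_mul u v, WSob.toLp_mul v u] with x h1 h2
      rw [h1, h2, mul_comm])
    norm_mul_le := fun u v => by
      have h := (WSob.bilinL (ε := ε) (D := D) (k := k)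
        (ContinuousLinearMap.mul ℝ ℝ)).le_opNorm₂ u v
      refine h.trans ?_
      have h1 := (WSob.norm_bilinL_le (ε := ε) (D := D) (k := k)
        (ContinuousLinearMap.mul ℝ ℝ)).trans (ContinuousLinearMap.opNorm_mul_le ℝ ℝ)
      gcongr
      exact mul_le_of_le_one_left (norm_nonneg _) h1 }

instance : Algebra ℝ (WSob ε D k ℝ) :=
  Algebra.ofModule
    (fun c u v => by
      change WSob.bilinL (ContinuousLinearMap.mul ℝ ℝ) (c • u) v = _
      rw [map_smul]; rfl)
    (fun c u v => map_smul (WSob.bilinL (ContinuousLinearMap.mul ℝ ℝ) u) c v)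

instance : NormedAlgebra ℝ (WSob ε D k ℝ) where
  norm_smul_le c v := norm_smul_le c v

/-- The underlying function as a continuous linear map. -/
def WSob.toLpL (hε : (ε : ℝ) ≤ 1) : WSob ε D k X →L[ℝ] Lp X ∞ (vol D) :=
  Sobolev.toLpL ∘L (WSob.ofL (D := D) (k := k) (X := X) hε).symm.toContinuousLinearMap

theorem WSob.toLpL_apply (hε : (ε : ℝ) ≤ 1) (v : WSob ε D k X) :
    WSob.toLpL hε v = v.toLp := Sobolev.toLpL_apply _

theorem WSob.toLp_sub (v w : WSob ε D k X) : (v - w).toLp = v.toLp - w.toLp := rfl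

theorem WSob.toLp_pow (u : WSob ε D k ℝ) (n : ℕ) :
    (u ^ n).toLp =ᵐ[vol D] fun x => u.toLp x ^ n := by
  induction n with
  | zero =>
    rw [pow_zero]
    filter_upwards [WSob.toLp_one (ε := ε) (D := D) (k := k)] with x hx
    rw [hx, pow_zero]
  | succ n ih =>
    rw [pow_succ]
    filter_upwards [WSob.toLp_mul (u ^ n) u, ih] with x h1 h2
    rw [h1, h2, pow_succ]

/-- The weighted norm is controlled by the sup norm and `ε` times the full norm. -/
theorem Sobolev.wnorm_le_toLp_add {ε : ℝ} (h0 : 0 ≤ ε) (h1 : ε ≤ 1) {p : ℝ≥0∞} [Fact (1 ≤ p)]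
    (v : Sobolev D k p X) : v.wnorm ε ≤ ‖v.toLp‖ + ε * ∑ α ∈ (multiIdx d k).erase 0, ‖v.coef α‖ := by
  unfold Sobolev.wnorm
  rw [← Finset.add_sum_erase _ _ (zero_mem_multiIdx d k), Sobolev.coef_zero_eq, Finset.mul_sum]
  refine add_le_add (by simp) (Finset.sum_le_sum fun α hα => ?_)
  refine mul_le_mul_of_nonneg_right ?_ (norm_nonneg _)
  have hne : ∑ j, α j ≠ 0 := by
    intro h
    refine (Finset.ne_of_mem_erase hα) (funext fun i => ?_)
    exact (Finset.sum_eq_zero_iff.mp h) i (Finset.mem_univ i)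
  calc ε ^ (∑ j, α j) ≤ ε ^ 1 := pow_le_pow_of_le_one h0 h1 (Nat.one_le_iff_ne_zero.mpr hne)
    _ = ε := pow_one ε

end Weighted

/-! ### Normalised projections in a commutative Banach algebra -/

section Abstract

open Filter Topology
open scoped Nat

variable {E V A M : Type*} [NormedAddCommGroup E] [NormedSpace ℝ E] [NormedAddCommGroup V]
  [NormedSpace ℝ V] [NormedCommRing A] [NormedAlgebra ℝ A] [NormedAddCommGroup M] [NormedSpace ℝ M]

/-- The rate `1 / c` is tuned to order one, where the bound `c · (1 / c)` is exactly the bound for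
`‖j‖`; higher derivatives vanish. -/
theorem derivBound_clm (j : E →L[ℝ] V) (hj : ‖j‖ ≤ 1) {v : E} {c : ℝ} (hc : 0 < c)
    (hv : ‖j v‖ ≤ c) : DerivBound (fun y => j y) v c (1 / c) := by
  intro n
  rcases n with _ | n
  · simpa using hv
  rw [← norm_iteratedFDeriv_fderiv]
  have h : fderiv ℝ (fun y => j y) = fun _ => j := funext fun y => j.fderiv
  rw [h]
  rcases n with _ | n
  · simpa [hc.ne'] using hj
  · rw [iteratedFDeriv_const_of_ne (Nat.succ_ne_zero n)]
    simp only [Pi.zero_apply, norm_zero]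
    positivity

/-- Both factors have the same rate, so the Leibniz sum consists of `n + 1` equal bounds. The factor
`n + 1` is absorbed later through `n + 1 ≤ 2^n`. -/
theorem norm_iteratedFDeriv_quadratic_le (B : V →L[ℝ] V →L[ℝ] M) (hB : ‖B‖ ≤ 1)
    (j : E →L[ℝ] V) (hj : ‖j‖ ≤ 1) {v : E} {c : ℝ} (hc : 0 < c) (hv : ‖j v‖ ≤ c) (n : ℕ) :
    ‖iteratedFDeriv ℝ n (fun y => B (j y) (j y)) v‖ ≤ n ! * (n + 1) * c ^ 2 * (1 / c) ^ n := by
  have hs := j.contDiff.contDiffOn (n := (⊤ : ℕ∞)) (s := univ)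
  refine (norm_iteratedFDeriv_bilin_le B isOpen_univ (mem_univ v) hs hs n).trans ?_
  refine (mul_le_of_le_one_left (by positivity) hB).trans ?_
  have hb := derivBound_clm j hj hc hv
  calc _ ≤ ∑ i ∈ Finset.range (n + 1), (n ! : ℝ) * c ^ 2 * (1 / c) ^ n := by
        refine Finset.sum_le_sum fun i hi => ?_
        have hin : i ≤ n := Nat.lt_succ_iff.mp (Finset.mem_range.mp hi)
        calc _ ≤ (n.choose i : ℝ) * (i ! * c * (1 / c) ^ i) * ((n - i)! * c * (1 / c) ^ (n - i)) :=
              mul_le_mul (mul_le_mul_of_nonneg_left (hb i) (by positivity)) (hb (n - i))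
                (norm_nonneg _) (by positivity)
          _ = ((n.choose i : ℝ) * i ! * (n - i)!) * c ^ 2 * ((1 / c) ^ i * (1 / c) ^ (n - i)) := by
              ring
          _ = _ := by rw [choose_mul_factorials hin, ← pow_add, Nat.add_sub_cancel' hin]
    _ = _ := by simp; ring

/-- The data from which the coefficient is built: squared length, outer product, and
multiplication of matrix fields by scalar fields. -/
structure ProjData (E V A M : Type*) [NormedAddCommGroup E] [NormedSpace ℝ E]
    [NormedAddCommGroup V] [NormedSpace ℝ V] [NormedCommRing A] [NormedAlgebra ℝ A]
    [NormedAddCommGroup M] [NormedSpace ℝ M] where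
  /-- The inclusion of the parameter space. -/
  incl : E →L[ℝ] V
  /-- The inner product. -/
  dot : V →L[ℝ] V →L[ℝ] A
  /-- The outer product. -/
  outer : V →L[ℝ] V →L[ℝ] M
  /-- Multiplication by scalars. -/
  scal : A →L[ℝ] M →L[ℝ] M
  norm_incl : ‖incl‖ ≤ 1
  norm_dot : ‖dot‖ ≤ 1
  norm_outer : ‖outer‖ ≤ 1
  norm_scal : ‖scal‖ ≤ 1
  norm_one : ‖(1 : A)‖ ≤ 1

namespace ProjData

variable (P : ProjData E V A M) (c a : ℝ)

/-- The squared length. -/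
def sq (v : E) : A := P.dot (P.incl v) (P.incl v)

/-- The argument `1 - |v|² / c²` of the power series. -/
def arg (v : E) : A := 1 - (c ^ 2)⁻¹ • P.sq v

/-- The inverse length. -/
def invLen (v : E) : A := c⁻¹ • invSqrtSeries (P.arg c v)

/-- The inverse squared length. -/
def invSq (v : E) : A := P.invLen c v * P.invLen c v

/-- `(1 / |v| - a / |v|²) v vᵀ`. -/
def proj (v : E) : M :=
  P.scal (P.invLen c v + (-a) • P.invSq c v) (P.outer (P.incl v) (P.incl v))

/-- The domain of convergence. -/
def dom : Set E := {v | ‖P.arg c v‖ < 1}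

theorem contDiff_sq : ContDiff ℝ (⊤ : ℕ∞) P.sq :=
  (P.dot.contDiff.comp P.incl.contDiff).clm_apply P.incl.contDiff

theorem contDiff_arg : ContDiff ℝ (⊤ : ℕ∞) (P.arg c) :=
  contDiff_const.sub (P.contDiff_sq.const_smul _)

theorem isOpen_dom : IsOpen (P.dom c) :=
  isOpen_lt (P.contDiff_arg c).continuous.norm continuous_const

variable [CompleteSpace A]

theorem contDiffOn_invLen : ContDiffOn ℝ (⊤ : ℕ∞) (P.invLen c) (P.dom c) := by
  refine ContDiffOn.const_smul _ ?_
  refine (contDiffOn_invSqrtSeries P.norm_one).comp (P.contDiff_arg c).contDiffOn fun v hv => ?_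
  exact mem_ball_zero_iff.mpr hv

theorem contDiffOn_invSq : ContDiffOn ℝ (⊤ : ℕ∞) (P.invSq c) (P.dom c) :=
  (P.contDiffOn_invLen c).mul (P.contDiffOn_invLen c)

theorem contDiffOn_proj : ContDiffOn ℝ (⊤ : ℕ∞) (P.proj c a) (P.dom c) := by
  have h1 : ContDiff ℝ (⊤ : ℕ∞) fun v => P.outer (P.incl v) (P.incl v) :=
    (P.outer.contDiff.comp P.incl.contDiff).clm_apply P.incl.contDiff
  exact (P.scal.contDiff.comp_contDiffOn ((P.contDiffOn_invLen c).add
    ((P.contDiffOn_invSq c).const_smul _))).clm_apply h1.contDiffOn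

variable {c}

/-- At `x = 1 - |v|²/c²` one has `1 - x = |v|²/c²`, and the squared series inverts `1 - x`. The
factors of `c` cancel. -/
theorem invSq_mul_sq (hc : 0 < c) {v : E} (hv : v ∈ P.dom c) : P.invSq c v * P.sq v = 1 := by
  have h := invSqrtSeries_mul_self_mul P.norm_one (x := P.arg c v) hv
  have h2 : P.sq v = (c ^ 2) • (1 - P.arg c v) := by
    rw [arg, sub_sub_cancel, smul_smul, mul_inv_cancel₀ (by positivity), one_smul]
  rw [invSq, invLen, h2, smul_mul_smul_comm, smul_mul_smul_comm, h]
  have : c⁻¹ * c⁻¹ * c ^ 2 = 1 := by field_simp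
  rw [this, one_smul]

variable {ℓ : ℝ}

theorem one_sub_inv_le (hc : 0 < c) (hℓ : 0 < ℓ) {t : ℝ} (ht : t ≤ 1 - 3 / 4 * ℓ / c ^ 2) :
    (1 - t)⁻¹ ≤ 4 * c ^ 2 / (3 * ℓ) := by
  have h : 3 / 4 * ℓ / c ^ 2 ≤ 1 - t := by linarith
  have h2 : (4 * c ^ 2 / (3 * ℓ)) = (3 / 4 * ℓ / c ^ 2)⁻¹ := by field_simp
  rw [h2]
  exact inv_anti₀ (by positivity) h

theorem norm_invLen_le (hc : 0 < c) (hℓ : 0 < ℓ) {v : E}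
    (hv : ‖P.arg c v‖ ≤ 1 - 3 / 4 * ℓ / c ^ 2) : ‖P.invLen c v‖ ≤ c * (4 / (3 * ℓ)) := by
  have hpos : 0 < 3 / 4 * ℓ / c ^ 2 := by positivity
  have h1 : ‖P.arg c v‖ < 1 := by linarith
  rw [invLen, norm_smul, Real.norm_of_nonneg (by positivity)]
  calc c⁻¹ * ‖invSqrtSeries (P.arg c v)‖ ≤ c⁻¹ * (4 * c ^ 2 / (3 * ℓ)) := by
        gcongr
        exact (norm_invSqrtSeries_le P.norm_one h1).trans (one_sub_inv_le hc hℓ hv)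
    _ = _ := by field_simp

theorem norm_invSq_le (hc : 0 < c) (hℓ : 0 < ℓ) {v : E}
    (hv : ‖P.arg c v‖ ≤ 1 - 3 / 4 * ℓ / c ^ 2) : ‖P.invSq c v‖ ≤ 4 / (3 * ℓ) := by
  have hpos : 0 < 3 / 4 * ℓ / c ^ 2 := by positivity
  have h1 : ‖P.arg c v‖ < 1 := by linarith
  rw [invSq, invLen, smul_mul_smul_comm, norm_smul, Real.norm_of_nonneg (by positivity)]
  calc c⁻¹ * c⁻¹ * ‖invSqrtSeries (P.arg c v) * invSqrtSeries (P.arg c v)‖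
      ≤ c⁻¹ * c⁻¹ * (4 * c ^ 2 / (3 * ℓ)) := by
        gcongr
        exact (norm_invSqrtSeries_mul_self_le P.norm_one h1).trans (one_sub_inv_le hc hℓ hv)
    _ = _ := by field_simp

theorem succ_le_two_pow_cast (n : ℕ) : (n : ℝ) + 1 ≤ 2 ^ n := by
  have : n + 1 ≤ 2 ^ n := Nat.lt_two_pow_self
  exact_mod_cast this

/-- For `c ≥ 2` and `n ≥ 1` the quantity `(n + 1) c^{1-n}` is at most two, so rate one suffices.
This removes one power of `c` from the general quadratic bound. -/
theorem norm_iteratedFDeriv_sq_le (hc : 2 ≤ c) {v : E} (hv : ‖P.incl v‖ ≤ c) {n : ℕ}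
    (hn : 1 ≤ n) : ‖iteratedFDeriv ℝ n P.sq v‖ ≤ n ! * (2 * c) * 1 ^ n := by
  have hc0 : 0 < c := by linarith
  refine (norm_iteratedFDeriv_quadratic_le P.dot P.norm_dot P.incl P.norm_incl hc0 hv n).trans ?_
  obtain ⟨m, rfl⟩ : ∃ m, n = m + 1 := ⟨n - 1, by omega⟩
  have h1 : ((m + 1 : ℕ) + 1 : ℝ) * (1 / c) ^ m ≤ 2 := by
    have h2 := succ_le_two_pow_cast (m + 1)
    have h3 : (1 / c) ^ m ≤ (1 / 2) ^ m := by gcongr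
    calc ((m + 1 : ℕ) + 1 : ℝ) * (1 / c) ^ m ≤ 2 ^ (m + 1) * (1 / 2) ^ m := by gcongr
      _ = 2 := by
        rw [pow_succ, mul_right_comm, ← mul_pow]; norm_num
  calc ((m + 1)! : ℝ) * ((m + 1 : ℕ) + 1) * c ^ 2 * (1 / c) ^ (m + 1)
      = (m + 1)! * c * (((m + 1 : ℕ) + 1 : ℝ) * (1 / c) ^ m) := by
        have h4 : c * (1 / c) = 1 := mul_one_div_cancel hc0.ne'
        rw [pow_succ]
        linear_combination ((m + 1)! : ℝ) * ((m + 1 : ℕ) + 1) * c * (1 / c) ^ m * h4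
    _ ≤ (m + 1)! * c * 2 := by gcongr
    _ = _ := by rw [one_pow]; ring

/-- The rate is halved twice in advance: once because this factor is multiplied by `invSq`, which
has rate `τ / 2`, and once because that product enters a differential equation whose solution has
rate `τ`. -/
theorem derivBound_fderiv_sq (hc : 2 ≤ c) {v : E} (hv : ‖P.incl v‖ ≤ c) {τ : ℝ} (hτ : 16 ≤ τ) :
    DerivBound (fderiv ℝ P.sq) v (2 * c) (τ / 2 / 2) := by
  intro n
  rw [norm_iteratedFDeriv_fderiv]
  refine (P.norm_iteratedFDeriv_sq_le hc hv (Nat.succ_pos n)).trans ?_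
  rw [one_pow, mul_one, Nat.factorial_succ]
  have h1 : ((n + 1 : ℕ) : ℝ) ≤ (τ / 2 / 2) ^ n := by
    push_cast
    refine (succ_le_two_pow_cast n).trans ?_
    gcongr
    linarith
  calc (((n + 1) * n ! : ℕ) : ℝ) * (2 * c) = n ! * (2 * c) * ((n + 1 : ℕ) : ℝ) := by
        push_cast; ring
    _ ≤ _ := by
        have : 0 ≤ c := by linarith
        gcongr

theorem derivBound_outer (hc : 2 ≤ c) {v : E} (hv : ‖P.incl v‖ ≤ c) {τ : ℝ} (hτ : 16 ≤ τ) :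
    DerivBound (fun y => P.outer (P.incl y) (P.incl y)) v (c ^ 2) (τ / 2) := by
  intro n
  have hc0 : 0 < c := by linarith
  refine (norm_iteratedFDeriv_quadratic_le P.outer P.norm_outer P.incl P.norm_incl hc0 hv n).trans
    ?_
  have h1 : ((n : ℝ) + 1) * (1 / c) ^ n ≤ (τ / 2) ^ n := by
    calc ((n : ℝ) + 1) * (1 / c) ^ n ≤ 2 ^ n * 1 := by
          gcongr
          · exact succ_le_two_pow_cast n
          · exact pow_le_one₀ (by positivity) (by rw [div_le_one hc0]; linarith)
      _ ≤ (τ / 2) ^ n := by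
          rw [mul_one]; gcongr; linarith
  calc (n ! : ℝ) * (n + 1) * c ^ 2 * (1 / c) ^ n
      = n ! * c ^ 2 * (((n : ℝ) + 1) * (1 / c) ^ n) := by ring
    _ ≤ _ := by gcongr

/-- The bilinear map `(g, h) ↦ g · h` for scalar-valued `g` and `h` with values in linear maps. -/
def mulComp (E A : Type*) [NormedAddCommGroup E] [NormedSpace ℝ E] [NormedCommRing A]
    [NormedAlgebra ℝ A] : A →L[ℝ] (E →L[ℝ] A) →L[ℝ] (E →L[ℝ] A) :=
  (ContinuousLinearMap.compL ℝ E A A) ∘L (ContinuousLinearMap.mul ℝ A)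

theorem mulComp_apply (g : A) (h : E →L[ℝ] A) (x : E) : mulComp E A g h x = g * h x := rfl

theorem norm_mulComp_le : ‖mulComp E A‖ ≤ 1 := by
  refine ContinuousLinearMap.opNorm_le_bound₂ _ zero_le_one fun g h => ?_
  refine ContinuousLinearMap.opNorm_le_bound _ (by positivity) fun x => ?_
  rw [mulComp_apply, one_mul]
  refine (norm_mul_le _ _).trans ?_
  rw [mul_assoc]
  exact mul_le_mul_of_nonneg_left (h.le_opNorm x) (norm_nonneg _)

/-- With `G = 1/S`, multiplying out gives `G(y) = G(v) - G(v) G(y) (S(y) - S(v))`, which is the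
situation of `DerivBound.of_perturbation`. Half of the final rate `4c²/ℓ` is claimed, as the
coefficient in the equation for `1/|v|` requires. -/
theorem derivBound_invSq (hc : 2 ≤ c) (hℓ : 0 < ℓ) (hℓ1 : ℓ ≤ 1) {v : E} (hv : ‖P.incl v‖ ≤ c)
    (hv' : ‖P.arg c v‖ ≤ 1 - 3 / 4 * ℓ / c ^ 2) :
    DerivBound (P.invSq c) v (4 / (3 * ℓ)) (4 * c ^ 2 / ℓ / 2) := by
  have hc0 : 0 < c := by linarith
  have hpos : 0 < 3 / 4 * ℓ / c ^ 2 := by positivity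
  have hdom : v ∈ P.dom c := by
    change ‖P.arg c v‖ < 1; linarith
  let Q : A →L[ℝ] A →L[ℝ] A :=
    (ContinuousLinearMap.compL ℝ A A A (ContinuousLinearMap.mul ℝ A (P.invSq c v))) ∘L
      (ContinuousLinearMap.mul ℝ A)
  have hQ : ∀ g δ, Q g δ = P.invSq c v * (g * δ) := fun g δ => rfl
  have hG := P.norm_invSq_le hc0 hℓ hv'
  have hQn : ‖Q‖ ≤ 4 / (3 * ℓ) := by
    refine ContinuousLinearMap.opNorm_le_bound₂ _ (by positivity) fun g δ => ?_
    rw [hQ, mul_assoc]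
    refine (norm_mul_le _ _).trans ?_
    exact mul_le_mul hG (norm_mul_le _ _) (norm_nonneg _) (by positivity)
  have hΔ : ContDiff ℝ (⊤ : ℕ∞) fun y => P.sq y - P.sq v := P.contDiff_sq.sub contDiff_const
  have key := DerivBound.of_perturbation Q (P.isOpen_dom c) hdom (P.contDiffOn_invSq c)
    hΔ.contDiffOn (g₀ := 4 / (3 * ℓ)) (β := 2 * c) (ρ := 1) (by positivity) zero_le_one hQn hG
    (sub_self _) (fun n hn => by
      rw [fun_iteratedFDeriv_sub_apply (P.contDiff_sq.contDiffAt.of_le (by exact_mod_cast le_top))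
        contDiffAt_const, iteratedFDeriv_const_of_ne (Nat.one_le_iff_ne_zero.mp hn)]
      simpa using P.norm_iteratedFDeriv_sq_le hc hv hn)
    (fun y hy => by
      rw [hQ]
      have h1 := P.invSq_mul_sq hc0 hy
      have h2 := P.invSq_mul_sq hc0 hdom
      calc P.invSq c y = P.invSq c v - (P.invSq c v * 1 - (1 : A) * P.invSq c y) := by ring
        _ = P.invSq c v - (P.invSq c v * (P.invSq c y * P.sq y) -
              P.invSq c v * P.sq v * P.invSq c y) := by rw [h1, h2]
        _ = _ := by ring)
  refine key.mono le_rfl (by positivity) ?_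
  rw [mul_one]
  -- The rate obtained is `1 + (8/3) c/ℓ`. Since `c ≥ 2` and `ℓ ≤ 1`, it is at most `(19/6) c/ℓ ≤ 4
  -- c/ℓ ≤ 2 c²/ℓ`.
  have h1 : 1 ≤ c / 2 / ℓ := by
    rw [le_div_iff₀ hℓ]; linarith
  have h2 : 2 * (c / ℓ) ≤ c ^ 2 / ℓ := by
    rw [mul_div_assoc']
    gcongr
    nlinarith
  have h3 : 4 / (3 * ℓ) * (2 * c) = 8 / 3 * (c / ℓ) := by field_simp; norm_num
  have h4 : c / 2 / ℓ = 1 / 2 * (c / ℓ) := by ring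
  have h5 : 4 * c ^ 2 / ℓ / 2 = 2 * (c ^ 2 / ℓ) := by ring
  have h6 : 0 < c / ℓ := by positivity
  rw [h3, h5]
  linarith

/-- Differentiate `r² S = 1` and multiply by `r` to get `2 r' = -r³ S'`. Grouped as `r · (r² S')`,
this is linear in `r` with a coefficient whose derivatives are already under control. -/
theorem fderiv_invLen (hc : 0 < c) {y : E} (hy : y ∈ P.dom c) :
    fderiv ℝ (P.invLen c) y = (((-1 / 2 : ℝ) • mulComp E A) (P.invLen c y))
      (mulComp E A (P.invSq c y) (fderiv ℝ P.sq y)) := by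
  have hR : DifferentiableAt ℝ (P.invLen c) y :=
    ((P.contDiffOn_invLen c).contDiffAt ((P.isOpen_dom c).mem_nhds hy)).differentiableAt (by simp)
  have hS : DifferentiableAt ℝ P.sq y := P.contDiff_sq.contDiffAt.differentiableAt (by simp)
  have hE : (fun z => P.invLen c z * P.invLen c z * P.sq z) =ᶠ[𝓝 y] fun _ => 1 :=
    Filter.eventually_of_mem ((P.isOpen_dom c).mem_nhds hy) fun z hz => P.invSq_mul_sq hc hz
  have h1 := hE.fderiv_eq (𝕜 := ℝ)
  rw [fderiv_fun_mul (hR.fun_mul hR) hS, fderiv_fun_mul hR hR] at h1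
  have h3 := P.invSq_mul_sq hc hy
  unfold invSq at h3
  ext x
  have h4 := congrArg (fun T : E →L[ℝ] A => T x) h1
  simp only [fderiv_const_apply, zero_apply, add_apply,
    smul_apply, smul_eq_mul] at h4
  simp only [smul_apply, mulComp_apply, invSq]
  set r := P.invLen c y
  set s := P.sq y
  set dr := fderiv ℝ (P.invLen c) y x
  set ds := fderiv ℝ P.sq y x
  have h5 : (2 : ℝ) • dr = -(r * (r * r * ds)) := by
    have : (2 : ℝ) • dr = dr + dr := two_smul ℝ dr
    rw [this]
    have h6 : dr = r * r * s * dr := by rw [h3, one_mul]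
    have h7 : r * (r * r * ds + s * (r * dr + r * dr)) = 0 := by
      rw [h4, mul_zero]
    calc dr + dr = r * r * s * dr + r * r * s * dr := by rw [← h6]
      _ = r * (r * r * ds + s * (r * dr + r * dr)) - r * (r * r * ds) := by ring
      _ = _ := by rw [h7, zero_sub]
  calc dr = (1 / 2 : ℝ) • (2 : ℝ) • dr := by rw [smul_smul]; norm_num
    _ = _ := by rw [h5, smul_neg, ← neg_smul]; norm_num

/-- The linear equation replaces any differentiation of the power series. The smallness condition of
`DerivBound.of_linear_ode` becomes `16 c / (3 ℓ) ≤ 4 c² / ℓ`, which `c ≥ 2` guarantees. -/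
theorem derivBound_invLen (hc : 2 ≤ c) (hℓ : 0 < ℓ) (hℓ1 : ℓ ≤ 1) {v : E} (hv : ‖P.incl v‖ ≤ c)
    (hv' : ‖P.arg c v‖ ≤ 1 - 3 / 4 * ℓ / c ^ 2) :
    DerivBound (P.invLen c) v (c * (4 / (3 * ℓ))) (4 * c ^ 2 / ℓ) := by
  have hc0 : 0 < c := by linarith
  have hpos : 0 < 3 / 4 * ℓ / c ^ 2 := by positivity
  have hdom : v ∈ P.dom c := by
    change ‖P.arg c v‖ < 1; linarith
  have hτ : 16 ≤ 4 * c ^ 2 / ℓ := by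
    rw [le_div_iff₀ hℓ]; nlinarith
  have hfs : ContDiffOn ℝ (⊤ : ℕ∞) (fderiv ℝ P.sq) (P.dom c) :=
    (P.contDiff_sq.fderiv_right (m := (⊤ : ℕ∞)) (by simp)).contDiffOn
  have hW := DerivBound.bilin (mulComp E A) (P.isOpen_dom c) hdom (P.contDiffOn_invSq c) hfs
    (by positivity) norm_mulComp_le (P.derivBound_invSq hc hℓ hℓ1 hv hv')
    (P.derivBound_fderiv_sq hc hv hτ)
  have hWc : ContDiffOn ℝ (⊤ : ℕ∞)
      (fun y => mulComp E A (P.invSq c y) (fderiv ℝ P.sq y)) (P.dom c) :=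
    ((mulComp E A).contDiff.comp_contDiffOn (P.contDiffOn_invSq c)).clm_apply hfs
  have hP : ‖((-1 / 2 : ℝ) • mulComp E A)‖ ≤ 1 / 2 := by
    rw [norm_smul]
    have h1 : ‖(-1 / 2 : ℝ)‖ = 1 / 2 := by norm_num [abs_div]
    rw [h1]
    have := norm_mulComp_le (E := E) (A := A)
    linarith
  refine DerivBound.of_linear_ode _ (P.isOpen_dom c) hdom (P.contDiffOn_invLen c) hWc
    (by positivity) hP (P.norm_invLen_le hc0 hℓ hv') hW ?_ (fun y hy => P.fderiv_invLen hc0 hy)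
  have h1 : 2 * (1 / 2) * (2 * (4 / (3 * ℓ)) * (2 * c)) = 16 / 3 * c / ℓ := by
    field_simp; norm_num
  rw [h1]
  exact div_le_div_of_nonneg_right (by nlinarith) hℓ.le

theorem derivBound_proj (hc : 2 ≤ c) (hℓ : 0 < ℓ) (hℓ1 : ℓ ≤ 1) {aUp : ℝ} (ha : |a| ≤ aUp)
    (hUp : 1 ≤ aUp) {v : E} (hv : ‖P.incl v‖ ≤ c)
    (hv' : ‖P.arg c v‖ ≤ 1 - 3 / 4 * ℓ / c ^ 2) :
    DerivBound (P.proj c a) v (4 * c ^ 3 * aUp / ℓ) (4 * c ^ 2 / ℓ) := by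
  have hc0 : 0 < c := by linarith
  have hpos : 0 < 3 / 4 * ℓ / c ^ 2 := by positivity
  have hdom : v ∈ P.dom c := by
    change ‖P.arg c v‖ < 1; linarith
  have hτ : 16 ≤ 4 * c ^ 2 / ℓ := by
    rw [le_div_iff₀ hℓ]; nlinarith
  have hs := P.isOpen_dom c
  have h1 := P.derivBound_invLen hc hℓ hℓ1 hv hv'
  have h2 : DerivBound (fun y => (-a) • P.invSq c y) v (aUp * (4 / (3 * ℓ))) (4 * c ^ 2 / ℓ) := by
    have := ((P.derivBound_invSq hc hℓ hℓ1 hv hv').mono le_rfl (by positivity)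
      (half_le_self (by positivity : 0 ≤ 4 * c ^ 2 / ℓ))).clm
      ((-a) • ContinuousLinearMap.id ℝ A) hs hdom (P.contDiffOn_invSq c) (N := aUp) (by
        refine ContinuousLinearMap.opNorm_le_bound _ (by linarith) fun x => ?_
        simp only [smul_apply, ContinuousLinearMap.id_apply, norm_smul,
          Real.norm_eq_abs, abs_neg]
        exact mul_le_mul_of_nonneg_right ha (norm_nonneg _))
    exact this
  have h3 := h1.add hs hdom (P.contDiffOn_invLen c)
    ((P.contDiffOn_invSq c).const_smul (-a)) h2
  have hout : ContDiff ℝ (⊤ : ℕ∞) fun v => P.outer (P.incl v) (P.incl v) :=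
    (P.outer.contDiff.comp P.incl.contDiff).clm_apply P.incl.contDiff
  have h4 := DerivBound.bilin P.scal hs hdom
    ((P.contDiffOn_invLen c).add ((P.contDiffOn_invSq c).const_smul (-a))) hout.contDiffOn
    (by positivity) P.norm_scal h3 (P.derivBound_outer hc hv hτ)
  refine h4.mono ?_ (by positivity) le_rfl
  have h5 : 2 * (c * (4 / (3 * ℓ)) + aUp * (4 / (3 * ℓ))) * c ^ 2 =
      8 / 3 * (c + aUp) * c ^ 2 / ℓ := by field_simp; norm_num
  rw [h5]
  refine div_le_div_of_nonneg_right ?_ hℓ.le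
  -- From `c ≤ c aUp` and `aUp ≤ c aUp / 2`; combined with the factor `8/3` this yields the constant
  -- four.
  have h6 : c + aUp ≤ 3 / 2 * (c * aUp) := by nlinarith
  have h7 : 0 ≤ c ^ 2 := by positivity
  nlinarith

end ProjData

end Abstract

/-! ### The coefficient as a smooth function of the vector field -/

section Coefficient

open Filter Topology
open scoped Nat

variable {d k : ℕ} {D : Opens (Vec d)} {ε : Ioi (0 : ℝ)}

/-- The inner product as a continuous bilinear map. -/
def dotL (d : ℕ) : Vec d →L[ℝ] Vec d →L[ℝ] ℝ :=
  LinearMap.mkContinuous₂ (LinearMap.mk₂ ℝ (fun v w => inner ℝ v w) inner_add_left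
    (fun c v w => real_inner_smul_left v w c) inner_add_right
    (fun c v w => real_inner_smul_right v w c)) 1
    (fun v w => by rw [one_mul]; exact norm_inner_le_norm v w)

theorem dotL_apply (v w : Vec d) : dotL d v w = inner ℝ v w := rfl

theorem norm_dotL_le : ‖dotL d‖ ≤ 1 := LinearMap.mkContinuous₂_norm_le _ zero_le_one _

/-- The outer product as a continuous bilinear map. -/
def outerL (d : ℕ) : Vec d →L[ℝ] Vec d →L[ℝ] Mat d :=
  LinearMap.mkContinuous₂ (LinearMap.mk₂ ℝ (fun v w => InnerProductSpace.rankOne ℝ v w)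
    (fun v v' w => by rw [map_add]; rfl) (fun c v w => by rw [map_smul]; rfl)
    (fun v w w' => map_add _ _ _) (fun c v w => by ext x; simp)) 1
    (fun v w => by rw [one_mul]; exact (InnerProductSpace.norm_rankOne v w).le)

theorem outerL_apply (v w : Vec d) : outerL d v w = InnerProductSpace.rankOne ℝ v w := rfl

theorem norm_outerL_le : ‖outerL d‖ ≤ 1 := LinearMap.mkContinuous₂_norm_le _ zero_le_one _

/-- The data for the coefficient in the weighted spaces. -/
def projData (hε : (ε : ℝ) ≤ 1) : ProjData (Sobolev D k ∞ (Vec d)) (WSob ε D k (Vec d))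
    (WSob ε D k ℝ) (WSob ε D k (Mat d)) where
  incl := (WSob.ofL hε).toContinuousLinearMap
  dot := WSob.bilinL (dotL d)
  outer := WSob.bilinL (outerL d)
  scal := WSob.bilinL (ContinuousLinearMap.lsmul ℝ ℝ)
  norm_incl := WSob.norm_ofL_le hε
  norm_dot := (WSob.norm_bilinL_le _).trans norm_dotL_le
  norm_outer := (WSob.norm_bilinL_le _).trans norm_outerL_le
  norm_scal := (WSob.norm_bilinL_le _).trans ContinuousLinearMap.opNorm_lsmul_le
  norm_one := WSob.norm_one_le

variable {c a aLow : ℝ}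

theorem toLp_projData_sq (hε : (ε : ℝ) ≤ 1) (V : Sobolev D k ∞ (Vec d)) :
    ((projData hε).sq V).toLp =ᵐ[vol D] fun x => ‖V.toLp x‖ ^ 2 := by
  filter_upwards [WSob.toLp_bilinL (dotL d) (WSob.of ε V) (WSob.of ε V)] with x hx
  refine hx.trans ?_
  rw [WSob.toLp_of, dotL_apply, real_inner_self_eq_norm_sq]

theorem toLp_projData_arg (hε : (ε : ℝ) ≤ 1) (V : Sobolev D k ∞ (Vec d)) :
    ((projData hε).arg c V).toLp =ᵐ[vol D] fun x => 1 - (c ^ 2)⁻¹ * ‖V.toLp x‖ ^ 2 := by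
  rw [ProjData.arg, WSob.toLp_sub, WSob.toLp_smul]
  filter_upwards [toLp_projData_sq hε V, WSob.toLp_one (ε := ε) (D := D) (k := k),
    Lp.coeFn_sub (1 : WSob ε D k ℝ).toLp ((c ^ 2)⁻¹ • ((projData hε).sq V).toLp),
    Lp.coeFn_smul (c ^ 2)⁻¹ ((projData hε).sq V).toLp] with x h1 h2 h3 h4
  rw [h3, Pi.sub_apply, h2, h4, Pi.smul_apply, h1, smul_eq_mul]

theorem Sobolev.ae_norm_toLp_le (V : Sobolev D k ∞ (Vec d)) :
    ∀ᵐ x ∂vol D, ‖V.toLp x‖ ≤ ‖V‖ := by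
  filter_upwards [ae_norm_le_toReal_eLpNorm (Lp.memLp V.toLp)] with x hx
  refine hx.trans ?_
  rw [← Lp.norm_def, ← Sobolev.coef_zero_eq]
  exact V.norm_coef_le 0

theorem Lp_top_norm_le {X : Type*} [NormedAddCommGroup X] {f : Lp X ∞ (vol D)} {C : ℝ}
    (hC : 0 ≤ C) (h : ∀ᵐ x ∂vol D, ‖f x‖ ≤ C) : ‖f‖ ≤ C := by
  rw [Lp.norm_def]
  refine ENNReal.toReal_le_of_le_ofReal hC ?_
  rw [eLpNorm_exponent_top]
  exact eLpNormEssSup_le_of_ae_bound h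

theorem Sobolev.coef_const_of_ne {X : Type*} [NormedAddCommGroup X] [NormedSpace ℝ X]
    [CompleteSpace X] (b : X) {α : Fin d → ℕ} (hα : α ∈ multiIdx d k) (h : α ≠ 0) :
    (Sobolev.const b : Sobolev D k ∞ X).coef α = 0 := by
  rw [Sobolev.const, Sobolev.coef_ofCoef _ (mem_multiIdx.mp hα), if_neg h]

/-- Values and derivatives are estimated separately. Pointwise, `aLow ≤ |V| ≤ c` bounds `1 -
|V|²/c²` by `1 - aLow²/c²`. The derivative terms carry a factor `ε`; without it they sum to at most
`‖V‖²/c² ≤ 1` by the product estimate, the constant one contributing nothing. -/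
theorem norm_projData_arg_le (hε : (ε : ℝ) ≤ 1) (hc : 0 < c) (hLow : 0 ≤ aLow) (hLc : aLow ≤ c)
    {V : Sobolev D k ∞ (Vec d)} (hV : ‖V‖ ≤ c) (hV' : ∀ᵐ x ∂vol D, aLow ≤ ‖V.toLp x‖) :
    ‖(projData hε).arg c V‖ ≤ 1 - aLow ^ 2 / c ^ 2 + ε := by
  rw [WSob.norm_eq]
  refine (Sobolev.wnorm_le_toLp_add ε.2.le hε _).trans (add_le_add ?_ ?_)
  · change ‖((projData hε).arg c V).toLp‖ ≤ _
    have h0 : aLow ^ 2 / c ^ 2 ≤ 1 := by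
      rw [div_le_one (by positivity)]; gcongr
    refine Lp_top_norm_le (by linarith) ?_
    filter_upwards [toLp_projData_arg (c := c) hε V, V.ae_norm_toLp_le, hV'] with x h1 h2 h3
    rw [h1, Real.norm_eq_abs, abs_le]
    have h4 : ‖V.toLp x‖ ^ 2 ≤ c ^ 2 := by
      have := h2.trans hV
      gcongr
    have h5 : aLow ^ 2 ≤ ‖V.toLp x‖ ^ 2 := by gcongr
    have h6 : (c ^ 2)⁻¹ * ‖V.toLp x‖ ^ 2 ≤ 1 := by
      rw [inv_mul_le_iff₀ (by positivity), mul_one]; exact h4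
    have h7 : aLow ^ 2 / c ^ 2 ≤ (c ^ 2)⁻¹ * ‖V.toLp x‖ ^ 2 := by
      rw [div_eq_inv_mul]; gcongr
    constructor <;> linarith
  · refine mul_le_of_le_one_right ε.2.le ?_
    let S : Sobolev D k ∞ ℝ := Sobolev.bilin (dotL d) V V
    have hS : ‖S‖ ≤ c ^ 2 := by
      refine (Sobolev.norm_bilin_le (dotL d) V V).trans ?_
      have := norm_dotL_le (d := d)
      calc ‖dotL d‖ * ‖V‖ * ‖V‖ ≤ 1 * c * c := by gcongr
        _ = c ^ 2 := by ring
    have hcoef : ∀ α ∈ (multiIdx d k).erase 0,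
        ‖((WSob.of ε).symm ((projData hε).arg c V)).coef α‖ = (c ^ 2)⁻¹ * ‖S.coef α‖ := by
      intro α hα
      have h1 : (WSob.of ε).symm ((projData hε).arg c V) =
          Sobolev.const 1 + (-(c ^ 2)⁻¹) • S := by
        rw [ProjData.arg, sub_eq_add_neg, ← neg_smul]; rfl
      rw [h1, Sobolev.coef_add, Sobolev.coef_smul,
        Sobolev.coef_const_of_ne 1 (Finset.mem_of_mem_erase hα) (Finset.ne_of_mem_erase hα),
        zero_add, norm_smul, norm_neg, Real.norm_of_nonneg (by positivity)]
    rw [Finset.sum_congr rfl hcoef, ← Finset.mul_sum, inv_mul_le_iff₀ (by positivity), mul_one]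
    refine le_trans ?_ hS
    rw [Sobolev.norm_eq_sum_coef]
    exact Finset.sum_le_sum_of_subset_of_nonneg (Finset.erase_subset _ _)
      fun _ _ _ => norm_nonneg _

/-- The equation `r² |V|² = 1` leaves the sign of `r` open. Since `|V| ≤ c`, all terms of the series
are nonnegative functions, and a convergent sum of such in `L^∞` is nonnegative. -/
theorem projData_invLen_nonneg (hε : (ε : ℝ) ≤ 1) (hc : 0 < c) {V : Sobolev D k ∞ (Vec d)}
    (hV : ‖V‖ ≤ c) (hdom : V ∈ (projData hε).dom c) :
    ∀ᵐ x ∂vol D, 0 ≤ ((projData hε).invLen c V).toLp x := by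
  have : CompleteSpace (WSob ε D k ℝ) := WSob.completeSpace hε
  have h1 := hasSum_invSqrtSeries (projData (D := D) (k := k) hε).norm_one hdom
  have h2 := h1.mapL (WSob.toLpL hε)
  have h3 : 0 ≤ (WSob.toLpL hε) (invSqrtSeries ((projData hε).arg c V)) := by
    refine h2.nonneg fun n => ?_
    rw [WSob.toLpL_apply, WSob.toLp_smul, ← Lp.coeFn_nonneg]
    filter_upwards [Lp.coeFn_smul (invSqrtCoeff n) (((projData hε).arg c V) ^ n).toLp,
      WSob.toLp_pow ((projData hε).arg c V) n, toLp_projData_arg (c := c) hε V,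
      V.ae_norm_toLp_le] with x h1 h2 h3 h4
    rw [h1, Pi.smul_apply, h2, h3, smul_eq_mul]
    refine mul_nonneg (invSqrtCoeff_nonneg n) (pow_nonneg ?_ n)
    rw [sub_nonneg, inv_mul_le_iff₀ (by positivity), mul_one]
    have := h4.trans hV
    gcongr
  rw [WSob.toLpL_apply, ← Lp.coeFn_nonneg] at h3
  rw [ProjData.invLen, WSob.toLp_smul]
  filter_upwards [h3, Lp.coeFn_smul c⁻¹ (invSqrtSeries ((projData hε).arg c V)).toLp]
    with x h4 h5
  rw [h5, Pi.smul_apply, smul_eq_mul]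
  exact mul_nonneg (by positivity) h4

/-- The anisotropic part of the coefficient, as an element of `W^{k,∞}`. -/
def anisoPart (hε : (ε : ℝ) ≤ 1) (c a : ℝ) (V : Sobolev D k ∞ (Vec d)) : Sobolev D k ∞ (Mat d) :=
  (WSob.ofL hε).symm ((projData hε).proj c a V)

/-- Almost everywhere `r` is the nonnegative root of `r² |V|² = 1`, so `r = 1/|V|` and `r - a r² =
(|V| - a)/|V|²`. -/
theorem toLp_anisoPart (hε : (ε : ℝ) ≤ 1) (hc : 0 < c) {V : Sobolev D k ∞ (Vec d)}
    (hV : ‖V‖ ≤ c) (hdom : V ∈ (projData hε).dom c) :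
    (anisoPart hε c a V).toLp =ᵐ[vol D] fun x =>
      ((‖V.toLp x‖ - a) / inner ℝ (V.toLp x) (V.toLp x)) •
        InnerProductSpace.rankOne ℝ (V.toLp x) (V.toLp x) := by
  have : CompleteSpace (WSob ε D k ℝ) := WSob.completeSpace hε
  set r := (projData hε).invLen c V
  set q := (projData hε).invSq c V
  have hq : q * (projData hε).sq V = 1 := (projData hε).invSq_mul_sq hc hdom
  have hlen := projData_invLen_nonneg hε hc hV hdom
  have h1 := WSob.toLp_bilinL (ContinuousLinearMap.lsmul ℝ ℝ) (r + (-a) • q)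
    (WSob.bilinL (outerL d) (WSob.of ε V) (WSob.of ε V))
  have h2 := WSob.toLp_bilinL (outerL d) (WSob.of ε V) (WSob.of ε V)
  have h3 := WSob.toLp_mul r r
  have h4 := WSob.toLp_mul q ((projData hε).sq V)
  rw [hq] at h4
  filter_upwards [hlen, h1, h2, h3, h4, WSob.toLp_one (ε := ε) (D := D) (k := k),
    toLp_projData_sq hε V, Lp.coeFn_add r.toLp ((-a) • q.toLp), Lp.coeFn_smul (-a) q.toLp]
    with x h0 h1 h2 h3 h4 h5 h6 h7 h8
  refine h1.trans ?_
  rw [h2, WSob.toLp_add, WSob.toLp_smul, h7, Pi.add_apply, h8, Pi.smul_apply, WSob.toLp_of,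
    ContinuousLinearMap.lsmul_apply, outerL_apply, smul_eq_mul]
  have h3' : q.toLp x = r.toLp x * r.toLp x := h3
  rw [h5, h6, h3'] at h4
  rw [h3', real_inner_self_eq_norm_sq]
  congr 1
  set t := r.toLp x
  set s := ‖V.toLp x‖
  have hs : 0 ≤ s := norm_nonneg _
  have hs0 : s ≠ 0 := by
    intro h
    rw [h] at h4
    norm_num at h4
  have hts : t * s = 1 := by
    have h9 : (t * s - 1) * (t * s + 1) = 0 := by linear_combination -h4
    rcases mul_eq_zero.mp h9 with h | h
    · linarith
    · have : 0 ≤ t * s := mul_nonneg h0 hs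
      linarith
  have ht : t = 1 / s := by field_simp; exact hts
  rw [ht]
  field_simp
  ring

theorem contDiffOn_anisoPart (hε : (ε : ℝ) ≤ 1) : ContDiffOn ℝ (⊤ : ℕ∞)
    (anisoPart (D := D) (k := k) hε c a) ((projData hε).dom c) := by
  have : CompleteSpace (WSob ε D k ℝ) := WSob.completeSpace hε
  exact (WSob.ofL hε).symm.contDiff.comp_contDiffOn ((projData hε).contDiffOn_proj c a)

/-- The weight `ℓ / (4 c²)`. -/
def weight {c aLow : ℝ} (hc : 2 ≤ c) (hLow : 0 < aLow) : Ioi (0 : ℝ) :=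
  ⟨aLow ^ 2 / (4 * c ^ 2), by
    have : 0 < c := by linarith
    exact mem_Ioi.mpr (by positivity)⟩

theorem weight_le_one (hc : 2 ≤ c) (hLow : 0 < aLow) (hLow1 : aLow ≤ 1) :
    (weight hc hLow : ℝ) ≤ 1 := by
  change aLow ^ 2 / (4 * c ^ 2) ≤ 1
  rw [div_le_one (by nlinarith)]
  nlinarith

/-- The chosen weight spends a quarter of the gap `aLow²/c²` on the derivatives and leaves three
quarters. -/
theorem norm_projData_arg_le_weight (hc : 2 ≤ c) (hLow : 0 < aLow) (hLow1 : aLow ≤ 1)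
    {V : Sobolev D k ∞ (Vec d)} (hV : ‖V‖ ≤ c) (hV' : ∀ᵐ x ∂vol D, aLow ≤ ‖V.toLp x‖) :
    ‖(projData (weight_le_one hc hLow hLow1)).arg c V‖ ≤ 1 - 3 / 4 * aLow ^ 2 / c ^ 2 := by
  have hc0 : 0 < c := by linarith
  refine (norm_projData_arg_le _ hc0 hLow.le (by linarith) hV hV').trans (le_of_eq ?_)
  change 1 - aLow ^ 2 / c ^ 2 + aLow ^ 2 / (4 * c ^ 2) = _
  field_simp
  ring

theorem mem_projData_dom (hc : 2 ≤ c) (hLow : 0 < aLow) (hLow1 : aLow ≤ 1)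
    {V : Sobolev D k ∞ (Vec d)} (hV : ‖V‖ ≤ c) (hV' : ∀ᵐ x ∂vol D, aLow ≤ ‖V.toLp x‖) :
    V ∈ (projData (weight_le_one hc hLow hLow1)).dom c := by
  have hc0 : 0 < c := by linarith
  have h := norm_projData_arg_le_weight hc hLow hLow1 hV hV'
  have hpos : 0 < 3 / 4 * aLow ^ 2 / c ^ 2 := by positivity
  change ‖_‖ < 1
  linarith

/-- This is `derivBound_proj` with `ℓ = aLow²`. Returning to the unweighted norm multiplies the
constant by `ε^{-k}` and leaves the rate unchanged. -/
theorem derivBound_anisoPart (hc : 2 ≤ c) (hLow : 0 < aLow) (hLow1 : aLow ≤ 1) {aUp : ℝ}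
    (ha : |a| ≤ aUp) (hUp : 1 ≤ aUp) {V : Sobolev D k ∞ (Vec d)} (hV : ‖V‖ ≤ c)
    (hV' : ∀ᵐ x ∂vol D, aLow ≤ ‖V.toLp x‖) :
    DerivBound (anisoPart (weight_le_one hc hLow hLow1) c a) V
      ((4 * c ^ 2 / aLow ^ 2) ^ k * (4 * c ^ 3 * aUp / aLow ^ 2)) (4 * c ^ 2 / aLow ^ 2) := by
  have hε := weight_le_one hc hLow hLow1
  have : CompleteSpace (WSob (weight hc hLow) D k ℝ) := WSob.completeSpace hε
  have hdom := mem_projData_dom hc hLow hLow1 hV hV'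
  have hincl : ‖(projData hε).incl V‖ ≤ c := by
    refine (((projData (D := D) (k := k) hε).incl.le_opNorm V).trans ?_)
    exact (mul_le_of_le_one_left (norm_nonneg _) (projData (D := D) (k := k) hε).norm_incl).trans hV
  have h := (projData hε).derivBound_proj (a := a) hc (by positivity : 0 < aLow ^ 2)
    (pow_le_one₀ hLow.le hLow1) ha hUp hincl
    (norm_projData_arg_le_weight hc hLow hLow1 hV hV')
  refine h.clm ((WSob.ofL (D := D) (k := k) (X := Mat d) hε).symm.toContinuousLinearMap)
    ((projData hε).isOpen_dom c) hdom ((projData hε).contDiffOn_proj c a) ?_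
  refine (WSob.norm_ofL_symm_le hε).trans (le_of_eq ?_)
  change (aLow ^ 2 / (4 * c ^ 2))⁻¹ ^ k = _
  rw [inv_div]

/-- With `t = 2c²/aLow²` the left side contains `(2t)^κ`, while `kA` contains `t^κ` twice. Since `4c
≤ t`, one has `2^κ · 4c ≤ 2 t^κ`, so the second power absorbs both `2^κ` and the surplus factor `c`.
-/
theorem two_mul_coefficient_bound_le_kA {κ : ℕ} (hκ : 1 ≤ κ) (hc : 2 ≤ c) (hLow : 0 < aLow)
    (hLow1 : aLow ≤ 1) {aUp : ℝ} (hUp : 1 ≤ aUp) :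
    2 * ((4 * c ^ 2 / aLow ^ 2) ^ κ * (4 * c ^ 3 * aUp / aLow ^ 2)) ≤ kA κ aLow aUp c := by
  have hc0 : 0 < c := by linarith
  set t := 2 * c ^ 2 / aLow ^ 2 with ht
  have h1 : 4 * c ^ 2 / aLow ^ 2 = 2 * t := by rw [ht]; ring
  have hκ' : (1 : ℝ) ≤ κ := by exact_mod_cast hκ
  have hl1 : aLow ^ 2 ≤ 1 := pow_le_one₀ hLow.le hLow1
  have ht4 : 4 * c ≤ t := by
    rw [ht, le_div_iff₀ (by positivity)]
    nlinarith
  have ht0 : 0 < t := by positivity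
  have h2 : (2 : ℝ) ^ κ * (4 * c) ≤ 2 * t ^ κ := by
    obtain ⟨m, rfl⟩ : ∃ m, κ = m + 1 := ⟨κ - 1, by omega⟩
    have : (2 : ℝ) ^ m ≤ t ^ m := by
      gcongr; linarith
    calc (2 : ℝ) ^ (m + 1) * (4 * c) = 2 * (2 ^ m * (4 * c)) := by ring
      _ ≤ 2 * (t ^ m * t) := by gcongr
      _ = _ := by ring
  set L := 1 / aLow ^ 2 with hL
  have hL0 : 0 < L := by positivity
  have hq : 4 * c ^ 3 * aUp / aLow ^ 2 = 4 * c * (c ^ 2 * aUp * L) := by rw [hL]; ring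
  have h5 : kA κ aLow aUp c ≥ ((κ + 1) * L * t ^ κ) * (3 * (κ + 1) * aUp * t ^ κ * c ^ 2) := by
    unfold kA
    rw [← ht, ← hL]
    have : 0 ≤ aUp * (3 * (κ + 1) * aUp * t ^ κ * c ^ 2) := by positivity
    nlinarith
  refine le_trans ?_ h5
  rw [h1, hq, mul_pow]
  calc 2 * ((2 : ℝ) ^ κ * t ^ κ * (4 * c * (c ^ 2 * aUp * L)))
      = 2 * ((2 : ℝ) ^ κ * (4 * c)) * (t ^ κ * (c ^ 2 * aUp * L)) := by ring
    _ ≤ 2 * (2 * t ^ κ) * (t ^ κ * (c ^ 2 * aUp * L)) := by gcongr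
    _ = 4 * (t ^ κ * t ^ κ * (c ^ 2 * aUp * L)) := by ring
    _ ≤ ((κ + 1) * (κ + 1) * 3) * (t ^ κ * t ^ κ * (c ^ 2 * aUp * L)) := by
        gcongr; nlinarith
    _ = _ := by ring

end Coefficient

/-! ### Differentiation, restriction and test functions in Sobolev spaces -/

section Derivatives

open Filter Topology

variable {d k : ℕ} {D : Opens (Vec d)} {p : ℝ≥0∞} [hp : Fact (1 ≤ p)]
variable {X : Type*} [NormedAddCommGroup X] [NormedSpace ℝ X]

/-- The weak partial derivative `∂_i v ∈ W^{k,p}` of `v ∈ W^{k+1,p}`. -/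
def Sobolev.pderiv (i : Fin d) (v : Sobolev D (k + 1) p X) : Sobolev D k p X :=
  Sobolev.ofCoef k (fun α => ((α i : ℝ) + 1) • v.coef (α + Pi.single i 1)) (by
    intro α j hα
    have h := (v.isWeakPartial_coef (α := α + Pi.single i 1) j
      (by rw [sum_add_single]; omega)).lp_smul ((α i : ℝ) + 1)
    rw [smul_smul] at h ⊢
    -- Both orders of shifting produce the same weight `(α + e_i + e_j)! / α!`.
    have h1 : ((α i : ℝ) + 1) * (((α + Pi.single i 1 : Fin d → ℕ) j : ℝ) + 1) =
        ((α j : ℝ) + 1) * (((α + Pi.single j 1 : Fin d → ℕ) i : ℝ) + 1) := by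
      by_cases hij : i = j
      · subst hij; simp
      · simp [hij, Ne.symm hij, mul_comm]
    rw [add_right_comm α, h1] at h
    exact h)

theorem Sobolev.toLp_pderiv (i : Fin d) (v : Sobolev D (k + 1) p X) :
    (v.pderiv i).toLp = v.coef (Pi.single i 1) := by
  rw [Sobolev.pderiv, Sobolev.toLp_ofCoef]
  simp

theorem Sobolev.norm_pderiv_le (i : Fin d) (v : Sobolev D (k + 1) p X) :
    ‖v.pderiv i‖ ≤ (k + 1) * ‖v‖ := by
  rw [Sobolev.pderiv, Sobolev.norm_ofCoef, v.norm_eq_sum_coef, Finset.mul_sum]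
  calc ∑ α ∈ multiIdx d k, ‖((α i : ℝ) + 1) • v.coef (α + Pi.single i 1)‖
      ≤ ∑ α ∈ multiIdx d k, ((k : ℝ) + 1) * ‖v.coef (α + Pi.single i 1)‖ := by
        refine Finset.sum_le_sum fun α hα => ?_
        rw [norm_smul, Real.norm_of_nonneg (by positivity)]
        have h1 : α i ≤ k := (Finset.single_le_sum (f := α) (fun j _ => Nat.zero_le _)
          (Finset.mem_univ i)).trans (mem_multiIdx.mp hα)
        gcongr
    _ = ∑ β ∈ (multiIdx d k).map (addRightEmbedding (Pi.single i 1)),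
          ((k : ℝ) + 1) * ‖v.coef β‖ := by
        rw [Finset.sum_map]; rfl
    _ ≤ _ := by
        refine Finset.sum_le_sum_of_subset_of_nonneg ?_ fun _ _ _ => by positivity
        intro β hβ
        obtain ⟨α, hα, rfl⟩ := Finset.mem_map.mp hβ
        rw [mem_multiIdx] at hα ⊢
        rw [addRightEmbedding_apply, sum_add_single]
        omega

/-- The weak partial derivative as a continuous linear map. -/
def Sobolev.pderivL [CompleteSpace X] (i : Fin d) :
    Sobolev D (k + 1) p X →L[ℝ] Sobolev D k p X :=
  LinearMap.mkContinuous
    { toFun := Sobolev.pderiv i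
      map_add' := fun v w => Sobolev.ext_toLp (by
        rw [Sobolev.toLp_add, Sobolev.toLp_pderiv, Sobolev.toLp_pderiv, Sobolev.toLp_pderiv,
          Sobolev.coef_add])
      map_smul' := fun c v => Sobolev.ext_toLp (by
        rw [Sobolev.toLp_smul, Sobolev.toLp_pderiv, Sobolev.toLp_pderiv, Sobolev.coef_smul]
        rfl) } (k + 1) (Sobolev.norm_pderiv_le i)

theorem Sobolev.pderivL_apply [CompleteSpace X] (i : Fin d) (v : Sobolev D (k + 1) p X) :
    Sobolev.pderivL i v = v.pderiv i := rfl

/-- The inclusion `W^{k,p} ⊆ W^{l,p}` for `l ≤ k`. -/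
def Sobolev.restrictL [CompleteSpace X] {l : ℕ} (hl : l ≤ k) :
    Sobolev D k p X →L[ℝ] Sobolev D l p X :=
  LinearMap.mkContinuous
    { toFun := fun v => Sobolev.ofCoef l v.coef fun α i h => v.isWeakPartial_coef i (by omega)
      map_add' := fun v w => Sobolev.ext_toLp (by
        rw [Sobolev.toLp_add, Sobolev.toLp_ofCoef, Sobolev.toLp_ofCoef, Sobolev.toLp_ofCoef,
          Sobolev.coef_add])
      map_smul' := fun c v => Sobolev.ext_toLp (by
        rw [Sobolev.toLp_smul, Sobolev.toLp_ofCoef, Sobolev.toLp_ofCoef, Sobolev.coef_smul]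
        rfl) } 1 (fun v => by
    rw [one_mul, v.norm_eq_sum_coef]
    refine (Sobolev.norm_ofCoef fun α i h => v.isWeakPartial_coef i (by omega)).le.trans ?_
    refine Finset.sum_le_sum_of_subset_of_nonneg ?_ fun _ _ _ => norm_nonneg _
    intro α hα
    rw [mem_multiIdx] at hα ⊢
    omega)

theorem Sobolev.coef_restrictL [CompleteSpace X] {l : ℕ} (hl : l ≤ k) (v : Sobolev D k p X)
    {α : Fin d → ℕ} (hα : ∑ j, α j ≤ l) : (Sobolev.restrictL hl v).coef α = v.coef α :=
  Sobolev.coef_ofCoef (fun _ i _ => v.isWeakPartial_coef i (by omega)) hα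

theorem Sobolev.toLp_restrictL [CompleteSpace X] {l : ℕ} (hl : l ≤ k) (v : Sobolev D k p X) :
    (Sobolev.restrictL hl v).toLp = v.toLp :=
  (Sobolev.toLp_ofCoef fun _ i _ => v.isWeakPartial_coef i (by omega)).trans v.coef_zero_eq

theorem memLp_test (φ : 𝓓(D, ℝ)) : MemLp φ p (vol D) :=
  (φ.contDiff.continuous.memLp_of_hasCompactSupport φ.hasCompactSupport).restrict _

/-- A test function as an element of a Sobolev space. -/
def Sobolev.ofTest (φ : 𝓓(D, ℝ)) : Sobolev D k p ℝ :=
  Sobolev.ofCoef k (fun α => (1 / (multiFact α : ℝ)) • (memLp_test (testDeriv α φ)).toLp _) (by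
    intro α i _
    have h : IsWeakPartial D i ((memLp_test (p := p) (testDeriv α φ)).toLp _)
        ((memLp_test (p := p) (testDeriv (α + Pi.single i 1) φ)).toLp _) := by
      refine (isWeakPartial_test (testDeriv α φ) i).congr (MemLp.coeFn_toLp _).symm ?_
      rw [testDeriv_add_single]
      exact (MemLp.coeFn_toLp _).symm
    have h1 := h.lp_smul (1 / (multiFact α : ℝ))
    convert h1 using 3
    rw [smul_smul, multiFact_add_single]
    congr 1
    have := (multiFact_pos α).ne'
    field_simp)

theorem Sobolev.toLp_ofTest (φ : 𝓓(D, ℝ)) :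
    (Sobolev.ofTest φ : Sobolev D k p ℝ).toLp =ᵐ[vol D] φ := by
  rw [Sobolev.ofTest, Sobolev.toLp_ofCoef]
  have h : (1 / (multiFact (0 : Fin d → ℕ) : ℝ)) = 1 := by simp [multiFact]
  rw [h, one_smul]
  refine (MemLp.coeFn_toLp (memLp_test (p := p) (testDeriv 0 φ))).trans ?_
  rw [testDeriv_zero]

/-- Uniqueness of weak derivatives forces `v` to be `Sobolev.ofTest φ`, whose derivatives are the
classical ones. -/
theorem coef_single_of_test {v : Sobolev D (k + 1) p ℝ} {φ : 𝓓(D, ℝ)} (h : v.toLp =ᵐ[vol D] φ)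
    (i : Fin d) : v.coef (Pi.single i 1) =ᵐ[vol D] (∂_{unitVec i} φ : 𝓓(D, ℝ)) := by
  have h1 : v = Sobolev.ofTest φ :=
    Sobolev.ext_toLp (Lp.ext (h.trans (Sobolev.toLp_ofTest φ).symm))
  rw [h1, Sobolev.ofTest, Sobolev.coef_ofCoef _ (by simp)]
  have h2 : (1 / (multiFact (Pi.single i 1 : Fin d → ℕ) : ℝ)) = 1 := by
    have := multiFact_add_single (0 : Fin d → ℕ) i
    rw [zero_add] at this
    rw [this]
    simp [multiFact]
  rw [h2, one_smul]
  refine (MemLp.coeFn_toLp (memLp_test (p := p) (testDeriv (Pi.single i 1) φ))).trans ?_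
  have h3 := testDeriv_add_single 0 i φ
  rw [zero_add, testDeriv_zero] at h3
  rw [h3]

end Derivatives

/-! ### The elliptic operator -/

section Elliptic

open Filter Topology

variable {d m : ℕ} {D : Opens (Vec d)}

/-- Multiplication by the entry `A_{ij}`. -/
def entryL (i j : Fin d) : Mat d →L[ℝ] ℝ →L[ℝ] ℝ :=
  LinearMap.mkContinuous₂ (LinearMap.mk₂ ℝ (fun A t => A (unitVec j) i * t)
    (fun A A' t => by simp [add_mul]) (fun c A t => by simp [mul_assoc])
    (fun A t t' => mul_add _ _ _) (fun c A t => by simp [mul_left_comm])) 1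
    (fun A t => by
      rw [one_mul, LinearMap.mk₂_apply, norm_mul]
      refine mul_le_mul_of_nonneg_right ?_ (norm_nonneg _)
      refine (PiLp.norm_apply_le _ i).trans ((A.le_opNorm _).trans ?_)
      simp [unitVec])

theorem entryL_apply (i j : Fin d) (A : Mat d) (t : ℝ) :
    entryL i j A t = A (unitVec j) i * t := rfl

theorem norm_entryL_le (i j : Fin d) : ‖entryL i j‖ ≤ 1 :=
  LinearMap.mkContinuous₂_norm_le _ zero_le_one _

/-- The `i`-th component of the flux `A ∇w`. -/
def flux (A : Sobolev D (m + 1) ∞ (Mat d)) (w : Sobolev D (m + 2) 2 ℝ) (i : Fin d) :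
    Sobolev D (m + 1) 2 ℝ :=
  ∑ j, Sobolev.bilinL (entryL i j) A (w.pderiv j)

theorem norm_flux_le (A : Sobolev D (m + 1) ∞ (Mat d)) (w : Sobolev D (m + 2) 2 ℝ) (i : Fin d) :
    ‖flux A w i‖ ≤ d * (m + 2) * ‖A‖ * ‖w‖ := by
  refine (norm_sum_le _ _).trans ?_
  calc ∑ j, ‖Sobolev.bilinL (entryL i j) A (w.pderiv j)‖
      ≤ ∑ _j : Fin d, (m + 2) * ‖A‖ * ‖w‖ := by
        refine Finset.sum_le_sum fun j _ => ?_
        refine (Sobolev.norm_bilin_le (entryL i j) A (w.pderiv j)).trans ?_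
        have h1 := norm_entryL_le i j
        have h2 := w.norm_pderiv_le j
        push_cast at h2
        calc ‖entryL i j‖ * ‖A‖ * ‖w.pderiv j‖ ≤ 1 * ‖A‖ * ((m + 1 + 1) * ‖w‖) := by gcongr
          _ = _ := by ring
    _ = _ := by simp; ring

/-- The operator `w ↦ -div (A ∇w)`, as a continuous bilinear map. -/
def ellipticOp (D : Opens (Vec d)) (m : ℕ) : Sobolev D (m + 1) ∞ (Mat d) →L[ℝ]
    Sobolev D (m + 2) 2 ℝ →L[ℝ] Sobolev D m 2 ℝ :=
  LinearMap.mkContinuous₂ (LinearMap.mk₂ ℝ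
    (fun A w => -∑ i, Sobolev.pderivL i (flux A w i))
    (fun A A' w => by
      simp only [flux, map_add, add_apply, Finset.sum_add_distrib, neg_add])
    (fun c A w => by
      simp only [flux, map_smul, smul_apply, ← Finset.smul_sum, smul_neg])
    (fun A w w' => by
      simp only [flux, ← Sobolev.pderivL_apply, map_add, Finset.sum_add_distrib, neg_add])
    (fun c A w => by
      simp only [flux, ← Sobolev.pderivL_apply, map_smul, ← Finset.smul_sum, smul_neg]))
    -- The matrix has `d²` entries; the inner derivative costs a factor `m + 2` and the divergence a
    -- factor `m + 1`.
    (d ^ 2 * ((m + 1) * (m + 2)))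
    (fun A w => by
      refine (norm_neg _).le.trans ((norm_sum_le _ _).trans ?_)
      calc ∑ i, ‖Sobolev.pderivL i (flux A w i)‖
          ≤ ∑ _i : Fin d, ((m : ℝ) + 1) * (d * (m + 2) * ‖A‖ * ‖w‖) := by
            refine Finset.sum_le_sum fun i _ => ?_
            rw [Sobolev.pderivL_apply]
            refine ((flux A w i).norm_pderiv_le i).trans ?_
            have := norm_flux_le A w i
            gcongr
        _ = _ := by simp; ring)

theorem ellipticOp_apply (A : Sobolev D (m + 1) ∞ (Mat d)) (w : Sobolev D (m + 2) 2 ℝ) :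
    ellipticOp D m A w = -∑ i, (flux A w i).pderiv i := rfl

theorem norm_ellipticOp_le : ‖ellipticOp D m‖ ≤ d ^ 2 * ((m + 1) * (m + 2)) :=
  LinearMap.mkContinuous₂_norm_le _ (by positivity) _

theorem grad_ae (v : Sobolev D 1 2 ℝ) :
    ∀ᵐ x ∂vol D, ∀ i, grad v x i = v.coef (Pi.single i 1) x := by
  refine ae_of_all _ fun x i => ?_
  change v.deriv ⟨Pi.single i 1, _⟩ x = _
  rw [v.coef_of_mem (single_mem_multiIdx le_rfl i)]
  have h2 : (1 / (multiFact (Pi.single i 1 : Fin d → ℕ) : ℝ)) = 1 := by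
    have := multiFact_add_single (0 : Fin d → ℕ) i
    rw [zero_add] at this
    rw [this]
    simp [multiFact]
  rw [h2, one_smul]

theorem toLp_flux (A : Sobolev D (m + 1) ∞ (Mat d)) (w : Sobolev D (m + 2) 2 ℝ) :
    ∀ᵐ x ∂vol D, ∀ i, (flux A w i).toLp x =
      A.toLp x (grad (Sobolev.restrictL (by omega) w) x) i := by
  rw [ae_all_iff]
  intro i
  have h1 : ∀ᵐ x ∂vol D, ∀ j, (Sobolev.bilin (entryL i j) A (w.pderiv j)).toLp x =
      entryL i j (A.toLp x) ((w.pderiv j).toLp x) :=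
    ae_all_iff.mpr fun j => Sobolev.toLp_bilin_ae (entryL i j) A (w.pderiv j)
  have h2 : (flux A w i).toLp = ∑ j, (Sobolev.bilin (entryL i j) A (w.pderiv j)).toLp := by
    rw [← Sobolev.toLpL_apply, flux, map_sum]
    simp only [Sobolev.toLpL_apply, Sobolev.bilinL_apply]
  filter_upwards [h1, grad_ae (Sobolev.restrictL (by omega) w),
    Lp.coeFn_finsetSum Finset.univ fun j => (Sobolev.bilin (entryL i j) A (w.pderiv j)).toLp]
    with x h1 h3 h4
  rw [h2, h4, Finset.sum_apply]
  set g := grad (Sobolev.restrictL (by omega) w) x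
  have h5 : g = ∑ j, g j • unitVec j := by
    ext l
    simp [unitVec, Finset.sum_apply, Pi.single_apply]
  have h6 : A.toLp x g i = ∑ j, g j * A.toLp x (unitVec j) i := by
    conv_lhs => rw [h5]
    simp
  rw [h6]
  refine Finset.sum_congr rfl fun j _ => ?_
  rw [h1 j, entryL_apply, Sobolev.toLp_pderiv, h3 j,
    Sobolev.coef_restrictL _ _ (by simp), mul_comm]

/-- The Dirichlet form in terms of the flux. -/
theorem integral_inner_eq_sum (A : Sobolev D (m + 1) ∞ (Mat d)) (w : Sobolev D (m + 2) 2 ℝ)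
    (v : Sobolev D 1 2 ℝ) :
    ∫ x, inner ℝ (A.toLp x (grad (Sobolev.restrictL (by omega) w) x)) (grad v x) ∂vol D =
      ∑ i, inner ℝ ((flux A w i).toLp) (v.coef (Pi.single i 1)) := by
  simp only [L2.inner_def]
  rw [← integral_finsetSum _ fun i _ => L2.integrable_inner _ _]
  refine integral_congr_ae ?_
  filter_upwards [toLp_flux A w, grad_ae v] with x h1 h2
  rw [PiLp.inner_apply]
  exact Finset.sum_congr rfl fun i _ => by rw [h1 i, h2 i]

/-- Both sides are continuous in `v`, so by the definition of `H10` as a closure `v` may be taken to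
be a test function. There the identity is the definition of the weak derivative of the flux. -/
theorem sum_inner_flux_eq (A : Sobolev D (m + 1) ∞ (Mat d)) (w : Sobolev D (m + 2) 2 ℝ)
    {v : Sobolev D 1 2 ℝ} (hv : v ∈ H10 D) :
    ∑ i, inner ℝ ((flux A w i).toLp) (v.coef (Pi.single i 1)) =
      inner ℝ (ellipticOp D m A w).toLp v.toLp := by
  let s : Set (Sobolev D 1 2 ℝ) := {v | ∑ i, inner ℝ ((flux A w i).toLp)
      (Sobolev.coefL (Pi.single i 1) v) = inner ℝ (ellipticOp D m A w).toLp
        (Sobolev.toLpL v)}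
  have hcl : IsClosed s := by
    refine isClosed_eq ?_ ?_ <;> fun_prop
  suffices h : v ∈ s by
    simpa only [s, mem_ofPred_eq, Sobolev.coefL_apply, Sobolev.toLpL_apply] using h
  refine closure_minimal ?_ hcl hv
  rintro v ⟨φ, hφ⟩
  simp only [s, mem_ofPred_eq, Sobolev.coefL_apply, Sobolev.toLpL_apply]
  have h1 : (ellipticOp D m A w).toLp = -∑ i, ((flux A w i).pderiv i).toLp := by
    rw [← Sobolev.toLpL_apply, ellipticOp_apply, map_neg, map_sum]
    simp only [Sobolev.toLpL_apply]
  rw [h1, inner_neg_left, sum_inner, ← Finset.sum_neg_distrib]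
  refine Finset.sum_congr rfl fun i _ => ?_
  have h2 := (flux A w i).isWeakPartial_coef (α := 0) i (by simp) φ
  rw [Sobolev.coef_zero_eq] at h2
  have h3 : (((0 : Fin d → ℕ) i : ℝ) + 1) • (flux A w i).coef (0 + Pi.single i 1) =
      ((flux A w i).pderiv i).toLp := by
    rw [Sobolev.toLp_pderiv]; simp
  rw [h3] at h2
  simp only [L2.inner_def]
  calc _ = ∫ x, (∂_{unitVec i} φ : 𝓓(D, ℝ)) x • (flux A w i).toLp x ∂vol D := by
        refine integral_congr_ae ?_
        filter_upwards [coef_single_of_test hφ i] with x hx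
        rw [hx]; simp
    _ = -∫ x, φ x • ((flux A w i).pderiv i).toLp x ∂vol D := h2
    _ = _ := by
        congr 1
        refine integral_congr_ae ?_
        filter_upwards [hφ] with x hx
        rw [hx]; simp

theorem ofTest_mem_H10 (φ : 𝓓(D, ℝ)) : (Sobolev.ofTest φ : Sobolev D 1 2 ℝ) ∈ H10 D :=
  subset_closure ⟨φ, Sobolev.toLp_ofTest φ⟩

/-- For regular `w` the variational problem is an equation in `H^m`: the fundamental lemma of the
calculus of variations gives one direction, integration by parts the other. -/
theorem isWeakSolution_iff (A : Sobolev D (m + 1) ∞ (Mat d)) (w : Sobolev D (m + 2) 2 ℝ)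
    (h : Sobolev D m 2 ℝ) :
    IsWeakSolution D A.toLp h.toLp (Sobolev.restrictL (by omega) w) ↔
      (Sobolev.restrictL (by omega) w : Sobolev D 1 2 ℝ) ∈ H10 D ∧ ellipticOp D m A w = h := by
  have hint : ∀ v : Sobolev D 1 2 ℝ,
      ∫ x, h.toLp x * v.toLp x ∂vol D = inner ℝ h.toLp v.toLp := by
    intro v
    rw [L2.inner_def]
    exact integral_congr_ae (ae_of_all _ fun x => by simp [mul_comm])
  unfold IsWeakSolution
  refine and_congr_right fun _ => ⟨fun hw => ?_, fun hw v hv => ?_⟩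
  · refine Sobolev.ext_toLp (Lp.ext (ae_eq_of_test (locInt_lp _) (locInt_lp _) fun φ => ?_))
    have h1 := hw _ (ofTest_mem_H10 φ)
    rw [integral_inner_eq_sum, sum_inner_flux_eq A w (ofTest_mem_H10 φ), hint] at h1
    have h2 : ∀ g : Lp ℝ 2 (vol D), inner ℝ g (Sobolev.ofTest φ : Sobolev D 1 2 ℝ).toLp =
        ∫ x, φ x • g x ∂vol D := by
      intro g
      rw [L2.inner_def]
      refine integral_congr_ae ?_
      filter_upwards [Sobolev.toLp_ofTest (k := 1) (p := 2) φ] with x hx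
      rw [hx]; simp
    rw [← h2, ← h2]
    exact h1
  · rw [integral_inner_eq_sum, sum_inner_flux_eq A w hv, hint, hw]

/-! ### Elliptic regularity as invertibility of an operator -/

/-- `H_0^1(D)` as a subspace of `H^1(D)`. -/
def H10Sub (D : Opens (Vec d)) : Submodule ℝ (Sobolev D 1 2 ℝ) :=
  Submodule.topologicalClosure
    { carrier := {v | ∃ φ : 𝓓(D, ℝ), v.toLp =ᵐ[vol D] φ}
      zero_mem' := ⟨0, by
        have : (0 : Sobolev D 1 2 ℝ).toLp = 0 := rfl
        rw [this]
        exact Lp.coeFn_zero _ _ _⟩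
      add_mem' := by
        rintro v w ⟨φ, hφ⟩ ⟨χ, hχ⟩
        refine ⟨φ + χ, ?_⟩
        rw [Sobolev.toLp_add]
        filter_upwards [Lp.coeFn_add v.toLp w.toLp, hφ, hχ] with x h1 h2 h3
        rw [h1, Pi.add_apply, h2, h3]
        rfl
      smul_mem' := by
        rintro c v ⟨φ, hφ⟩
        refine ⟨c • φ, ?_⟩
        rw [Sobolev.toLp_smul]
        filter_upwards [Lp.coeFn_smul c v.toLp, hφ] with x h1 h2
        rw [h1, Pi.smul_apply, h2]
        rfl }

/-- The space `H^{m+2}(D) ∩ H_0^1(D)`. -/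
def regSub (D : Opens (Vec d)) (m : ℕ) : Submodule ℝ (Sobolev D (m + 2) 2 ℝ) :=
  (H10Sub D).comap (Sobolev.restrictL (by omega : 1 ≤ m + 2)).toLinearMap

instance : CompleteSpace (regSub D m) := by
  have : IsClosed (regSub D m : Set (Sobolev D (m + 2) 2 ℝ)) :=
    (Submodule.isClosed_topologicalClosure _).preimage
      (Sobolev.restrictL (by omega : 1 ≤ m + 2)).continuous
  exact this.completeSpace_coe

/-- The elliptic operator on `H^{m+2}(D) ∩ H_0^1(D)`. -/
def dirichletOp (D : Opens (Vec d)) (m : ℕ) : Sobolev D (m + 1) ∞ (Mat d) →L[ℝ]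
    regSub D m →L[ℝ] Sobolev D m 2 ℝ :=
  LinearMap.mkContinuous₂ (LinearMap.mk₂ ℝ
    (fun A (w : regSub D m) => ellipticOp D m A w)
    (fun A A' w => by rw [map_add, add_apply]) (fun c A w => by rw [map_smul, smul_apply])
    (fun A w w' => by rw [Submodule.coe_add, map_add])
    (fun c A w => by rw [Submodule.coe_smul, map_smul])) (d ^ 2 * ((m + 1) * (m + 2)))
    (fun A w => ((ellipticOp D m).le_opNorm₂ A w).trans (by
      have := norm_ellipticOp_le (D := D) (m := m)
      have h2 : ‖(w : Sobolev D (m + 2) 2 ℝ)‖ = ‖w‖ := rfl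
      rw [h2]
      gcongr))

theorem norm_dirichletOp_le : ‖dirichletOp D m‖ ≤ d ^ 2 * ((m + 1) * (m + 2)) :=
  LinearMap.mkContinuous₂_norm_le _ (by positivity) _

/-- Elliptic regularity makes the Dirichlet operator invertible. -/
theorem EllipticRegularity.dirichletOp {aLow aUp : ℝ} {R : Type*} [NormedAddCommGroup R]
    [NormedSpace ℝ R] {ι : R →ₗ[ℝ] (Vec d →ₘ[vol D] Mat d)} {Cer : ℝ → ℝ}
    (hEr : EllipticRegularity D (m + 1) aLow aUp ι Cer) (A : Sobolev D (m + 1) ∞ (Mat d)) (r : R)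
    (hr : ι r =ᵐ[vol D] A.toLp) (hA : UniformlyElliptic D aLow aUp A.toLp) :
    Function.Surjective (dirichletOp D m A) ∧
      ∀ w, ‖w‖ ≤ Cer ‖r‖ * ‖AnisoDiff.dirichletOp D m A w‖ := by
  have key : ∀ h : Sobolev D m 2 ℝ, ∃ w : regSub D m, AnisoDiff.dirichletOp D m A w = h ∧
      ‖w‖ ≤ Cer ‖r‖ * ‖h‖ ∧ ∀ w', AnisoDiff.dirichletOp D m A w' = h → w' = w := by
    intro h
    obtain ⟨u, hu, huniq, w, hw, hn⟩ := hEr.2 A r hr hA h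
    have hwu : Sobolev.restrictL (by omega) w = u :=
      Sobolev.ext_toLp ((Sobolev.toLp_restrictL _ _).trans hw)
    subst hwu
    have h1 := (isWeakSolution_iff A w h).mp hu
    refine ⟨⟨w, h1.1⟩, h1.2, hn, fun w' hw' => Subtype.ext (Sobolev.ext_toLp ?_)⟩
    have h2 := huniq _ ((isWeakSolution_iff A w' h).mpr ⟨w'.2, hw'⟩)
    rw [← Sobolev.toLp_restrictL (by omega : 1 ≤ m + 2), h2, Sobolev.toLp_restrictL]
  refine ⟨fun h => ?_, fun w => ?_⟩
  · obtain ⟨w, hw, -⟩ := key h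
    exact ⟨w, hw⟩
  -- Take the image of `w` itself as right-hand side: uniqueness identifies the regular solution
  -- with `w`, and the regularity estimate becomes a lower bound for the operator.
  · obtain ⟨w', -, hn, huniq⟩ := key (AnisoDiff.dirichletOp D m A w)
    rw [huniq w rfl]
    rwa [← huniq w rfl] at hn ⊢

end Elliptic

/-! ### Families of invertible operators -/

section Inverse

open Filter Topology
open scoped Nat

variable {X Y : Type*} [NormedAddCommGroup X] [NormedSpace ℝ X] [NormedAddCommGroup Y]
  [NormedSpace ℝ Y]

theorem isInvertible_of_bound {T : X →L[ℝ] Y} {C : ℝ} (hC : 0 ≤ C)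
    (hs : Function.Surjective T) (hb : ∀ w, ‖w‖ ≤ C * ‖T w‖) :
    T.IsInvertible ∧ ‖T.inverse‖ ≤ C := by
  have hi : Function.Injective T := by
    refine (injective_iff_map_eq_zero T).mpr fun w hw => ?_
    have := hb w
    rw [hw, norm_zero, mul_zero] at this
    exact norm_le_zero_iff.mp this
  let e : X ≃L[ℝ] Y := (LinearEquiv.ofBijective T.toLinearMap ⟨hi, hs⟩).toContinuousLinearEquivOfBounds
    ‖T‖ C (fun w => T.le_opNorm w) (fun z => by
      have h1 := hb ((LinearEquiv.ofBijective T.toLinearMap ⟨hi, hs⟩).symm z)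
      have h2 : T ((LinearEquiv.ofBijective T.toLinearMap ⟨hi, hs⟩).symm z) = z :=
        (LinearEquiv.ofBijective T.toLinearMap ⟨hi, hs⟩).apply_symm_apply z
      rwa [h2] at h1)
  have he : (e : X →L[ℝ] Y) = T := rfl
  have hinv : T.IsInvertible := ⟨e, he⟩
  refine ⟨hinv, ContinuousLinearMap.opNorm_le_bound _ hC fun z => ?_⟩
  have := hb (T.inverse z)
  rwa [hinv.self_apply_inverse] at this

/-- A uniform bound for the inverses on a dense set extends to the whole set. -/
theorem isInvertible_of_dense [CompleteSpace X] {E : Type*} [TopologicalSpace E]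
    {T : E → X →L[ℝ] Y} {K S : Set E} (hT : ContinuousOn T K) (hSK : S ⊆ K) (hd : K ⊆ closure S)
    {C : ℝ} (hC : 0 ≤ C)
    (hb : ∀ s ∈ S, Function.Surjective (T s) ∧ ∀ w, ‖w‖ ≤ C * ‖T s w‖) {y : E} (hy : y ∈ K) :
    (T y).IsInvertible ∧ ‖(T y).inverse‖ ≤ C := by
  have hne : (𝓝[S] y).NeBot := mem_closure_iff_nhdsWithin_neBot.mp (hd hy)
  have hlim : Tendsto T (𝓝[S] y) (𝓝 (T y)) := (hT y hy).mono hSK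
  have hbound : ∀ w, ‖w‖ ≤ C * ‖T y w‖ := by
    intro w
    have h1 : Tendsto (fun s => C * ‖T s w‖) (𝓝[S] y) (𝓝 (C * ‖T y w‖)) :=
      ((((ContinuousLinearMap.apply ℝ Y w).continuous.tendsto (T y)).comp hlim).norm).const_mul C
    exact ge_of_tendsto h1 (eventually_of_mem self_mem_nhdsWithin fun s hs => (hb s hs).2 w)
  -- For `s` in the dense set close enough to `y`, `T y = T s (1 - δ)` with `‖δ‖ < 1`, and a Neumann
  -- series gives surjectivity. It is essential that `C` does not depend on `s`.
  have hsmall : ∀ᶠ s in 𝓝[S] y, C * ‖T s - T y‖ < 1 := by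
    have h1 : Tendsto (fun s => C * ‖T s - T y‖) (𝓝[S] y) (𝓝 (C * ‖T y - T y‖)) :=
      ((hlim.sub_const (T y)).norm).const_mul C
    rw [sub_self, norm_zero, mul_zero] at h1
    exact h1.eventually_lt_const one_pos
  obtain ⟨s, hs1, hs⟩ := (hsmall.and self_mem_nhdsWithin).exists
  obtain ⟨hinv, hCs⟩ := isInvertible_of_bound hC (hb s hs).1 (hb s hs).2
  set δ : X →L[ℝ] X := (T s).inverse ∘L (T s - T y) with hδ
  have hδn : ‖δ‖ < 1 := by
    refine (ContinuousLinearMap.opNorm_comp_le _ _).trans_lt (lt_of_le_of_lt ?_ hs1)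
    gcongr
  obtain ⟨v, hv⟩ := isUnit_one_sub_of_norm_lt_one hδn
  have hTy : ∀ w, T s ((1 - δ) w) = T y w := by
    intro w
    change T s (w - δ w) = _
    rw [map_sub, hδ, ContinuousLinearMap.comp_apply, hinv.self_apply_inverse]
    change T s w - (T s w - T y w) = _
    abel
  refine isInvertible_of_bound hC (fun z => ?_) hbound
  refine ⟨(v⁻¹ : (X →L[ℝ] X)ˣ).val ((T s).inverse z), ?_⟩
  rw [← hTy, ← hv]
  have h3 : (v : X →L[ℝ] X) ((v⁻¹ : (X →L[ℝ] X)ˣ).val ((T s).inverse z)) = (T s).inverse z := by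
    have := v.mul_inv
    exact congrArg (fun L : X →L[ℝ] X => L ((T s).inverse z)) this
  rw [h3, hinv.self_apply_inverse]

/-! ### Smoothness and derivative bounds of the inverse -/

variable {E W : Type*} [NormedAddCommGroup E] [NormedSpace ℝ E] [NormedAddCommGroup W]
  [NormedSpace ℝ W]

/-- The points of `Ω` at which the operator is invertible. -/
def invDomain (ℒ : W →L[ℝ] X →L[ℝ] Y) (b : W) (𝒜 : E → W) (Ω : Set E) : Set E :=
  Ω ∩ (fun v => ℒ (b + 𝒜 v)) ⁻¹' {T | T.IsInvertible}

section

variable {ℒ : W →L[ℝ] X →L[ℝ] Y} {b : W} {𝒜 : E → W} {Ω : Set E}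

theorem contDiffOn_operator (h𝒜 : ContDiffOn ℝ (⊤ : ℕ∞) 𝒜 Ω) :
    ContDiffOn ℝ (⊤ : ℕ∞) (fun v => ℒ (b + 𝒜 v)) Ω :=
  ℒ.contDiff.comp_contDiffOn (contDiffOn_const.add h𝒜)

theorem isOpen_invDomain [CompleteSpace X] (hΩ : IsOpen Ω) (h𝒜 : ContDiffOn ℝ (⊤ : ℕ∞) 𝒜 Ω) :
    IsOpen (invDomain ℒ b 𝒜 Ω) :=
  (contDiffOn_operator h𝒜).continuousOn.isOpen_inter_preimage hΩ
    (ContinuousLinearEquiv.isOpen (𝕜 := ℝ) (E := X) (F := Y))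

theorem contDiffOn_inverse [CompleteSpace X] (h𝒜 : ContDiffOn ℝ (⊤ : ℕ∞) 𝒜 Ω) :
    ContDiffOn ℝ (⊤ : ℕ∞) (fun v => (ℒ (b + 𝒜 v)).inverse) (invDomain ℒ b 𝒜 Ω) := by
  intro v hv
  have h1 : ContDiffAt ℝ (⊤ : ℕ∞) ContinuousLinearMap.inverse (ℒ (b + 𝒜 v)) :=
    ContinuousLinearMap.IsInvertible.contDiffAt_map_inverse hv.2
  exact h1.comp_contDiffWithinAt v
    (((contDiffOn_operator h𝒜) v hv.1).mono inter_subset_left)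

/-- Derivative bounds for the inverse operator. -/
theorem derivBound_inverse [CompleteSpace X] (hΩ : IsOpen Ω) (h𝒜 : ContDiffOn ℝ (⊤ : ℕ∞) 𝒜 Ω)
    {x : E} (hx : x ∈ invDomain ℒ b 𝒜 Ω) {N k τ C : ℝ} (hN : ‖ℒ‖ ≤ N) (hτ : 0 ≤ τ)
    (hk : DerivBound 𝒜 x k τ) (hC : ‖(ℒ (b + 𝒜 x)).inverse‖ ≤ C) :
    DerivBound (fun v => (ℒ (b + 𝒜 v)).inverse) x C ((1 + C * (N * k)) * τ) := by
  set g : E → (Y →L[ℝ] X) := fun v => (ℒ (b + 𝒜 v)).inverse with hg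
  have hC0 : 0 ≤ C := (norm_nonneg _).trans hC
  have hN0 : 0 ≤ N := (norm_nonneg _).trans hN
  have hs := isOpen_invDomain (ℒ := ℒ) (b := b) hΩ h𝒜
  have h𝒜' : ContDiffOn ℝ (⊤ : ℕ∞) 𝒜 (invDomain ℒ b 𝒜 Ω) := h𝒜.mono inter_subset_left
  have hℒ𝒜 : ContDiffOn ℝ (⊤ : ℕ∞) (fun v => ℒ (𝒜 v)) (invDomain ℒ b 𝒜 Ω) :=
    ℒ.contDiff.comp_contDiffOn h𝒜'
  -- The resolvent identity `g(y) = g(x) - g(y) (L_y - L_x) g(x)` in the form needed for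
  -- `DerivBound.of_perturbation`. The fixed factor `g(x)` is built into `Q`, and the constant `b`
  -- drops out of the difference.
  let Q : (Y →L[ℝ] X) →L[ℝ] (X →L[ℝ] Y) →L[ℝ] (Y →L[ℝ] X) :=
    LinearMap.mkContinuous₂ (LinearMap.mk₂ ℝ
      (fun (S : Y →L[ℝ] X) (δ : X →L[ℝ] Y) => S ∘L (δ ∘L g x))
      (fun S S' δ => ContinuousLinearMap.add_comp _ _ _)
      (fun c S δ => ContinuousLinearMap.smul_comp _ _ _)
      (fun S δ δ' => by rw [ContinuousLinearMap.add_comp, ContinuousLinearMap.comp_add])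
      (fun c S δ => by rw [ContinuousLinearMap.smul_comp, ContinuousLinearMap.comp_smul])) C
      (fun S δ => by
        rw [LinearMap.mk₂_apply]
        refine (ContinuousLinearMap.opNorm_comp_le _ _).trans ?_
        calc ‖S‖ * ‖δ ∘L g x‖ ≤ ‖S‖ * (‖δ‖ * C) := by
              gcongr
              refine (ContinuousLinearMap.opNorm_comp_le _ _).trans ?_
              gcongr
          _ = _ := by ring)
  have hQ : ∀ S δ, Q S δ = S ∘L (δ ∘L g x) := fun _ _ => rfl
  refine DerivBound.of_perturbation Q hs hx (contDiffOn_inverse h𝒜)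
    (Δ := fun v => ℒ (𝒜 v) - ℒ (𝒜 x)) (hℒ𝒜.sub contDiffOn_const)
    (mul_nonneg hN0 hk.nonneg) hτ (LinearMap.mkContinuous₂_norm_le _ hC0 _) hC (sub_self _)
    (fun n hn => ?_) (fun y hy => ?_)
  · have h1 : ContDiffAt ℝ n (fun v => ℒ (𝒜 v)) x :=
      (hℒ𝒜.contDiffAt (hs.mem_nhds hx)).of_le (by exact_mod_cast le_top)
    rw [fun_iteratedFDeriv_sub_apply h1 contDiffAt_const,
      iteratedFDeriv_const_of_ne (Nat.one_le_iff_ne_zero.mp hn), Pi.zero_apply, sub_zero]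
    exact hk.clm ℒ hs hx h𝒜' hN n
  · ext z
    rw [hQ]
    have h1 : ℒ (𝒜 y) - ℒ (𝒜 x) = ℒ (b + 𝒜 y) - ℒ (b + 𝒜 x) := by
      rw [map_add, map_add]; abel
    rw [h1]
    change g y z = g x z - g y (ℒ (b + 𝒜 y) (g x z) - ℒ (b + 𝒜 x) (g x z))
    have h2 : ℒ (b + 𝒜 x) (g x z) = z := ContinuousLinearMap.IsInvertible.self_apply_inverse hx.2 z
    have h3 : g y (ℒ (b + 𝒜 y) (g x z)) = g x z :=
      ContinuousLinearMap.IsInvertible.inverse_apply_self hy.2 _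
    rw [map_sub, h2, h3]
    abel

end

end Inverse

/-! ### Parameter derivatives -/

section Parameter

open Filter Topology
open scoped Nat

variable {M : ℕ} {E F : Type*} [NormedAddCommGroup E] [NormedSpace ℝ E] [NormedAddCommGroup F]
  [NormedSpace ℝ F]

theorem uniqueDiffOn_cube (M : ℕ) : UniqueDiffOn ℝ (cube M) := by
  refine uniqueDiffOn_convex (convex_Icc _ _) ⟨0, ?_⟩
  have h : (univ : Set (Fin M)).pi (fun _ => Ioo (-1 : ℝ) 1) ⊆ cube M := by
    intro y hy
    exact ⟨fun i => (hy i (mem_univ i)).1.le, fun i => (hy i (mem_univ i)).2.le⟩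
  refine interior_maximal h (isOpen_set_pi finite_univ fun i _ => isOpen_Ioo) ?_
  intro i _
  exact ⟨by norm_num, by norm_num⟩

/-- The derivatives along coordinate directions of `g ∘ V` for an affine map `V`. -/
def IsDirDeriv (g : E → F) (V : (Fin M → ℝ) → E) (e : Fin M → E) (χ : (Fin M → ℝ) → F)
    (l : List (Fin M)) : Prop :=
  ∀ y ∈ cube M, χ y = iteratedFDeriv ℝ l.length g (V y) fun j => e (l.get j)

/-- Since `V` is affine, the chain rule creates no extra terms: each parameter derivative inserts
one more fixed direction into the next Fréchet derivative. As `s` is open, `g` is differentiable at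
all `V y`, and unique differentiability of the cube fixes the one-sided derivatives. -/
theorem IsDirDeriv.fderivWithin {g : E → F} {s : Set E} (hs : IsOpen s)
    (hg : ContDiffOn ℝ (⊤ : ℕ∞) g s) {V : (Fin M → ℝ) → E} {V' : (Fin M → ℝ) →L[ℝ] E}
    (hV : ∀ y, HasFDerivAt V V' y) (hVs : ∀ y ∈ cube M, V y ∈ s) {χ : (Fin M → ℝ) → F}
    {l : List (Fin M)} (h : IsDirDeriv g V (fun k => V' (Pi.single k 1)) χ l) (i : Fin M) :
    IsDirDeriv g V (fun k => V' (Pi.single k 1))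
      (fun y => fderivWithin ℝ χ (cube M) y (Pi.single i 1)) (i :: l) := by
  intro y hy
  set e : Fin M → E := fun k => V' (Pi.single k 1)
  have hat : ContDiffAt ℝ (⊤ : ℕ∞) g (V y) := hg.contDiffAt (hs.mem_nhds (hVs y hy))
  have h1 : DifferentiableAt ℝ (iteratedFDeriv ℝ l.length g) (V y) :=
    (hat.differentiableAt_iteratedFDeriv (by exact_mod_cast ENat.natCast_lt_top _))
  have h2 : HasFDerivAt (fun y => iteratedFDeriv ℝ l.length g (V y))
      ((fderiv ℝ (iteratedFDeriv ℝ l.length g) (V y)) ∘L V') y :=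
    h1.hasFDerivAt.comp y (hV y)
  have h3 := (ContinuousMultilinearMap.apply ℝ (fun _ : Fin l.length => E) F
    (fun j => e (l.get j))).hasFDerivAt.comp y h2
  have h4 : HasFDerivWithinAt χ _ (cube M) y :=
    h3.hasFDerivWithinAt.congr (fun z hz => h z hz) (h y hy)
  beta_reduce
  rw [h4.fderivWithin (uniqueDiffOn_cube M y hy)]
  exact (iteratedFDeriv_succ_apply_left (fun j : Fin (l.length + 1) => e ((i :: l).get j))).symm

/-- Only the length of the list and its multiplicities enter the estimate, so the order of the
directions is left unspecified. -/
theorem isDirDeriv_paramDeriv {g : E → F} {s : Set E} (hs : IsOpen s)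
    (hg : ContDiffOn ℝ (⊤ : ℕ∞) g s) {V : (Fin M → ℝ) → E} {V' : (Fin M → ℝ) →L[ℝ] E}
    (hV : ∀ y, HasFDerivAt V V' y) (hVs : ∀ y ∈ cube M, V y ∈ s) (α : Fin M → ℕ) :
    ∃ l : List (Fin M), (∀ k, l.count k = α k) ∧
      IsDirDeriv g V (fun k => V' (Pi.single k 1)) (paramDeriv (cube M) α fun y => g (V y)) l := by
  have hit : ∀ (n : ℕ) (i : Fin M) (χ : (Fin M → ℝ) → F) (l : List (Fin M)),
      IsDirDeriv g V (fun k => V' (Pi.single k 1)) χ l →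
      IsDirDeriv g V (fun k => V' (Pi.single k 1))
        ((fun χ y => fderivWithin ℝ χ (cube M) y (Pi.single i 1))^[n] χ)
        (List.replicate n i ++ l) := by
    intro n i χ l h
    induction n with
    | zero => exact h
    | succ n ih =>
      rw [Function.iterate_succ_apply']
      exact ih.fderivWithin hs hg hV hVs i
  have hfold : ∀ L : List (Fin M), L.Nodup → ∃ l : List (Fin M),
      (∀ k, l.count k = if k ∈ L then α k else 0) ∧
      IsDirDeriv g V (fun k => V' (Pi.single k 1)) (L.foldr (fun i g' =>
        (fun χ y => fderivWithin ℝ χ (cube M) y (Pi.single i 1))^[α i] g') fun y => g (V y)) l := by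
    intro L
    induction L with
    | nil => exact fun _ => ⟨[], by simp, fun y _ => by simp⟩
    | cons i L ih =>
      intro hL
      obtain ⟨hi, hL⟩ := List.nodup_cons.mp hL
      obtain ⟨l, hl, hd⟩ := ih hL
      refine ⟨List.replicate (α i) i ++ l, fun k => ?_, hit _ _ _ _ hd⟩
      rw [List.count_append, hl, List.count_replicate]
      by_cases hk : k = i
      · subst hk; simp [hi]
      · have : (i == k) = false := by simpa using Ne.symm hk
        simp [hk, this]
  obtain ⟨l, hl, hd⟩ := hfold (List.finRange M) (List.nodup_finRange M)
  exact ⟨l, fun k => by rw [hl]; simp, hd⟩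

theorem norm_paramDeriv_le {g : E → F} {s : Set E} (hs : IsOpen s)
    (hg : ContDiffOn ℝ (⊤ : ℕ∞) g s) {V : (Fin M → ℝ) → E} {V' : (Fin M → ℝ) →L[ℝ] E}
    (hV : ∀ y, HasFDerivAt V V' y) (hVs : ∀ y ∈ cube M, V y ∈ s) (α : Fin M → ℕ) :
    ContinuousOn (paramDeriv (cube M) α fun y => g (V y)) (cube M) ∧ ∀ y ∈ cube M,
      ‖paramDeriv (cube M) α (fun y => g (V y)) y‖ ≤
        ‖iteratedFDeriv ℝ (∑ k, α k) g (V y)‖ * ∏ k, ‖V' (Pi.single k 1)‖ ^ α k := by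
  obtain ⟨l, hl, hd⟩ := isDirDeriv_paramDeriv hs hg hV hVs α
  have hlen : l.length = ∑ k, α k := by
    rw [← List.sum_toFinset_count_eq_length, Finset.sum_subset (Finset.subset_univ _)
      fun k _ hk => List.count_eq_zero_of_not_mem (by simpa using hk)]
    exact Finset.sum_congr rfl fun k _ => hl k
  have hprod : ∏ j : Fin l.length, ‖V' (Pi.single (l.get j) 1)‖ =
      ∏ k, ‖V' (Pi.single k 1)‖ ^ α k := by
    have h1 : ∏ j : Fin l.length, ‖V' (Pi.single (l.get j) 1)‖ =
        (l.map fun k => ‖V' (Pi.single k 1)‖).prod := by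
      rw [← List.prod_ofFn]
      congr 1
      conv_rhs => rw [← List.ofFn_get l, List.map_ofFn]
      rfl
    rw [h1, Finset.prod_list_map_count]
    rw [Finset.prod_subset (Finset.subset_univ _) fun k _ hk => ?_]
    · exact Finset.prod_congr rfl fun k _ => by rw [hl]
    · rw [List.mem_toFinset] at hk
      rw [List.count_eq_zero_of_not_mem hk, pow_zero]
  refine ⟨?_, fun y hy => ?_⟩
  · have hVc : Continuous V := continuous_iff_continuousAt.mpr fun y => (hV y).continuousAt
    have h1 : ContinuousOn (fun y => iteratedFDeriv ℝ l.length g (V y)) (cube M) := by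
      have : ContinuousOn (iteratedFDeriv ℝ l.length g) s := fun z hz =>
        ((hg.contDiffAt (hs.mem_nhds hz)).differentiableAt_iteratedFDeriv
          (by exact_mod_cast ENat.natCast_lt_top _)).continuousAt.continuousWithinAt
      exact this.comp hVc.continuousOn hVs
    have h2 := (ContinuousMultilinearMap.apply ℝ (fun _ : Fin l.length => E) F
      (fun j => V' (Pi.single (l.get j) 1))).continuous.comp_continuousOn h1
    exact h2.congr fun y hy => hd y hy
  · rw [hd y hy, ← hprod, ← hlen]
    exact (iteratedFDeriv ℝ l.length g (V y)).le_opNorm _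

end Parameter

/-! ### The law of the parameters -/

section Law

open Filter Topology

variable {M : ℕ}

theorem isProbabilityMeasure_cond_Icc :
    IsProbabilityMeasure (ProbabilityTheory.cond volume (Icc (-1 : ℝ) 1)) :=
  ProbabilityTheory.cond_isProbabilityMeasure_of_finite (by simp) (by simp)

instance : IsProbabilityMeasure (paramLaw M) := by
  have := isProbabilityMeasure_cond_Icc
  unfold paramLaw
  infer_instance

theorem ae_mem_cube : ∀ᵐ y ∂paramLaw M, y ∈ cube M := by
  have := isProbabilityMeasure_cond_Icc
  have h : paramLaw M (cube M) = 1 := by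
    rw [cube, ← pi_univ_Icc, paramLaw, Measure.pi_pi]
    refine Finset.prod_eq_one fun i _ => ?_
    exact ProbabilityTheory.cond_apply_self (by simp) (by simp)
  exact (mem_ae_iff_prob_eq_one measurableSet_Icc).mpr h

theorem cond_Icc_ball_pos {t r : ℝ} (ht : t ∈ Icc (-1 : ℝ) 1) (hr : 0 < r) :
    0 < ProbabilityTheory.cond volume (Icc (-1 : ℝ) 1) (Metric.ball t r) := by
  rw [ProbabilityTheory.cond_apply measurableSet_Icc]
  refine ENNReal.mul_pos (by simp) ?_
  have hsub : Ioo (max (-1) (t - r)) (min 1 (t + r)) ⊆ Icc (-1) 1 ∩ Metric.ball t r := by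
    intro x hx
    rw [Real.ball_eq_Ioo]
    simp only [mem_Ioo, max_lt_iff, lt_min_iff] at hx
    exact ⟨⟨hx.1.1.le, hx.2.1.le⟩, hx.1.2, hx.2.2⟩
  have hlt : max (-1) (t - r) < min 1 (t + r) := by
    rw [max_lt_iff, lt_min_iff, lt_min_iff]
    refine ⟨⟨by norm_num, by linarith [ht.1]⟩, by linarith [ht.2], by linarith⟩
  refine (lt_of_lt_of_le ?_ (measure_mono hsub)).ne'
  rw [Real.volume_Ioo]
  exact ENNReal.ofReal_pos.mpr (sub_pos.mpr hlt)

/-- A set of full measure is dense in the parameter domain. -/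
theorem cube_subset_closure {P : (Fin M → ℝ) → Prop} (hP : ∀ᵐ y ∂paramLaw M, P y) :
    cube M ⊆ closure {y | y ∈ cube M ∧ P y} := by
  have := isProbabilityMeasure_cond_Icc
  intro y hy
  rw [Metric.mem_closure_iff]
  intro r hr
  -- Sup-norm balls are products of intervals, and an interval centred at a point of `[-1, 1]`, even
  -- an endpoint, meets `[-1, 1]` in positive length.
  have hpos : 0 < paramLaw M (Metric.ball y r) := by
    rw [ball_pi y hr, paramLaw, Measure.pi_pi]
    exact pos_iff_ne_zero.mpr (Finset.prod_ne_zero_iff.mpr fun i _ =>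
      (cond_Icc_ball_pos ⟨hy.1 i, hy.2 i⟩ hr).ne')
  have hfreq : ∃ᵐ z ∂paramLaw M, z ∈ Metric.ball y r := frequently_ae_iff.mpr hpos.ne'
  obtain ⟨z, hz, hzc, hzP⟩ := (hfreq.and_eventually (ae_mem_cube.and hP)).exists
  exact ⟨z, ⟨hzc, hzP⟩, by rw [dist_comm]; exact hz⟩

theorem memLp_top_of_continuousOn_cube {F : Type*} [NormedAddCommGroup F] {g : (Fin M → ℝ) → F}
    (hg : ContinuousOn g (cube M)) {C : ℝ} (hC : ∀ y ∈ cube M, ‖g y‖ ≤ C) :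
    MemLp g ∞ (paramLaw M) ∧ eLpNorm g ∞ (paramLaw M) ≤ ENNReal.ofReal C := by
  have hres : (paramLaw M).restrict (cube M) = paramLaw M :=
    Measure.restrict_eq_self_of_ae_mem ae_mem_cube
  have hm : AEStronglyMeasurable g (paramLaw M) := by
    rw [← hres]
    exact hg.aestronglyMeasurable measurableSet_Icc
  have hb : ∀ᵐ y ∂paramLaw M, ‖g y‖ ≤ C := ae_mem_cube.mono hC
  refine ⟨memLp_top_of_bound hm C hb, ?_⟩
  rw [eLpNorm_exponent_top]
  exact eLpNormEssSup_le_of_ae_bound hb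

end Law

/-! ### The parametric field -/

section Field

open Filter Topology

variable {d κ M : ℕ} {D : Opens (Vec d)} {σ : ℕ → ℝ} {ψ : ℕ → Sobolev D κ ∞ (Vec d)}

/-- The derivative of the field with respect to the parameters. -/
def fieldDeriv (σ : ℕ → ℝ) (ψ : ℕ → Sobolev D κ ∞ (Vec d)) (M : ℕ) :
    (Fin M → ℝ) →L[ℝ] Sobolev D κ ∞ (Vec d) :=
  ∑ k : Fin M, (ContinuousLinearMap.proj (R := ℝ) (φ := fun _ : Fin M => ℝ) k).smulRight
    (σ (k + 1) • ψ (k + 1))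

theorem field_eq (y : Fin M → ℝ) : field σ ψ y = ψ 0 + fieldDeriv σ ψ M y := by
  simp only [field, fieldDeriv, sum_apply,
    ContinuousLinearMap.smulRight_apply, ContinuousLinearMap.proj_apply, smul_smul, mul_comm]

theorem hasFDerivAt_field (y : Fin M → ℝ) :
    HasFDerivAt (fun y => field σ ψ y) (fieldDeriv σ ψ M) y := by
  simp only [field_eq]
  exact (fieldDeriv σ ψ M).hasFDerivAt.const_add _

theorem norm_fieldDeriv_single (k : Fin M) :
    ‖fieldDeriv σ ψ M (Pi.single k 1)‖ = gammaSeq σ ψ (k + 1) := by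
  have h : fieldDeriv σ ψ M (Pi.single k 1) = σ (k + 1) • ψ (k + 1) := by
    simp only [fieldDeriv, sum_apply, ContinuousLinearMap.smulRight_apply,
      ContinuousLinearMap.proj_apply]
    rw [Finset.sum_eq_single k (fun j _ hj => by simp [hj]) (by simp)]
    simp
  rw [h, gammaSeq]

theorem norm_field_le (hσ : σ 0 = 1) (hγ : Summable (gammaSeq σ ψ)) {y : Fin M → ℝ}
    (hy : y ∈ cube M) : ‖field σ ψ y‖ ≤ cGamma σ ψ := by
  have h1 : ‖field σ ψ y‖ ≤ ∑ k ∈ Finset.range (M + 1), gammaSeq σ ψ k := by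
    rw [Finset.sum_range_succ', add_comm, ← Fin.sum_univ_eq_sum_range
      (fun k => gammaSeq σ ψ (k + 1))]
    have h0 : gammaSeq σ ψ 0 = ‖ψ 0‖ := by rw [gammaSeq, hσ, one_smul]
    rw [field, h0]
    refine (norm_add_le _ _).trans (add_le_add le_rfl ((norm_sum_le _ _).trans ?_))
    refine Finset.sum_le_sum fun k _ => ?_
    rw [mul_comm, mul_smul, norm_smul]
    refine mul_le_of_le_one_left (norm_nonneg _) ?_
    rw [Real.norm_eq_abs, abs_le]
    exact ⟨hy.1 k, hy.2 k⟩
  exact (h1.trans (hγ.sum_le_tsum _ fun k _ => norm_nonneg _)).trans (le_max_left _ _)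

/-- The `W^{κ,∞}` norm controls the sup norm, so the lower bound survives in the limit. This carries
it from almost every parameter to every parameter in the cube. -/
theorem ae_le_norm_of_mem_closure {aLow : ℝ} {S : Set (Sobolev D κ ∞ (Vec d))}
    (hS : ∀ V ∈ S, ∀ᵐ x ∂vol D, aLow ≤ ‖V.toLp x‖) {V : Sobolev D κ ∞ (Vec d)}
    (hV : V ∈ closure S) : ∀ᵐ x ∂vol D, aLow ≤ ‖V.toLp x‖ := by
  have h1 : ∀ n : ℕ, ∀ᵐ x ∂vol D, aLow - 1 / ((n : ℝ) + 1) ≤ ‖V.toLp x‖ := by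
    intro n
    obtain ⟨W, hW, hd⟩ := Metric.mem_closure_iff.mp hV (1 / ((n : ℝ) + 1)) Nat.one_div_pos_of_nat
    rw [dist_eq_norm] at hd
    have h2 : (V - W).toLp = V.toLp - W.toLp := rfl
    have h3 := (V - W).ae_norm_toLp_le
    rw [h2] at h3
    filter_upwards [hS W hW, h3, Lp.coeFn_sub V.toLp W.toLp] with x h4 h5 h6
    rw [h6, Pi.sub_apply] at h5
    have h7 := norm_sub_norm_le (W.toLp x) (V.toLp x)
    rw [norm_sub_rev] at h7
    linarith
  filter_upwards [ae_all_iff.mpr h1] with x hx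
  refine le_of_forall_pos_sub_le fun δ hδ => ?_
  obtain ⟨n, hn⟩ := exists_nat_one_div_lt hδ
  linarith [hx n]

/-- With `t` the squared length of the projection of `ξ` onto `v`, the quadratic form is `a (|ξ|² -
t) + |v| t`, where `0 ≤ t ≤ |ξ|²` and both `a` and `|v|` lie in `[aLow, aUp]`. -/
theorem diffusionMatrix_elliptic {aLow aUp a : ℝ} (hLow : 0 < aLow) (haLow : aLow ≤ a)
    (haUp : a ≤ aUp) {v : Vec d} (h1 : aLow ≤ ‖v‖) (h2 : ‖v‖ ≤ aUp) :
    IsSelfAdjoint (diffusionMatrix a v) ∧ ∀ ξ : Vec d,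
      aLow * ‖ξ‖ ^ 2 ≤ inner ℝ (diffusionMatrix a v ξ) ξ ∧
        inner ℝ (diffusionMatrix a v ξ) ξ ≤ aUp * ‖ξ‖ ^ 2 := by
  have hv : 0 < ‖v‖ := hLow.trans_le h1
  refine ⟨?_, fun ξ => ?_⟩
  · rw [ContinuousLinearMap.isSelfAdjoint_iff_isSymmetric]
    intro ξ η
    simp only [diffusionMatrix, ContinuousLinearMap.coe_coe, add_apply, smul_apply,
      ContinuousLinearMap.id_apply, InnerProductSpace.rankOne_apply, inner_add_left,
      inner_add_right, real_inner_smul_left, real_inner_smul_right, real_inner_comm v]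
    ring
  · set t := inner ℝ v ξ ^ 2 / ‖v‖ ^ 2 with ht
    have ht0 : 0 ≤ t := by positivity
    have ht1 : t ≤ ‖ξ‖ ^ 2 := by
      rw [ht, div_le_iff₀ (by positivity), ← mul_pow, mul_comm]
      exact sq_le_sq' (by linarith [neg_le_of_abs_le (abs_real_inner_le_norm v ξ)])
        (real_inner_le_norm v ξ)
    have h3 : inner ℝ (diffusionMatrix a v ξ) ξ = a * (‖ξ‖ ^ 2 - t) + ‖v‖ * t := by
      simp only [diffusionMatrix, add_apply, smul_apply, ContinuousLinearMap.id_apply,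
        InnerProductSpace.rankOne_apply, inner_add_left, real_inner_smul_left,
        real_inner_self_eq_norm_sq]
      rw [ht]
      field_simp
      ring
    rw [h3]
    constructor <;> nlinarith

/-- Continuity on a compact interval makes the image bounded above, so that the supremum really
dominates. -/
theorem le_maxCer {Cer : ℝ → ℝ} (h : ContinuousOn Cer (Ici 0)) {s S : ℝ} (h0 : 0 ≤ s)
    (hs : s ≤ S) : Cer s ≤ maxCer Cer S :=
  le_csSup (isCompact_Icc.image_of_continuousOn (h.mono Icc_subset_Ici_self)).bddAbove
    ⟨s, ⟨h0, hs⟩, rfl⟩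

theorem IsWeakSolution.congr {A B : Vec d → Mat d} (hAB : A =ᵐ[vol D] B) {h : Vec d → ℝ}
    {u : Sobolev D 1 2 ℝ} (hu : IsWeakSolution D A h u) : IsWeakSolution D B h u := by
  refine ⟨hu.1, fun v hv => ?_⟩
  rw [← hu.2 v hv]
  refine integral_congr_ae ?_
  filter_upwards [hAB] with x hx
  rw [hx]

end Field

/-! ### Regularity of the solution in the parameters -/

section Solution

open Filter Topology
open scoped Nat

variable {d m M : ℕ} {D : Opens (Vec d)} {aLow aUp a c : ℝ}

/-- The coefficient `a I + (‖V‖ - a) V Vᵀ / (Vᵀ V)` as an element of `W^{m+1,∞}`. -/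
theorem toLp_const_add_anisoPart (hc : 2 ≤ c) (hLow : 0 < aLow) (hLow1 : aLow ≤ 1)
    {V : Sobolev D (m + 1) ∞ (Vec d)} (hV : ‖V‖ ≤ c) (hV' : ∀ᵐ x ∂vol D, aLow ≤ ‖V.toLp x‖) :
    (Sobolev.const (a • ContinuousLinearMap.id ℝ (Vec d)) +
      anisoPart (weight_le_one hc hLow hLow1) c a V).toLp =ᵐ[vol D]
      fun x => diffusionMatrix a (V.toLp x) := by
  rw [Sobolev.toLp_add]
  filter_upwards [Lp.coeFn_add (Sobolev.const (a • ContinuousLinearMap.id ℝ (Vec d)) :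
      Sobolev D (m + 1) ∞ (Mat d)).toLp (anisoPart (weight_le_one hc hLow hLow1) c a V).toLp,
    Sobolev.toLp_const (D := D) (k := m + 1) (a • ContinuousLinearMap.id ℝ (Vec d)),
    toLp_anisoPart (a := a) (weight_le_one hc hLow hLow1) (by linarith) hV
      (mem_projData_dom hc hLow hLow1 hV hV')] with x h1 h2 h3
  rw [h1, Pi.add_apply, h2, h3]
  rfl

/-- The solution operator as a function of the vector field. -/
def solve (hc : 2 ≤ c) (hLow : 0 < aLow) (hLow1 : aLow ≤ 1) (a : ℝ) (f : Sobolev D m 2 ℝ)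
    (V : Sobolev D (m + 1) ∞ (Vec d)) : regSub D m :=
  (dirichletOp D m (Sobolev.const (a • ContinuousLinearMap.id ℝ (Vec d)) +
    anisoPart (weight_le_one hc hLow hLow1) c a V)).inverse f

/-- The vector fields for which the Dirichlet problem is uniquely solvable. -/
def solveDomain (D : Opens (Vec d)) (m : ℕ) (hc : 2 ≤ c) (hLow : 0 < aLow) (hLow1 : aLow ≤ 1)
    (a : ℝ) : Set (Sobolev D (m + 1) ∞ (Vec d)) :=
  invDomain (dirichletOp D m) (Sobolev.const (a • ContinuousLinearMap.id ℝ (Vec d)))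
    (anisoPart (weight_le_one hc hLow hLow1) c a) ((projData (weight_le_one hc hLow hLow1)).dom c)

theorem isOpen_solveDomain (hc : 2 ≤ c) (hLow : 0 < aLow) (hLow1 : aLow ≤ 1) :
    IsOpen (solveDomain D m hc hLow hLow1 a) :=
  isOpen_invDomain (ProjData.isOpen_dom _ c) (contDiffOn_anisoPart _)

theorem contDiffOn_solve (hc : 2 ≤ c) (hLow : 0 < aLow) (hLow1 : aLow ≤ 1)
    (f : Sobolev D m 2 ℝ) :
    ContDiffOn ℝ (⊤ : ℕ∞) (solve hc hLow hLow1 a f) (solveDomain D m hc hLow hLow1 a) :=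
  (ContinuousLinearMap.apply ℝ (regSub D m) f).contDiff.comp_contDiffOn
    (contDiffOn_inverse (contDiffOn_anisoPart _))

theorem derivBound_solve (hc : 2 ≤ c) (hLow : 0 < aLow) (hLow1 : aLow ≤ 1) (ha : |a| ≤ aUp)
    (hUp : 1 ≤ aUp) (f : Sobolev D m 2 ℝ) {V : Sobolev D (m + 1) ∞ (Vec d)} (hV : ‖V‖ ≤ c)
    (hV' : ∀ᵐ x ∂vol D, aLow ≤ ‖V.toLp x‖) (hmem : V ∈ solveDomain D m hc hLow hLow1 a)
    {C : ℝ} (hC : ‖(dirichletOp D m (Sobolev.const (a • ContinuousLinearMap.id ℝ (Vec d)) +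
      anisoPart (weight_le_one hc hLow hLow1) c a V)).inverse‖ ≤ C) :
    DerivBound (solve hc hLow hLow1 a f) V (‖f‖ * C)
      ((1 + C * (d ^ 2 * ((m + 1) * (m + 2)) *
        ((4 * c ^ 2 / aLow ^ 2) ^ (m + 1) * (4 * c ^ 3 * aUp / aLow ^ 2)))) *
          (4 * c ^ 2 / aLow ^ 2)) := by
  refine (derivBound_inverse (ProjData.isOpen_dom _ c) (contDiffOn_anisoPart _) hmem
    norm_dirichletOp_le (by positivity)
    (derivBound_anisoPart hc hLow hLow1 ha hUp hV hV') hC).clm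
    (ContinuousLinearMap.apply ℝ (regSub D m) f) (isOpen_solveDomain hc hLow hLow1) hmem
    (contDiffOn_inverse (contDiffOn_anisoPart _)) ?_
  exact ContinuousLinearMap.opNorm_le_bound _ (norm_nonneg _) fun T => by
    rw [mul_comm]; exact T.le_opNorm f

theorem log_two_le_one : Real.log 2 ≤ 1 := by
  have := Real.log_two_lt_d9
  linarith

/-- The arithmetic behind the final bound. -/
theorem solution_bound_le (hc : 2 ≤ c) (hLow : 0 < aLow) (hLow1 : aLow ≤ 1) (hUp : 1 ≤ aUp)
    {C₀ K F Γ Γ' : ℝ} (hK2 : 2 ≤ K)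
    (hKA : 2 * C₀ * ((m + 1 : ℕ) : ℝ) ^ 2 * (d : ℝ) ^ 2 * kA (m + 1) aLow aUp c ≤ K)
    (hKF : C₀ * F ≤ K) (n : ℕ) (hΓ : 0 ≤ Γ)
    (hΓ' : Γ' = (4 * c ^ 2 / (aLow ^ 2 * Real.log 2)) ^ n * Γ) :
    n ! * (F * max C₀ 0) * ((1 + max C₀ 0 * (d ^ 2 * ((m + 1) * (m + 2)) *
        ((4 * c ^ 2 / aLow ^ 2) ^ (m + 1) * (4 * c ^ 3 * aUp / aLow ^ 2)))) *
          (4 * c ^ 2 / aLow ^ 2)) ^ n * Γ ≤ n ! * Γ' * K ^ (n + 1) := by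
  have hc0 : 0 < c := by linarith
  set C := max C₀ 0
  have hC0 : 0 ≤ C := le_max_right _ _
  set τ := 4 * c ^ 2 / aLow ^ 2 with hτ
  set q := τ ^ (m + 1) * (4 * c ^ 3 * aUp / aLow ^ 2) with hq
  have hτ0 : 0 < τ := by positivity
  have hq0 : 0 ≤ q := by positivity
  have hqk : 2 * q ≤ kA (m + 1) aLow aUp c :=
    two_mul_coefficient_bound_le_kA (Nat.succ_le_succ (Nat.zero_le m)) hc hLow hLow1 hUp
  -- The sign of `C₀` is unknown. Replacing it by its positive part is harmless because `K ≥ 2`.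
  have hKF' : F * C ≤ K := by
    rcases le_total C₀ 0 with h | h
    · have : C = 0 := max_eq_right h
      rw [this, mul_zero]; linarith
    · have : C = C₀ := max_eq_left h
      rw [this, mul_comm]; exact hKF
  have hKA' : 2 * C * ((m + 1 : ℕ) : ℝ) ^ 2 * (d : ℝ) ^ 2 * kA (m + 1) aLow aUp c ≤ K := by
    rcases le_total C₀ 0 with h | h
    · have : C = 0 := max_eq_right h
      rw [this]; simp; linarith
    · have : C = C₀ := max_eq_left h
      rw [this]; exact hKA
  -- Half of `K` covers the one. The other half covers the operator term, by `(m + 1)(m + 2) ≤ 2 (m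
  -- + 1)²` and `2q ≤ kA`.
  have h1 : 1 + C * (d ^ 2 * ((m + 1) * (m + 2)) * q) ≤ K := by
    have h2 : C * ((d : ℝ) ^ 2 * ((m + 1) * (m + 2)) * q) ≤
        C * (m + 1) ^ 2 * (d : ℝ) ^ 2 * (2 * q) := by
      have h3 : ((m : ℝ) + 1) * (m + 2) ≤ (m + 1) ^ 2 * 2 := by nlinarith [Nat.cast_nonneg (α := ℝ) m]
      calc C * ((d : ℝ) ^ 2 * ((m + 1) * (m + 2)) * q)
          ≤ C * ((d : ℝ) ^ 2 * ((m + 1) ^ 2 * 2) * q) := by gcongr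
        _ = _ := by ring
    have h4 : C * (m + 1) ^ 2 * (d : ℝ) ^ 2 * (2 * q) ≤
        C * (m + 1) ^ 2 * (d : ℝ) ^ 2 * kA (m + 1) aLow aUp c := by gcongr
    push_cast at hKA'
    linarith
  have hlog : 0 < Real.log 2 := Real.log_pos one_lt_two
  have hτ_le : τ ≤ 4 * c ^ 2 / (aLow ^ 2 * Real.log 2) := by
    rw [hτ]
    gcongr
    exact mul_le_of_le_one_right (by positivity) log_two_le_one
  have hK0 : 0 ≤ K := by linarith
  rw [hΓ']
  calc n ! * (F * C) * ((1 + C * (d ^ 2 * ((m + 1) * (m + 2)) * q)) * τ) ^ n * Γ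
      ≤ n ! * K * (K * (4 * c ^ 2 / (aLow ^ 2 * Real.log 2))) ^ n * Γ := by
        gcongr
    _ = _ := by rw [mul_pow]; ring

/-- The smooth version of the solution, with bounds for its derivatives. -/
theorem exists_smooth_solution (hLow : 0 < aLow) (hLow1 : aLow ≤ 1) (hUp1 : 1 ≤ aUp)
    (haLow : aLow ≤ a) (haUp : a ≤ aUp) {σ : ℕ → ℝ} {ψ : ℕ → Sobolev D (m + 1) ∞ (Vec d)}
    (hσ : σ 0 = 1) (hγ : Summable (gammaSeq σ ψ))
    (hV : ∀ᵐ y ∂paramLaw M, ∀ᵐ x ∂vol D,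
      aLow ≤ ‖(field σ ψ y).toLp x‖ ∧ ‖(field σ ψ y).toLp x‖ ≤ aUp)
    {R : Type*} [NormedAddCommGroup R] [NormedSpace ℝ R]
    {ι : R →ₗ[ℝ] (Vec d →ₘ[vol D] Mat d)} {Cer : ℝ → ℝ}
    (hEr : EllipticRegularity D (m + 1) aLow aUp ι Cer)
    {AR : (Fin M → ℝ) → R} (hAR : MemLp AR ∞ (paramLaw M))
    (hA : ∀ᵐ y ∂paramLaw M, ι (AR y) =ᵐ[vol D] coeff a σ ψ y)
    (f : Sobolev D m 2 ℝ) {u : (Fin M → ℝ) → Sobolev D 1 2 ℝ}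
    (hsol : ∀ᵐ y ∂paramLaw M, IsWeakSolution D (coeff a σ ψ y) f.toLp (u y)) :
    ∃ U : (Fin M → ℝ) → Sobolev D (m + 2) 2 ℝ,
      (∀ᵐ y ∂paramLaw M, (U y).toLp = (u y).toLp) ∧
      ContDiffOn ℝ (⊤ : ℕ∞) U (cube M) ∧
      ∀ α : Fin M → ℕ,
        MemLp (paramDeriv (cube M) α U) ∞ (paramLaw M) ∧
        eLpNorm (paramDeriv (cube M) α U) ∞ (paramLaw M) ≤
          ENNReal.ofReal (((∑ k, α k)! : ℝ) *
            (∏ k : Fin M, muSeq aLow σ ψ (k + 1) ^ α k) *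
            (max 2 (max
              (2 * maxCer Cer (eLpNorm AR ∞ (paramLaw M)).toReal * ((m + 1 : ℕ) : ℝ) ^ 2 *
                (d : ℝ) ^ 2 * kA (m + 1) aLow aUp (cGamma σ ψ))
              (maxCer Cer (eLpNorm AR ∞ (paramLaw M)).toReal * ‖f‖))) ^ ((∑ k, α k) + 1)) := by
  set c := cGamma σ ψ with hcdef
  have hc : 2 ≤ c := le_max_right _ _
  have hc0 : 0 < c := by linarith
  have ha : |a| ≤ aUp := by rw [abs_of_nonneg (by linarith)]; exact haUp
  set C₀ := maxCer Cer (eLpNorm AR ∞ (paramLaw M)).toReal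
  set b : Sobolev D (m + 1) ∞ (Mat d) := Sobolev.const (a • ContinuousLinearMap.id ℝ (Vec d))
  set 𝒜 : Sobolev D (m + 1) ∞ (Vec d) → Sobolev D (m + 1) ∞ (Mat d) :=
    anisoPart (weight_le_one hc hLow hLow1) c a
  let V : (Fin M → ℝ) → Sobolev D (m + 1) ∞ (Vec d) := fun y => field σ ψ y
  have hVc : Continuous V :=
    continuous_iff_continuousAt.mpr fun y => (hasFDerivAt_field y).continuousAt
  have hVn : ∀ y ∈ cube M, ‖V y‖ ≤ c := fun y hy => norm_field_le hσ hγ hy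
  -- The hypothesis covers only almost every `y`, but such parameters are dense in the cube and `V`
  -- is continuous.
  have hVl : ∀ y ∈ cube M, ∀ᵐ x ∂vol D, aLow ≤ ‖(V y).toLp x‖ := by
    intro y hy
    have h1 := cube_subset_closure hV hy
    refine ae_le_norm_of_mem_closure (S := V '' {y | y ∈ cube M ∧ ∀ᵐ x ∂vol D,
      aLow ≤ ‖(V y).toLp x‖ ∧ ‖(V y).toLp x‖ ≤ aUp}) ?_
      (image_closure_subset_closure_image hVc ⟨y, h1, rfl⟩)
    rintro _ ⟨z, hz, rfl⟩
    exact hz.2.mono fun x hx => hx.1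
  have hdom : ∀ y ∈ cube M, V y ∈ (projData (weight_le_one hc hLow hLow1)).dom c :=
    fun y hy => mem_projData_dom hc hLow hLow1 (hVn y hy) (hVl y hy)
  have hcoef : ∀ y ∈ cube M, (b + 𝒜 (V y)).toLp =ᵐ[vol D] coeff a σ ψ y :=
    fun y hy => toLp_const_add_anisoPart hc hLow hLow1 (hVn y hy) (hVl y hy)
  have hgood : ∀ᵐ y ∂paramLaw M, (∀ᵐ x ∂vol D, aLow ≤ ‖(V y).toLp x‖ ∧ ‖(V y).toLp x‖ ≤ aUp) ∧
      ι (AR y) =ᵐ[vol D] coeff a σ ψ y ∧ ‖AR y‖ ≤ (eLpNorm AR ∞ (paramLaw M)).toReal := by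
    filter_upwards [hV, hA, ae_norm_le_toReal_eLpNorm hAR] with y h1 h2 h3 using ⟨h1, h2, h3⟩
  have hell : ∀ y ∈ cube M, (∀ᵐ x ∂vol D, aLow ≤ ‖(V y).toLp x‖ ∧ ‖(V y).toLp x‖ ≤ aUp) →
      UniformlyElliptic D aLow aUp (b + 𝒜 (V y)).toLp := by
    intro y hy h
    filter_upwards [h, hcoef y hy] with x h1 h2
    rw [h2]
    exact diffusionMatrix_elliptic hLow haLow haUp h1.1 h1.2
  have hTc : ContinuousOn (fun y => dirichletOp D m (b + 𝒜 (V y))) (cube M) :=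
    (contDiffOn_operator (contDiffOn_anisoPart _)).continuousOn.comp hVc.continuousOn hdom
  have hinv : ∀ y ∈ cube M, (dirichletOp D m (b + 𝒜 (V y))).IsInvertible ∧
      ‖(dirichletOp D m (b + 𝒜 (V y))).inverse‖ ≤ max C₀ 0 := by
    intro y hy
    -- Elliptic regularity applies only where the coefficient is known to lie in `R`. Density and
    -- the uniform bound extend invertibility to every point of the cube, as smoothness up to the
    -- boundary demands.
    refine isInvertible_of_dense hTc (fun y hy => hy.1) (cube_subset_closure hgood)
      (le_max_right _ _) ?_ hy
    rintro z ⟨hz, h1, h2, h3⟩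
    obtain ⟨h4, h5⟩ := hEr.dirichletOp (b + 𝒜 (V z)) (AR z) (h2.trans (hcoef z hz).symm)
      (hell z hz h1)
    refine ⟨h4, fun w => (h5 w).trans (mul_le_mul_of_nonneg_right ?_ (norm_nonneg _))⟩
    exact (le_maxCer hEr.1 (norm_nonneg _) h3).trans (le_max_left _ _)
  have hmem : ∀ y ∈ cube M, V y ∈ solveDomain D m hc hLow hLow1 a :=
    fun y hy => ⟨hdom y hy, (hinv y hy).1⟩
  let g : Sobolev D (m + 1) ∞ (Vec d) → Sobolev D (m + 2) 2 ℝ :=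
    fun v => (regSub D m).subtypeL (solve hc hLow hLow1 a f v)
  have hopen := isOpen_solveDomain (D := D) (m := m) (a := a) hc hLow hLow1
  have hsolve := contDiffOn_solve (a := a) hc hLow hLow1 f
  have hg : ContDiffOn ℝ (⊤ : ℕ∞) g (solveDomain D m hc hLow hLow1 a) :=
    (regSub D m).subtypeL.contDiff.comp_contDiffOn hsolve
  refine ⟨fun y => g (V y), ?_, ?_, fun α => ?_⟩
  · filter_upwards [ae_mem_cube, hgood, hsol] with y hy hy1 hy2
    have h1 : ellipticOp D m (b + 𝒜 (V y)) (g (V y)) = f := by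
      have := ContinuousLinearMap.IsInvertible.self_apply_inverse (hinv y hy).1 f
      exact this
    have h2 := (isWeakSolution_iff (b + 𝒜 (V y)) (g (V y)) f).mpr
      ⟨(solve hc hLow hLow1 a f (V y)).2, h1⟩
    have h3 : IsWeakSolution D (b + 𝒜 (V y)).toLp f.toLp (u y) := hy2.congr (hcoef y hy).symm
    obtain ⟨w, -, hw, -⟩ := hEr.2 (b + 𝒜 (V y)) (AR y) (hy1.2.1.trans (hcoef y hy).symm)
      (hell y hy hy1.1) f
    -- The given and the constructed solution solve the same problem, hence both equal the unique
    -- one.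
    rw [hw _ h3, ← hw _ h2, Sobolev.toLp_restrictL]
  · have hVd : ContDiff ℝ (⊤ : ℕ∞) V := by
      simp only [V, field_eq]
      exact contDiff_const.add (fieldDeriv σ ψ M).contDiff
    exact hg.comp hVd.contDiffOn hmem
  · obtain ⟨hcont, hbound⟩ := norm_paramDeriv_le hopen hg
      (fun y => hasFDerivAt_field (σ := σ) (ψ := ψ) y) hmem α
    refine memLp_top_of_continuousOn_cube hcont fun y hy => (hbound y hy).trans ?_
    have hD := derivBound_solve hc hLow hLow1 ha hUp1 f (hVn y hy) (hVl y hy) (hmem y hy)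
      (hinv y hy).2
    have hD' := hD.clm (regSub D m).subtypeL hopen (hmem y hy) hsolve
      (Submodule.norm_subtypeL_le _)
    rw [one_mul] at hD'
    refine (mul_le_mul_of_nonneg_right (hD' (∑ k, α k))
      (Finset.prod_nonneg fun k _ => by positivity)).trans ?_
    simp only [norm_fieldDeriv_single]
    refine solution_bound_le hc hLow hLow1 hUp1 (le_max_left _ _)
      ((le_max_left _ _).trans (le_max_right _ _)) ((le_max_right _ _).trans (le_max_right _ _))
      _ (Finset.prod_nonneg fun k _ => pow_nonneg (norm_nonneg _) _) ?_
    -- The common factor of the `μ_{κ,k}` comes out of the product with exponent `|α|`, leaving the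
    -- product of the `γ_{κ,k}`.
    simp only [muSeq, mul_pow, Finset.prod_mul_distrib, Finset.prod_pow_eq_pow_sum]
    rfl

end Solution

end AnisoDiff

end

open AnisoDiff in
theorem theorem3p10 {d : ℕ} (hd : 1 ≤ d) (D : Opens (Vec d)) (κ : ℕ) (hκ : 1 ≤ κ)
    (aLow aUp a : ℝ) (hLow : 0 < aLow) (hLow1 : aLow ≤ 1) (hUp1 : 1 ≤ aUp)
    (haLow : aLow ≤ a) (haUp : a ≤ aUp)
    -- decay of the expansion and uniform ellipticity
    (σ : ℕ → ℝ) (ψ : ℕ → Sobolev D κ ∞ (Vec d)) (hσ : σ 0 = 1) (hγ : Summable (gammaSeq σ ψ))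
    (M : ℕ)
    (hV : ∀ᵐ y ∂paramLaw M, ∀ᵐ x ∂vol D,
      aLow ≤ ‖(field σ ψ y).toLp x‖ ∧ ‖(field σ ψ y).toLp x‖ ≤ aUp)
    -- elliptic regularity
    {R : Type*} [NormedAddCommGroup R] [NormedSpace ℝ R] [CompleteSpace R]
    (ι : R →ₗ[ℝ] (Vec d →ₘ[vol D] Mat d)) (hι : Function.Injective ι) (Cer : ℝ → ℝ)
    (hEr : EllipticRegularity D κ aLow aUp ι Cer)
    -- the coefficient `A` as an element of `L^∞(□; R)`
    (AR : (Fin M → ℝ) → R) (hAR : MemLp AR ∞ (paramLaw M))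
    (hA : ∀ᵐ y ∂paramLaw M, ι (AR y) =ᵐ[vol D] coeff a σ ψ y)
    -- the source and the solution
    (f : Sobolev D (κ - 1) 2 ℝ) (u : (Fin M → ℝ) → Sobolev D 1 2 ℝ)
    (hu : MemLp u ∞ (paramLaw M))
    (hsol : ∀ᵐ y ∂paramLaw M, IsWeakSolution D (coeff a σ ψ y) f.toLp (u y)) :
    ∃ U : (Fin M → ℝ) → Sobolev D (κ + 1) 2 ℝ,
      (∀ᵐ y ∂paramLaw M, (U y).toLp = (u y).toLp) ∧
      ContDiffOn ℝ (⊤ : ℕ∞) U (cube M) ∧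
      ∀ α : Fin M → ℕ,
        MemLp (paramDeriv (cube M) α U) ∞ (paramLaw M) ∧
        eLpNorm (paramDeriv (cube M) α U) ∞ (paramLaw M) ≤
          ENNReal.ofReal (((∑ k, α k).factorial : ℝ) *
            (∏ k : Fin M, muSeq aLow σ ψ (k + 1) ^ α k) *
            (max 2 (max
              (2 * maxCer Cer (eLpNorm AR ∞ (paramLaw M)).toReal * (κ : ℝ) ^ 2 * (d : ℝ) ^ 2 *
                kA κ aLow aUp (cGamma σ ψ))
              (maxCer Cer (eLpNorm AR ∞ (paramLaw M)).toReal * ‖f‖))) ^ ((∑ k, α k) + 1)) := by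
  -- Writing `κ = m + 1` removes the truncated subtraction in `H^{κ-1}`.
  obtain ⟨m, rfl⟩ : ∃ m, κ = m + 1 := ⟨κ - 1, by omega⟩
  exact exists_smooth_solution hLow hLow1 hUp1 haLow haUp hσ hγ hV hEr hAR hA f hsol
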